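/- Let $N\ge 1$ be an integer, let $a\ge b\ge -\tfrac12$ be real, and put $\epsilon=\frac{a+b+1}{2}\ge 0$, $\widehat x=(x+\epsilon)^2$, $\mathbb Z_+^{\epsilon}=\{\widehat x: x=0,1,2,\dots\}$. Let $\mathcal Z\subset\mathbb C^2$ be the set of pairs $(z,z')$ such that one of the following holds: $z'=\overline z$ with $(z,z')\notin\mathbb R^2$; or $z,z'$ are real and $n<z,z'<n+1$ for some $n\in\mathbb Z$; or $z,z'$ are real and, for some integer $n\ge1$, $z=n,\ z'>n-1$ or $z'=n,\ z>n-1$. Let $(z,z')$ be admissible: $\Sigma:=z+z'+b$ satisfies $\Re\Sigma>-1$, and both $(z,z')$ and $(z+2\epsilon,z'+2\epsilon)$ lie in $\mathcal Z$ (so $\Sigma$ is real). For $x=0,1,2,\dots$ let $$W(\widehat x)=\frac{(x+\epsilon)\,\Gamma(x+2\epsilon)\Gamma(x+a+1)}{\Gamma(x+1)\Gamma(x+b+1)}\cdot\frac{1}{\Gamma(z-x+N)\Gamma(z'-x+N)\Gamma(z+x+N+2\epsilon)\Gamma(z'+x+N+2\epsilon)},$$ where $1/\Gamma$ is the entire function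 and, for $x=\epsilon=0$, $(x+\epsilon)\Gamma(x+2\epsilon)$ means $\tfrac12$. For integers $\lambda_1\ge\dots\ge\lambda_N\ge0$ put $l_i=\lambda_i+N-i$. Let $\mathcal O^{(N)}$ be the random subset $\{\widehat{l}_1,\dots,\widehat{l}_N\}$ of $\mathbb Z_+^{\epsilon}$, where $\lambda$ has probability proportional to $\prod_{i<j}(\widehat l_i-\widehat l_j)^2\prod_{i}W(\widehat l_i)$ (the BC type $z$-measure of level $N$). Write $(c)_k=c(c+1)\cdots(c+k-1)$ and ${}_4F_3(1)$ for the generalized hypergeometric series at $1$. Let $\mathfrak p_N$ and $\mathfrak p_{N-1}$ be the cases $n=N$ (for $\Sigma\ne0$) and $n=N-1$ of the polynomials in $\widehat x$ $$\mathfrak p_n(\widehat x)=\frac{(1+a)_n(1-z-N)_n(1-z'-N)_n}{(n+1-2N-\Sigma)_n}\;{}_4F_3\!\left[{-n,\ n+1-2N-\Sigma,\ x+2\epsilon,\ -x\atop 1+a,\ 1-z-N,\ 1-z'-N};1\right],$$ let $$h_{N-1}=\frac12\cdot\frac{\Gamma(N+a)\Gamma(N)\Gamma(\Sigma+1)\Gamma(\Sigma+2)}{\Gamma(N+\Sigma+a+1)\Gamma(N+\Sigma+1)\Gamma(1+z)\Gamma(1+z')\Gamma(1+z+b)\Gamma(1+z'+b)},$$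 and let $\widetilde{\mathfrak p}_N$ be the polynomial in $\widehat x$ whose values for integers $x\ge N$ are $$\widetilde{\mathfrak p}_N(\widehat x)=\frac{\Gamma(x+1)\Gamma(x+N+2\epsilon)}{\Gamma(x+2\epsilon)\Gamma(x-N+1)}\;{}_4F_3\!\left[{-N,\ -N-a,\ z,\ z'\atop \Sigma+1,\ x-N+1,\ -x-N-a-b};1\right].$$ Then: 1. $W$ is real and nonnegative on $\mathbb Z_+^{\epsilon}$, and $\mathcal O^{(N)}$ is a well-defined random configuration, an orthogonal polynomial ensemble with weight $W$: it has $N$ points almost surely, and for some constant $c>0$ every set of $N$ distinct points satisfies $\mathbb P(\mathcal O^{(N)}=\{\widehat x_1,\dots,\widehat x_N\})=c\prod_{i<j}|\widehat x_i-\widehat x_j|^2\prod_iW(\widehat x_i)$. 2. $\mathfrak p_{N-1}$ is the monic orthogonal polynomial of degree $N-1$ for the weight $W$ on $\mathbb Z_+^\epsilon$, with squared norm $\sum_{x\ge0}\mathfrak p_{N-1}(\widehat x)^2W(\widehat x)=h_{N-1}\neq0$; if $\Sigma>0$, then $\mathfrak p_N$ is the monic orthogonal polynomial of degree $N$. 3.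 If $\Sigma\ne0$, then $$K(\widehat x,\widehat y)=\frac{\sqrt{W(\widehat x)W(\widehat y)}}{h_{N-1}}\cdot\frac{\mathfrak p_N(\widehat x)\mathfrak p_{N-1}(\widehat y)-\mathfrak p_{N-1}(\widehat x)\mathfrak p_N(\widehat y)}{\widehat x-\widehat y}\qquad(\widehat x,\widehat y\in\mathbb Z_+^\epsilon)$$ (with the limit value of the polynomial quotient for $\widehat x=\widehat y$) is a correlation kernel of $\mathcal O^{(N)}$: for all $m$ and all distinct $\widehat x_1,\dots,\widehat x_m\in\mathbb Z_+^\epsilon$, $\mathbb P(\{\widehat x_1,\dots,\widehat x_m\}\subseteq\mathcal O^{(N)})=\det[K(\widehat x_i,\widehat x_j)]_{i,j=1}^m$. 4. For every admissible $(z,z')$, including those with $\Sigma=0$, the same formula with $\widetilde{\mathfrak p}_N$ in place of $\mathfrak p_N$ is a real-valued correlation kernel of $\mathcal O^{(N)}$, and for $\Sigma\neq0$ it equals $K$. -/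

import Mathlib

open MeasureTheory Polynomial

namespace ZMeas

noncomputable section

/-! ### Parameters -/

/-- `ε = (a + b + 1) / 2`. -/
def eps (a b : ℝ) : ℝ := (a + b + 1) / 2

/-- `Σ = z + z' + b`. -/
def sig (z z' : ℂ) (b : ℝ) : ℂ := z + z' + b

/-- Principal series: non-real pairs of complex conjugates. -/
def Zprinc : Set (ℂ × ℂ) :=
  {p | ¬ (p.1.im = 0 ∧ p.2.im = 0) ∧ p.2 = (starRingEnd ℂ) p.1}

/-- Complementary series: real pairs lying in a common open interval `(n, n + 1)`. -/
def Zcompl : Set (ℂ × ℂ) :=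
  {p | p.1.im = 0 ∧ p.2.im = 0 ∧
    ∃ n : ℤ, (n : ℝ) < p.1.re ∧ p.1.re < n + 1 ∧ (n : ℝ) < p.2.re ∧ p.2.re < n + 1}

/-- Degenerate series: real pairs, one entry being an integer `n ≥ 1`, the other one `> n - 1`. -/
def Zdegen : Set (ℂ × ℂ) :=
  {p | p.1.im = 0 ∧ p.2.im = 0 ∧
    ∃ n : ℕ, 1 ≤ n ∧
      ((p.1.re = n ∧ (n : ℝ) - 1 < p.2.re) ∨ (p.2.re = n ∧ (n : ℝ) - 1 < p.1.re))}

/-- Admissible pairs `(z, z')`. -/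
def Admissible (z z' : ℂ) (a b : ℝ) : Prop :=
  -1 < (sig z z' b).re ∧
  (z, z') ∈ Zprinc ∪ Zcompl ∪ Zdegen ∧
  (z + 2 * (eps a b : ℂ), z' + 2 * (eps a b : ℂ)) ∈ Zprinc ∪ Zcompl ∪ Zdegen

/-! ### The quadratic half-lattice and the weight -/

/-- `x̂ = (x + ε)²`. -/
def hat (a b : ℝ) (x : ℕ) : ℝ := ((x : ℝ) + eps a b) ^ 2

/-- The quadratic half-lattice `{(n + ε)² : n = 0, 1, 2, …}`. -/
def HalfLattice (a b : ℝ) : Set ℝ := Set.range (hat a b)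

/-- The point of the half-lattice with label `x`. -/
def pt (a b : ℝ) (x : ℕ) : HalfLattice a b := ⟨hat a b x, x, rfl⟩

/-- For `ε ≥ 0` the labelling of the lattice points by nonnegative integers is bijective. -/
lemma pt_bijective {a b : ℝ} (h : 0 ≤ eps a b) : Function.Bijective (pt a b) := by
  constructor
  · intro x y hxy
    have h1 : hat a b x = hat a b y := congrArg Subtype.val hxy
    unfold hat at h1
    have hx : (0 : ℝ) ≤ (x : ℝ) + eps a b := by positivity
    have hy : (0 : ℝ) ≤ (y : ℝ) + eps a b := by positivity
    have h2 := (pow_left_inj₀ hx hy two_ne_zero).1 h1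
    exact_mod_cast add_right_cancel h2
  · rintro ⟨_, x, rfl⟩
    exact ⟨x, rfl⟩

/-- The factor `(x + ε) Γ(x + 2ε)`; at `x = 0` it is `ε Γ(2ε) = Γ(2ε + 1) / 2`, which also is the
value by continuity when `ε = 0`. -/
def leadFactor (a b : ℝ) (x : ℕ) : ℝ :=
  if x = 0 then Real.Gamma (2 * eps a b + 1) / 2
  else ((x : ℝ) + eps a b) * Real.Gamma (x + 2 * eps a b)

lemma leadFactor_eq {a b : ℝ} (x : ℕ) (h : x ≠ 0 ∨ eps a b ≠ 0) :
    leadFactor a b x = ((x : ℝ) + eps a b) * Real.Gamma (x + 2 * eps a b) := by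
  unfold leadFactor
  split_ifs with hx
  · subst hx
    have he : eps a b ≠ 0 := by simpa using h
    rw [Real.Gamma_add_one (mul_ne_zero two_ne_zero he)]
    push_cast
    rw [zero_add, zero_add]
    ring
  · rfl

/-- The right-hand side of the formula for the weight `W(x̂)`, a priori a complex number. In Mathlib
`Complex.Gamma` vanishes at its poles, so that the inverses below are the values of the entire
function `1 / Γ`. -/
def weightC (z z' : ℂ) (a b : ℝ) (N x : ℕ) : ℂ :=
  ((leadFactor a b x * Real.Gamma (x + a + 1) /
      (Real.Gamma (x + 1) * Real.Gamma (x + b + 1)) : ℝ) : ℂ) *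
    (Complex.Gamma (z - x + N) * Complex.Gamma (z' - x + N) *
      Complex.Gamma (z + x + N + 2 * (eps a b : ℂ)) *
      Complex.Gamma (z' + x + N + 2 * (eps a b : ℂ)))⁻¹

/-- The weight `W(x̂)` as a real number. -/
def weight (z z' : ℂ) (a b : ℝ) (N x : ℕ) : ℝ := (weightC z z' a b N x).re

/-! ### The z-measure of level `N` and the point process `O^(N)` -/

/-- Positive signatures `λ₁ ≥ … ≥ λ_N ≥ 0` of length `N`. -/
abbrev Signature (N : ℕ) : Type := {lam : Fin N → ℕ // Antitone lam}

/-- Shifted coordinates `l_i = λ_i + N - i`, `1 ≤ i ≤ N` (the index `i : Fin N` starts at `0`). -/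
def shifted {N : ℕ} (lam : Signature N) (i : Fin N) : ℕ := lam.1 i + (N - 1 - (i : ℕ))

/-- Vandermonde product `∏_{i < j} (x_i - x_j)`. -/
def vandermonde {N : ℕ} (x : Fin N → ℝ) : ℝ := ∏ i, ∏ j ∈ Finset.Ioi i, (x i - x j)

/-- The unnormalized z-measure of level `N`. -/
def zWeight (z z' : ℂ) (a b : ℝ) (N : ℕ) (lam : Signature N) : ℝ :=
  vandermonde (fun i => hat a b (shifted lam i)) ^ 2 *
    ∏ i, weight z z' a b N (shifted lam i)

/-- The z-measure of level `N`: the normalization of `zWeight` by its total mass. -/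
def zMeasure (z z' : ℂ) (a b : ℝ) (N : ℕ) : Measure (Signature N) :=
  Measure.sum fun lam =>
    ENNReal.ofReal (zWeight z z' a b N lam / ∑' mu, zWeight z z' a b N mu) • Measure.dirac lam

/-- Simple finite point configurations on the half-lattice. -/
abbrev Conf (a b : ℝ) : Type := Finset (HalfLattice a b)

/-- The map `λ ↦ {l̂₁ > … > l̂_N}`. -/
def configO (a b : ℝ) {N : ℕ} (lam : Signature N) : Conf a b :=
  (Set.finite_range fun i => pt a b (shifted lam i)).toFinset

/-- The point process `O^(N)` on the half-lattice, as a law on configurations. -/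
def processO (z z' : ℂ) (a b : ℝ) (N : ℕ) : Measure (Conf a b) :=
  (zMeasure z z' a b N).map (configO a b)

/-! ### Orthogonal polynomial ensembles and correlation kernels on the half-lattice
Points of the half-lattice are referred to by their labels. -/

/-- `μ` is the `N`-point orthogonal polynomial ensemble with weight `W`: a configuration almost
surely has `N` points, and each set of `N` distinct points has probability
`const · |Δ_N|² · ∏ W`. -/
def IsOrthPolyEnsemble (a b : ℝ) (N : ℕ) (W : ℕ → ℝ) (μ : Measure (Conf a b)) : Prop :=
  (∀ᵐ X ∂μ, X.card = N) ∧
  ∃ c : ℝ, 0 < c ∧ ∀ x : Fin N → ℕ, Function.Injective x →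
    μ.real {X | (X : Set (HalfLattice a b)) = Set.range fun i => pt a b (x i)} =
      c * |vandermonde fun i => hat a b (x i)| ^ 2 * ∏ i, W (x i)

/-- `K` is a correlation kernel of `μ`: for all `m` and all distinct points `x̂₁, …, x̂_m`, the
probability that a configuration contains them all is `det [K(x̂_i, x̂_j)]`. -/
def IsCorrelationKernel (a b : ℝ) (K : ℕ → ℕ → ℂ) (μ : Measure (Conf a b)) : Prop :=
  ∀ (m : ℕ) (x : Fin m → ℕ), Function.Injective x →
    ((μ.real {X | ∀ i, pt a b (x i) ∈ X} : ℝ) : ℂ) =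
      Matrix.det (Matrix.of fun i j : Fin m => K (x i) (x j))

/-! ### Hypergeometric polynomials -/

/-- The Pochhammer symbol `(c)_n = c (c + 1) ⋯ (c + n - 1)`. -/
def poch (c : ℂ) (n : ℕ) : ℂ := (ascPochhammer ℂ n).eval c

lemma poch_succ (c : ℂ) (n : ℕ) : poch c (n + 1) = poch c n * (c + n) :=
  ascPochhammer_succ_eval n c

/-- Off the poles, the Pochhammer symbol is the quotient `Γ(c + n) / Γ(c)`. -/
lemma poch_eq_Gamma_div (c : ℂ) (n : ℕ) (hc : ∀ m : ℕ, c ≠ -m) :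
    poch c n = Complex.Gamma (c + n) / Complex.Gamma c := by
  have h0 : Complex.Gamma c ≠ 0 := Complex.Gamma_ne_zero hc
  rw [eq_div_iff h0]
  induction n with
  | zero => simp [poch]
  | succ n ih =>
    have hn : c + n ≠ 0 := fun h => hc n (eq_neg_of_add_eq_zero_left h)
    have e : c + ((n + 1 : ℕ) : ℂ) = (c + n) + 1 := by push_cast; ring
    rw [e, Complex.Gamma_add_one _ hn, ← ih, poch_succ]
    ring

/-- The value at `u` of the series `₄F₃(a₁, a₂, a₃, a₄; b₁, b₂, b₃; u)`. -/
def hyp4F3 (a₁ a₂ a₃ a₄ b₁ b₂ b₃ u : ℂ) : ℂ :=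
  ∑' k : ℕ, poch a₁ k * poch a₂ k * poch a₃ k * poch a₄ k /
    (poch b₁ k * poch b₂ k * poch b₃ k) * (u ^ k / (k.factorial : ℂ))

lemma poch_neg_nat {n k : ℕ} (h : n < k) : poch (-(n : ℂ)) k = 0 :=
  ascPochhammer_eval_neg_coe_nat_of_lt h

lemma hyp4F3_terminating (n : ℕ) (a₂ a₃ a₄ b₁ b₂ b₃ : ℂ) :
    hyp4F3 (-(n : ℂ)) a₂ a₃ a₄ b₁ b₂ b₃ 1 =
      ∑ k ∈ Finset.range (n + 1), poch (-(n : ℂ)) k * poch a₂ k * poch a₃ k * poch a₄ k /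
        (poch b₁ k * poch b₂ k * poch b₃ k) * (1 ^ k / (k.factorial : ℂ)) := by
  unfold hyp4F3
  refine tsum_eq_sum fun k hk => ?_
  have : n < k := by simpa [Nat.lt_succ_iff] using hk
  simp [poch_neg_nat this]

/-- The polynomial `∏_{j < k} ((j + ε)² - u)` in `u`; its value at `u = x̂` is
`(x + 2ε)_k (-x)_k`. -/
def latticePoly (a b : ℝ) (k : ℕ) : ℂ[X] :=
  ∏ j ∈ Finset.range k, (C (((j : ℂ) + (eps a b : ℂ)) ^ 2) - X)

lemma latticePoly_eval (a b : ℝ) (k : ℕ) (x : ℂ) :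
    (latticePoly a b k).eval ((x + (eps a b : ℂ)) ^ 2) =
      poch (x + 2 * (eps a b : ℂ)) k * poch (-x) k := by
  induction k with
  | zero => simp [latticePoly, poch]
  | succ k ih =>
    rw [poch_succ, poch_succ, latticePoly, Finset.prod_range_succ, ← latticePoly, eval_mul, ih]
    simp only [eval_sub, eval_C, eval_X]
    ring

/-- The monic Wilson–Neretin polynomial `𝔭_n`, as a polynomial in the variable `x̂`; see
`neretin_eval`. The prefactor is
`Γ[1+a+n, 1-z-N+n, 1-z'-N+n, n+1-2N-Σ] / Γ[1+a, 1-z-N, 1-z'-N, 2n+1-2N-Σ]`,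
each quotient of Gamma values being understood as a Pochhammer symbol. -/
def neretin (z z' : ℂ) (a b : ℝ) (N n : ℕ) : ℂ[X] :=
  C (poch (1 + a) n * poch (1 - z - N) n * poch (1 - z' - N) n /
      poch (n + 1 - 2 * N - sig z z' b) n) *
  ∑ k ∈ Finset.range (n + 1),
    C (poch (-(n : ℂ)) k * poch (n + 1 - 2 * N - sig z z' b) k /
        (poch (1 + a) k * poch (1 - z - N) k * poch (1 - z' - N) k * (k.factorial : ℂ))) *
      latticePoly a b k

/-- `𝔭_n(x̂)` is the stated multiple of a terminating `₄F₃(1)`. -/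
lemma neretin_eval (z z' : ℂ) (a b : ℝ) (N n : ℕ) (x : ℂ) :
    (neretin z z' a b N n).eval ((x + (eps a b : ℂ)) ^ 2) =
      poch (1 + a) n * poch (1 - z - N) n * poch (1 - z' - N) n /
        poch (n + 1 - 2 * N - sig z z' b) n *
      hyp4F3 (-(n : ℂ)) (n + 1 - 2 * N - sig z z' b) (x + 2 * (eps a b : ℂ)) (-x)
        (1 + a) (1 - z - N) (1 - z' - N) 1 := by
  rw [hyp4F3_terminating, neretin, eval_mul, eval_C, eval_finsetSum]
  congr 1
  refine Finset.sum_congr rfl fun k _ => ?_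
  rw [eval_mul, eval_C, latticePoly_eval, one_pow]
  simp only [div_eq_mul_inv, mul_inv]
  ring

/-- The polynomial `𝔭̃_N` in the variable `x̂`: the polynomial whose value at `x̂` is
`Γ[x+1, x+N+2ε] / Γ[x+2ε, x-N+1] · ₄F₃(-N, -N-a, z, z'; Σ+1, x-N+1, -x-N-a-b; 1)` for all
integers `x ≥ N`, see `neretinTilde_eval`. For `x < N` the Gamma quotient vanishes while terms of
the series are singular, and the product is understood by continuity in `x`, that is, as the value
of this polynomial. -/
def neretinTilde (z z' : ℂ) (a b : ℝ) (N : ℕ) : ℂ[X] :=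
  ∑ k ∈ Finset.range (N + 1),
    C (poch (-(N : ℂ)) k * poch (-(N : ℂ) - a) k * poch z k * poch z' k /
        (poch (sig z z' b + 1) k * (k.factorial : ℂ)) * (-1) ^ N) *
      latticePoly a b (N - k)

lemma poch_add (c : ℂ) (m n : ℕ) : poch c (m + n) = poch c m * poch (c + m) n := by
  induction n with
  | zero => simp [poch]
  | succ n ih =>
    rw [← add_assoc, poch_succ, ih, poch_succ]
    push_cast
    ring

lemma poch_reflect (m : ℕ) : ∀ c : ℂ, poch (1 - c - m) m = (-1) ^ m * poch c m := by
  induction m with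
  | zero => simp [poch]
  | succ m ih =>
    intro c
    have h1 : poch (1 - c - ((m + 1 : ℕ) : ℂ)) (m + 1) = (-c - m) * poch (1 - c - m) m := by
      have h := poch_add (1 - c - ((m + 1 : ℕ) : ℂ)) 1 m
      have e1 : poch (1 - c - ((m + 1 : ℕ) : ℂ)) 1 = -c - m := by
        simp [poch]; ring
      have e2 : (1 - c - ((m + 1 : ℕ) : ℂ)) + ((1 : ℕ) : ℂ) = 1 - c - m := by push_cast; ring
      rw [e1, e2] at h
      rw [← h, add_comm 1 m]
    rw [h1, ih, poch_succ]
    ring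

lemma poch_ne_zero (c : ℂ) (n : ℕ) (hc : ∀ m : ℕ, c ≠ -m) : poch c n ≠ 0 := by
  rw [poch_eq_Gamma_div c n hc]
  refine div_ne_zero (Complex.Gamma_ne_zero fun m h => hc (n + m) ?_) (Complex.Gamma_ne_zero hc)
  push_cast
  linear_combination h

lemma ne_neg_of_pos {r : ℝ} (hr : 0 < r) (m : ℕ) : (r : ℂ) ≠ -m := by
  intro h
  have h' : r = -(m : ℝ) := by exact_mod_cast h
  have : (0 : ℝ) ≤ m := Nat.cast_nonneg m
  linarith

/-- `𝔭̃_N(x̂)` is the stated multiple of a terminating `₄F₃(1)` for all integers `x ≥ N`. -/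
lemma neretinTilde_eval (z z' : ℂ) {a b : ℝ} (h : 0 ≤ eps a b) {N x : ℕ} (hN : 1 ≤ N)
    (hx : N ≤ x) :
    (neretinTilde z z' a b N).eval (hat a b x : ℂ) =
      Complex.Gamma (x + 1) * Complex.Gamma (x + N + 2 * (eps a b : ℂ)) /
        (Complex.Gamma (x + 2 * (eps a b : ℂ)) * Complex.Gamma (x - N + 1)) *
      hyp4F3 (-(N : ℂ)) (-(N : ℂ) - a) z z' (sig z z' b + 1) (x - N + 1) (-x - N - a - b) 1 := by
  have hx1 : (1 : ℝ) ≤ x := by exact_mod_cast hN.trans hx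
  have hxN : (N : ℝ) ≤ x := by exact_mod_cast hx
  have hc : ∀ m : ℕ, (x : ℂ) + 2 * (eps a b : ℂ) ≠ -m := by
    have := ne_neg_of_pos (r := x + 2 * eps a b) (by linarith)
    simpa using this
  have hd : ∀ m : ℕ, (x : ℂ) - N + 1 ≠ -m := by
    have := ne_neg_of_pos (r := x - N + 1) (by linarith)
    simpa using this
  have hG : Complex.Gamma (x + 1) * Complex.Gamma (x + N + 2 * (eps a b : ℂ)) /
        (Complex.Gamma (x + 2 * (eps a b : ℂ)) * Complex.Gamma (x - N + 1)) =
      poch (x + 2 * (eps a b : ℂ)) N * poch (x - N + 1) N := by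
    rw [poch_eq_Gamma_div _ _ hc, poch_eq_Gamma_div _ _ hd, div_mul_div_comm]
    congr 1
    rw [mul_comm]
    congr 2 <;> ring
  have hhat : (hat a b x : ℂ) = ((x : ℂ) + (eps a b : ℂ)) ^ 2 := by simp [hat]
  rw [hG, hyp4F3_terminating, neretinTilde, eval_finsetSum, Finset.mul_sum]
  refine Finset.sum_congr rfl fun k hk => ?_
  obtain ⟨m, rfl⟩ : ∃ m, N = k + m := Nat.exists_eq_add_of_le (by simpa [Nat.lt_succ_iff] using hk)
  have e0 : k + m - k = m := by omega
  rw [eval_mul, eval_C, hhat, latticePoly_eval, one_pow, e0]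
  have e1 : poch ((x : ℂ) + 2 * (eps a b : ℂ)) (k + m) =
      poch ((x : ℂ) + 2 * (eps a b : ℂ)) m * poch ((x : ℂ) + 2 * (eps a b : ℂ) + m) k := by
    rw [add_comm k m, poch_add]
  have e2 := poch_add ((x : ℂ) - ((k + m : ℕ) : ℂ) + 1) k m
  have e3 : poch (-(x : ℂ) - ((k + m : ℕ) : ℂ) - a - b) k =
      (-1) ^ k * poch ((x : ℂ) + 2 * (eps a b : ℂ) + m) k := by
    rw [← poch_reflect]
    congr 1
    simp only [eps]
    push_cast
    ring
  have e4 : poch (-(x : ℂ)) m =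
      (-1) ^ m * poch ((x : ℂ) - ((k + m : ℕ) : ℂ) + 1 + k) m := by
    rw [← poch_reflect]
    congr 1
    push_cast
    ring
  have n1 : poch ((x : ℂ) - ((k + m : ℕ) : ℂ) + 1) k ≠ 0 := poch_ne_zero _ _ hd
  have n2 : poch ((x : ℂ) + 2 * (eps a b : ℂ) + m) k ≠ 0 := by
    refine poch_ne_zero _ _ fun j hj => hc (m + j) ?_
    push_cast
    linear_combination hj
  have s1 : ((-1 : ℂ) ^ k) * (-1) ^ k = 1 := by rw [← mul_pow]; simp
  have s2 : ((-1 : ℂ) ^ m) * (-1) ^ m = 1 := by rw [← mul_pow]; simp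
  have s3 : ((-1 : ℂ) ^ k)⁻¹ = (-1) ^ k := inv_eq_of_mul_eq_one_right s1
  rw [e1, e2, e3, e4, pow_add]
  simp only [div_eq_mul_inv, mul_inv, s3]
  field_simp
  linear_combination (poch (-((k + m : ℕ) : ℂ)) k * poch (-((k + m : ℕ) : ℂ) - a) k * poch z k *
    poch z' k * poch ((x : ℂ) + 2 * (eps a b : ℂ)) m *
    poch ((x : ℂ) - ((k + m : ℕ) : ℂ) + 1 + k) m * (poch (sig z z' b + 1) k)⁻¹ *
    (k.factorial : ℂ)⁻¹) * s2

/-- The formula for the norm `h_{N-1}`. -/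
def normTop (z z' : ℂ) (a b : ℝ) (N : ℕ) : ℂ :=
  1 / 2 * (Complex.Gamma (N + a) * Complex.Gamma N * Complex.Gamma (sig z z' b + 1) *
      Complex.Gamma (sig z z' b + 2)) /
    (Complex.Gamma (N + sig z z' b + a + 1) * Complex.Gamma (N + sig z z' b + 1) *
      Complex.Gamma (1 + z) * Complex.Gamma (1 + z') *
      Complex.Gamma (1 + z + b) * Complex.Gamma (1 + z' + b))

/-- `p` is the monic orthogonal polynomial of degree `n` for the weight `W` on the half-lattice:
it is orthogonal to all polynomials of lower degree, with absolutely convergent pairings. -/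
def IsMonicOrthPoly (a b : ℝ) (W : ℕ → ℝ) (n : ℕ) (p : ℂ[X]) : Prop :=
  p.Monic ∧ p.natDegree = n ∧
  ∀ q : ℂ[X], q.degree < n →
    HasSum (fun x : ℕ => p.eval (hat a b x : ℂ) * q.eval (hat a b x : ℂ) * (W x : ℂ)) 0

/-- `(p(u) q(v) - q(u) p(v)) / (u - v)`, with its limit value for `u = v`. -/
def cdQuotient (p q : ℂ[X]) (u v : ℂ) : ℂ :=
  if u = v then p.derivative.eval u * q.eval u - q.derivative.eval u * p.eval u
  else (p.eval u * q.eval v - q.eval u * p.eval v) / (u - v)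

/-- `√(W(x̂) W(ŷ)) / h_{N-1} · (p(x̂) 𝔭_{N-1}(ŷ) - 𝔭_{N-1}(x̂) p(ŷ)) / (x̂ - ŷ)`. -/
def cdKernel (z z' : ℂ) (a b : ℝ) (N : ℕ) (p : ℂ[X]) (x y : ℕ) : ℂ :=
  (Real.sqrt (weight z z' a b N x * weight z z' a b N y) : ℂ) / normTop z z' a b N *
    cdQuotient p (neretin z z' a b N (N - 1)) (hat a b x : ℂ) (hat a b y : ℂ)

end

end ZMeas

/-!
`W` is the weight of a Dougall-type bilateral summation: its total mass is a quotient of Gamma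
functions for all parameters. Multiplying `W` by a basis polynomial `(x + 2ε)_k (-x)_k` and by
`(x + 1 - z' - N)_j (1 - z' - N - 2ε - x)_j`, a monic polynomial of degree `j` in `x̂`, only shifts
the parameters, so every pairing needed is explicit. Orthogonality of `𝔭_n` then reduces to the
vanishing of high-order finite differences of a polynomial.

By the Christoffel–Darboux identity, for every monic `p` of degree `N` orthogonal to the polynomials
of degree less than `N - 1`, the kernel built from `p` and `𝔭_{N-1}` is the projection kernel onto
polynomials of degree less than `N`. This applies to `𝔭_N` and to its replacement alike, the latter
also at `Σ = 0`. Each minor of the projection kernel is a correlation: the minors of order `N` are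
the probabilities of the configurations, and summing out one point lowers the order.
-/

namespace ZMeas

open Filter Asymptotics Topology

/-! ### Gamma values along the integers -/

lemma poch_eq_prod (c : ℂ) (n : ℕ) : poch c n = ∏ j ∈ Finset.range n, (c + j) := by
  induction n with
  | zero => simp [poch]
  | succ n ih => rw [poch_succ, ih, Finset.prod_range_succ]

lemma ne_neg_natCast_of_re_pos {c : ℂ} (hc : 0 < c.re) (m : ℕ) : c ≠ -m := by
  rintro rfl
  simp only [Complex.neg_re, Complex.natCast_re, Left.neg_pos_iff] at hc
  exact hc.not_ge m.cast_nonneg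

lemma inv_Gamma_eq_mul {s t : ℂ} (h : t = s + 1) :
    (Complex.Gamma s)⁻¹ = s * (Complex.Gamma t)⁻¹ := by
  rw [h, Complex.one_div_Gamma_eq_self_mul_one_div_Gamma_add_one]

lemma inv_realGamma_eq_mul {s t : ℝ} (h : t = s + 1) :
    (Real.Gamma s)⁻¹ = s * (Real.Gamma t)⁻¹ := by
  have hC := inv_Gamma_eq_mul (s := s) (t := t) (by rw [h]; push_cast; rfl)
  rw [Complex.Gamma_ofReal, Complex.Gamma_ofReal] at hC
  exact_mod_cast hC

lemma inv_Gamma_eq_poch_mul (c : ℂ) (n : ℕ) :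
    (Complex.Gamma c)⁻¹ = poch c n * (Complex.Gamma (c + n))⁻¹ := by
  induction n with
  | zero => simp [poch]
  | succ n ih =>
    rw [ih, poch_succ, inv_Gamma_eq_mul (s := c + n) (t := c + (n + 1 : ℕ)) (by push_cast; ring)]
    ring

lemma inv_Gamma_sub_nat (c : ℂ) (n : ℕ) :
    (Complex.Gamma (c - n))⁻¹ = (-1) ^ n * poch (1 - c) n * (Complex.Gamma c)⁻¹ := by
  rw [inv_Gamma_eq_poch_mul (c - n) n, ← poch_reflect n (1 - c)]
  ring_nf

lemma tendsto_add_nat_div_add_nat (c d : ℂ) :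
    Tendsto (fun n : ℕ => (c + n) / (d + n)) atTop (𝓝 1) := by
  have h (c : ℂ) : Tendsto (fun n : ℕ => c / (n : ℂ) + 1) atTop (𝓝 1) := by
    simpa using (tendsto_const_div_atTop_nhds_zero_nat c).add_const 1
  have hdiv := (h c).div (h d) one_ne_zero
  rw [div_one] at hdiv
  refine hdiv.congr' ?_
  filter_upwards [eventually_ne_atTop 0] with n hn
  have hn' : (n : ℂ) ≠ 0 := Nat.cast_ne_zero.2 hn
  rw [Pi.div_apply, div_add_one hn', div_add_one hn', div_div_div_cancel_right₀ hn']

/-- Euler's limit formula, solved for the Pochhammer symbol hidden in `Γ(n + c)`. -/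
lemma tendsto_Gamma_nat_add_div {c : ℂ} (hc : ∀ m : ℕ, c ≠ -m) :
    Tendsto (fun n : ℕ => Complex.Gamma (n + c) / (n.factorial * (n : ℂ) ^ (c - 1)))
      atTop (𝓝 1) := by
  have hG : Complex.Gamma c ≠ 0 := Complex.Gamma_ne_zero hc
  have hlim := ((tendsto_add_nat_div_add_nat 0 c).mul
    ((Complex.GammaSeq_tendsto_Gamma c).inv₀ hG)).const_mul (Complex.Gamma c)
  rw [one_mul, mul_inv_cancel₀ hG] at hlim
  refine hlim.congr' ?_
  filter_upwards [eventually_ne_atTop 0] with n hn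
  have hn' : (n : ℂ) ≠ 0 := Nat.cast_ne_zero.2 hn
  have hcn : c + n ≠ 0 := fun h => hc n (eq_neg_of_add_eq_zero_left h)
  have hpow : (n : ℂ) ^ c ≠ 0 := by simp [Complex.cpow_eq_zero_iff, hn']
  have hfac : (n.factorial : ℂ) ≠ 0 := Nat.cast_ne_zero.2 n.factorial_ne_zero
  have hpoch : poch c n * Complex.Gamma c = Complex.Gamma (n + c) := by
    rw [poch_eq_Gamma_div c n hc, div_mul_cancel₀ _ hG, add_comm]
  rw [Complex.GammaSeq, ← poch_eq_prod, poch_succ, Complex.cpow_sub _ _ hn', Complex.cpow_one,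
    ← hpoch]
  field_simp
  ring

lemma natCast_add_isTheta (c : ℂ) :
    (fun n : ℕ => (n : ℂ) + c) =Θ[atTop] fun n : ℕ => (n : ℝ) := by
  have h : (fun n : ℕ => (n : ℂ) + c) =Θ[atTop] fun n : ℕ => (n : ℂ) :=
    isTheta_of_div_tendsto_nhds_ne_zero
      (by simpa [add_comm] using tendsto_add_nat_div_add_nat 0 c) one_ne_zero
  exact h.trans (.of_norm_eventuallyEq_norm (.of_forall fun n => by simp))

lemma Gamma_nat_add_isTheta_of_re_pos {c : ℂ} (hc : 0 < c.re) :
    (fun n : ℕ => Complex.Gamma (n + c)) =Θ[atTop]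
      fun n : ℕ => (n.factorial : ℝ) * (n : ℝ) ^ (c.re - 1) := by
  refine (isTheta_of_div_tendsto_nhds_ne_zero
    (tendsto_Gamma_nat_add_div (ne_neg_natCast_of_re_pos hc)) one_ne_zero).symm.trans
      (.of_norm_eventuallyEq ?_)
  filter_upwards [eventually_gt_atTop 0] with n hn
  rw [norm_mul, Complex.norm_natCast, Complex.norm_natCast_cpow_of_pos hn, Complex.sub_re,
    Complex.one_re]

lemma Gamma_nat_add_isTheta (c : ℂ) :
    (fun n : ℕ => Complex.Gamma (n + c)) =Θ[atTop]
      fun n : ℕ => (n.factorial : ℝ) * (n : ℝ) ^ (c.re - 1) := by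
  obtain ⟨k, hk⟩ := exists_nat_gt (-c.re)
  induction k generalizing c with
  | zero => exact Gamma_nat_add_isTheta_of_re_pos (by simpa using hk)
  | succ k ih =>
    have h := (ih (c + 1) (by
      push_cast at hk
      rw [Complex.add_re, Complex.one_re]
      linarith)).mul (natCast_add_isTheta c).inv
    refine (IsTheta.of_norm_eventuallyEq_norm ?_).trans (h.trans
      (.of_norm_eventuallyEq_norm ?_))
    · filter_upwards [eventually_gt_atTop ⌈‖c‖⌉₊] with n hn
      have hnc : (n : ℂ) + c ≠ 0 := fun h0 => by
        have := (Nat.lt_of_ceil_lt hn).ne'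
        rw [← norm_neg c, ← eq_neg_of_add_eq_zero_left h0, Complex.norm_natCast] at this
        exact this rfl
      rw [← add_assoc, Complex.Gamma_add_one _ hnc, mul_comm ((n : ℂ) + c),
        mul_inv_cancel_right₀ hnc]
    · filter_upwards [eventually_gt_atTop 0] with n hn
      rw [Complex.add_re, Complex.one_re, add_sub_cancel_right,
        Real.rpow_sub_one (Nat.cast_ne_zero.2 hn.ne'), div_eq_mul_inv, mul_assoc]

lemma realGamma_nat_add_isTheta (c : ℝ) :
    (fun n : ℕ => Real.Gamma (n + c)) =Θ[atTop]
      fun n : ℕ => (n.factorial : ℝ) * (n : ℝ) ^ (c - 1) := by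
  refine .trans (.of_norm_eventuallyEq_norm (.of_forall fun n => ?_)) (Gamma_nat_add_isTheta c)
  simp only [← Complex.ofReal_natCast, ← Complex.ofReal_add, Complex.Gamma_ofReal,
    Complex.norm_real]

lemma inv_Gamma_sub_nat_isBigO (c : ℂ) :
    (fun n : ℕ => (Complex.Gamma (c - n))⁻¹) =O[atTop]
      fun n : ℕ => (n.factorial : ℝ) * (n : ℝ) ^ (-c.re) := by
  by_cases hc : ∃ m : ℕ, 1 - c = -m
  · obtain ⟨m, hm⟩ := hc
    refine EventuallyEq.trans_isBigO ?_ (isBigO_zero _ _)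
    filter_upwards [eventually_gt_atTop m] with n hn
    rw [inv_Gamma_sub_nat, hm, poch_neg_nat hn, mul_zero, zero_mul]
  · push Not at hc
    have h := (Gamma_nat_add_isTheta (1 - c)).1.const_mul_left
      ((Complex.Gamma (1 - c))⁻¹ * (Complex.Gamma c)⁻¹)
    rw [show (1 - c).re - 1 = -c.re by simp] at h
    refine IsBigO.of_norm_left (h.norm_left.congr_left fun n => ?_)
    rw [inv_Gamma_sub_nat, poch_eq_Gamma_div _ _ hc, add_comm (n : ℂ)]
    simp only [norm_mul, norm_inv, norm_div, norm_pow, norm_neg, norm_one, one_pow]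
    ring

lemma inv_Gamma_sub_mul_Gamma_add_isBigO (c d : ℂ) :
    (fun n : ℕ => (Complex.Gamma (c - n) * Complex.Gamma (d + n))⁻¹) =O[atTop]
      fun n : ℕ => (n : ℝ) ^ (1 - c.re - d.re) := by
  refine (((inv_Gamma_sub_nat_isBigO c).mul (Gamma_nat_add_isTheta d).inv.1).congr_left
    fun n => ?_).trans (EventuallyEq.isBigO ?_)
  · rw [mul_inv, add_comm d]
  · filter_upwards [eventually_gt_atTop 0] with n hn
    have hn' : (0 : ℝ) < n := Nat.cast_pos.2 hn
    have hfac : (n.factorial : ℝ) ≠ 0 := Nat.cast_ne_zero.2 n.factorial_ne_zero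
    rw [show 1 - c.re - d.re = -c.re + -(d.re - 1) by ring, Real.rpow_add hn',
      Real.rpow_neg hn'.le (d.re - 1), mul_inv]
    field_simp

lemma realGamma_nat_add_div_isBigO (c d : ℝ) :
    (fun n : ℕ => Real.Gamma (n + c) / Real.Gamma (n + d)) =O[atTop]
      fun n : ℕ => (n : ℝ) ^ (c - d) := by
  refine ((realGamma_nat_add_isTheta c).div (realGamma_nat_add_isTheta d)).1.trans
    (EventuallyEq.isBigO ?_)
  filter_upwards [eventually_gt_atTop 0] with n hn
  have hfac : (n.factorial : ℝ) ≠ 0 := Nat.cast_ne_zero.2 n.factorial_ne_zero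
  rw [mul_div_mul_left _ _ hfac, ← Real.rpow_sub (Nat.cast_pos.2 hn)]
  ring_nf

/-! ### Dougall's `₅F₄` summation formula -/

lemma two_mul_eps (a b : ℝ) : 2 * eps a b = a + b + 1 := by
  rw [eps]
  ring

lemma leadFactor_div_Gamma {a b : ℝ} (hab : -2 < a + b) (x : ℕ) :
    leadFactor a b x / Real.Gamma (x + 1) =
      (Real.Gamma (x + (a + b + 1)) / Real.Gamma x +
        Real.Gamma (x + (a + b + 2)) / Real.Gamma (x + 1)) / 2 := by
  rcases x.eq_zero_or_pos with rfl | hx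
  · simp only [leadFactor, two_mul_eps, if_pos, Nat.cast_zero, zero_add, Real.Gamma_zero, div_zero,
      Real.Gamma_one]
    ring_nf
  · have hx' : (1 : ℝ) ≤ x := Nat.one_le_cast.2 hx
    have hΓ : Real.Gamma x ≠ 0 := (Real.Gamma_pos_of_pos (by linarith)).ne'
    have hx0 : (x : ℝ) ≠ 0 := by positivity
    rw [leadFactor, if_neg hx.ne', two_mul_eps, Real.Gamma_add_one hx0,
      show (x : ℝ) + (a + b + 2) = x + (a + b + 1) + 1 by ring,
      Real.Gamma_add_one (s := x + (a + b + 1)) (by linarith), eps]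
    field_simp
    ring

/-- The real factor `(x + ε) Γ(x + 2ε) Γ(x + a + 1) / (Γ(x + 1) Γ(x + b + 1))` of the weight, that
is, the weight of the Jacobi-type special case without the parameters `z, z'`. -/
noncomputable def jacobiCore (a b : ℝ) (x : ℕ) : ℝ :=
  leadFactor a b x * Real.Gamma (x + a + 1) / (Real.Gamma (x + 1) * Real.Gamma (x + b + 1))

lemma jacobiCore_eq {a b : ℝ} (hab : -2 < a + b) (x : ℕ) :
    jacobiCore a b x =
      (Real.Gamma (x + (a + b + 1)) / Real.Gamma x +
        Real.Gamma (x + (a + b + 2)) / Real.Gamma (x + 1)) / 2 *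
      (Real.Gamma (x + (a + 1)) / Real.Gamma (x + (b + 1))) := by
  rw [jacobiCore, ← leadFactor_div_Gamma hab, div_mul_div_comm, add_assoc, add_assoc]

lemma jacobiCore_isBigO {a b : ℝ} (hab : -2 < a + b) :
    jacobiCore a b =O[atTop] fun n : ℕ => (n : ℝ) ^ (2 * a + 1) := by
  have hlead := (realGamma_nat_add_div_isBigO (a + b + 1) 0).add <|
    (realGamma_nat_add_div_isBigO (a + b + 2) 1).trans (by ring_nf; exact isBigO_refl _ _)
  have h := (hlead.const_mul_left (1 / 2)).mul (realGamma_nat_add_div_isBigO (a + 1) (b + 1))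
  refine (h.congr_left fun n => ?_).trans (EventuallyEq.isBigO ?_)
  · rw [jacobiCore_eq hab, add_zero]
    ring
  · filter_upwards [eventually_gt_atTop 0] with n hn
    rw [← Real.rpow_add (Nat.cast_pos.2 hn)]
    ring_nf

/-- The very-well-poised summand of Dougall's `₅F₄` formula, written with entire functions `1 / Γ`
so that no restriction on `P` and `Q` is needed. The weight `W(x̂)` is the case `P = z + N`,
`Q = z' + N`. -/
noncomputable def dougallTerm (a b : ℝ) (P Q : ℂ) (x : ℕ) : ℂ :=
  (jacobiCore a b x : ℂ) *
    ((Complex.Gamma (P - x) * Complex.Gamma (P + (a + b + 1) + x))⁻¹ *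
      (Complex.Gamma (Q - x) * Complex.Gamma (Q + (a + b + 1) + x))⁻¹)

/-- The closed form of the sum of `dougallTerm`. -/
noncomputable def dougallSum (a b : ℝ) (P Q : ℂ) : ℂ :=
  1 / 2 * Complex.Gamma (a + 1) * Complex.Gamma (P + Q + b - 1) *
    (Complex.Gamma P * Complex.Gamma (P + b) * (Complex.Gamma Q * Complex.Gamma (Q + b)) *
      Complex.Gamma (P + Q + a + b))⁻¹

lemma dougallTerm_comm (a b : ℝ) (P Q : ℂ) : dougallTerm a b P Q = dougallTerm a b Q P := by
  funext x
  rw [dougallTerm, dougallTerm, mul_comm (Complex.Gamma (P - x) * _)⁻¹]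

lemma dougallSum_comm (a b : ℝ) (P Q : ℂ) : dougallSum a b P Q = dougallSum a b Q P := by
  rw [dougallSum, dougallSum, add_comm P Q, mul_comm (Complex.Gamma P * _)]

lemma dougallTerm_isBigO {a b : ℝ} (hab : -2 < a + b) (P Q : ℂ) :
    dougallTerm a b P Q =O[atTop] fun n : ℕ => (n : ℝ) ^ (1 - 2 * (P + Q + b).re) := by
  refine ((Complex.isBigO_ofReal_left.2 (jacobiCore_isBigO hab)).mul
    ((inv_Gamma_sub_mul_Gamma_add_isBigO P (P + (a + b + 1))).mul
      (inv_Gamma_sub_mul_Gamma_add_isBigO Q (Q + (a + b + 1))))).trans (EventuallyEq.isBigO ?_)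
  filter_upwards [eventually_gt_atTop 0] with n hn
  have hn' : (0 : ℝ) < n := Nat.cast_pos.2 hn
  rw [← Real.rpow_add hn', ← Real.rpow_add hn']
  simp only [Complex.add_re, Complex.ofReal_re, Complex.one_re]
  ring_nf

lemma dougallTerm_summable {a b : ℝ} (hab : -2 < a + b) {P Q : ℂ} (h : 1 < (P + Q + b).re) :
    Summable (dougallTerm a b P Q) :=
  summable_of_isBigO_nat (Real.summable_nat_rpow.2 (by linarith)) (dougallTerm_isBigO hab P Q)

/-- The telescoping certificate, in the sense of Wilf and Zeilberger, for the contiguous relation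
`dougallTerm_contiguous`. -/
noncomputable def dougallCert (a b : ℝ) (P Q : ℂ) (x : ℕ) : ℂ :=
  -(1 / 2) * ((Real.Gamma (x + (a + b + 1)) / Real.Gamma x *
      (Real.Gamma (x + (a + 1)) / Real.Gamma (x + b)) : ℝ) : ℂ) *
    ((Complex.Gamma (P - x) * Complex.Gamma (P + (a + b) + x))⁻¹ *
      (Complex.Gamma (Q + 1 - x) * Complex.Gamma (Q + (a + b + 1) + x))⁻¹)

lemma dougallCert_zero (a b : ℝ) (P Q : ℂ) : dougallCert a b P Q 0 = 0 := by
  simp [dougallCert, Real.Gamma_zero]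

lemma dougallCert_tendsto (a b : ℝ) {P Q : ℂ} (h : 1 < (P + Q + b).re) :
    Tendsto (dougallCert a b P Q) atTop (𝓝 0) := by
  have hO : dougallCert a b P Q =O[atTop] fun n : ℕ => (n : ℝ) ^ (-(2 * (P + Q + b).re - 2)) := by
    have hreal := (realGamma_nat_add_div_isBigO (a + b + 1) 0).mul
      (realGamma_nat_add_div_isBigO (a + 1) b)
    simp only [add_zero] at hreal
    refine (((Complex.isBigO_ofReal_left.2 hreal).const_mul_left (-(1 / 2))).mul
      ((inv_Gamma_sub_mul_Gamma_add_isBigO P (P + (a + b))).mul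
        (inv_Gamma_sub_mul_Gamma_add_isBigO (Q + 1) (Q + (a + b + 1))))).trans
          (EventuallyEq.isBigO ?_)
    filter_upwards [eventually_gt_atTop 0] with n hn
    have hn' : (0 : ℝ) < n := Nat.cast_pos.2 hn
    rw [← Real.rpow_add hn', ← Real.rpow_add hn', ← Real.rpow_add hn']
    simp only [Complex.add_re, Complex.ofReal_re, Complex.one_re]
    ring_nf
  exact hO.trans_tendsto
    ((tendsto_rpow_neg_atTop (by linarith)).comp tendsto_natCast_atTop_atTop)

lemma realGamma_add_div_mul {c : ℝ} (hc : -1 < c) (x : ℕ) :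
    Real.Gamma (x + c) / Real.Gamma x * (x + c) =
      x * (Real.Gamma (x + (c + 1)) / Real.Gamma (x + 1)) := by
  rcases x.eq_zero_or_pos with rfl | hx
  · simp [Real.Gamma_zero]
  · have hx' : (1 : ℝ) ≤ x := Nat.one_le_cast.2 hx
    have hx0 : (x : ℝ) ≠ 0 := by positivity
    rw [Real.Gamma_add_one hx0, ← add_assoc, Real.Gamma_add_one (s := x + c) (by linarith)]
    field_simp

lemma dougallTerm_contiguous {a b : ℝ} (ha : -1 < a) (hab : -2 < a + b) (P Q : ℂ) (x : ℕ) :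
    Q * (Q + b) * (P + Q + a + b) * dougallTerm a b P (Q + 1) x -
        (P + Q + b - 1) * dougallTerm a b P Q x =
      dougallCert a b P Q (x + 1) - dougallCert a b P Q x := by
  have hratio := congrArg ((↑) : ℝ → ℂ) (realGamma_add_div_mul (c := a + b + 1) (by linarith) x)
  rw [show a + b + 1 + 1 = a + b + 2 by ring] at hratio
  have hx : (x : ℝ) + (a + 1) ≠ 0 := (add_pos_of_nonneg_of_pos x.cast_nonneg (by linarith)).ne'
  rw [dougallTerm, dougallTerm, dougallCert, dougallCert, jacobiCore_eq hab,
    show ((x + 1 : ℕ) : ℝ) + (a + b + 1) = x + (a + b + 2) by push_cast; ring,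
    show ((x + 1 : ℕ) : ℝ) + (a + 1) = x + (a + 1) + 1 by push_cast; ring,
    show ((x + 1 : ℕ) : ℝ) + b = x + (b + 1) by push_cast; ring,
    show ((x + 1 : ℕ) : ℝ) = x + 1 by push_cast; rfl, Real.Gamma_add_one hx,
    show P + (a + b) + (x + 1 : ℕ) = P + (a + b + 1) + x by push_cast; ring,
    show Q + 1 - (x + 1 : ℕ) = Q - x by push_cast; ring,
    show Q + (a + b + 1) + (x + 1 : ℕ) = Q + 1 + (a + b + 1) + x by push_cast; ring]
  simp only [div_eq_mul_inv, mul_inv, Complex.ofReal_mul, Complex.ofReal_add] at hratio ⊢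
  rw [inv_realGamma_eq_mul (s := x + b) (t := x + (b + 1)) (by ring),
    inv_Gamma_eq_mul (s := P - (x + 1 : ℕ)) (t := P - x) (by push_cast; ring),
    inv_Gamma_eq_mul (s := P + (a + b) + x) (t := P + (a + b + 1) + x) (by ring),
    inv_Gamma_eq_mul (s := Q - x) (t := Q + 1 - x) (by ring),
    inv_Gamma_eq_mul (s := Q + (a + b + 1) + x) (t := Q + 1 + (a + b + 1) + x) (by ring)]
  push_cast at hratio ⊢
  linear_combination -((x : ℂ) ^ 2 + (a + b + 1) * x + b * (P + Q + a + b) + (P - 1) * Q) / 2 *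
    (Real.Gamma (x + (a + 1)) : ℂ) * ((Real.Gamma (x + (b + 1)) : ℂ))⁻¹ *
    (Complex.Gamma (P - x))⁻¹ * (Complex.Gamma (P + (a + b + 1) + x))⁻¹ *
    (Complex.Gamma (Q + 1 - x))⁻¹ * (Complex.Gamma (Q + 1 + (a + b + 1) + x))⁻¹ * hratio

lemma dougallTerm_tsum_contiguous {a b : ℝ} (ha : -1 < a) (hab : -2 < a + b) {P Q : ℂ}
    (h : 1 < (P + Q + b).re) :
    Q * (Q + b) * (P + Q + a + b) * ∑' x, dougallTerm a b P (Q + 1) x =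
      (P + Q + b - 1) * ∑' x, dougallTerm a b P Q x := by
  have h' : 1 < (P + (Q + 1) + b).re := by
    simp only [Complex.add_re, Complex.one_re] at h ⊢
    linarith
  have hsum := (((dougallTerm_summable hab h').hasSum.mul_left
    (Q * (Q + b) * (P + Q + a + b))).sub
      ((dougallTerm_summable hab h).hasSum.mul_left (P + Q + b - 1))).tendsto_sum_nat
  simp only [dougallTerm_contiguous ha hab, Finset.sum_range_sub, dougallCert_zero,
    sub_zero] at hsum
  exact sub_eq_zero.1 (tendsto_nhds_unique hsum (dougallCert_tendsto a b h))

lemma dougallSum_contiguous (a : ℝ) {b : ℝ} {P Q : ℂ} (h : P + Q + b - 1 ≠ 0) :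
    Q * (Q + b) * (P + Q + a + b) * dougallSum a b P (Q + 1) =
      (P + Q + b - 1) * dougallSum a b P Q := by
  rw [dougallSum, dougallSum, show P + (Q + 1) + b - 1 = P + Q + b - 1 + 1 by ring,
    Complex.Gamma_add_one _ h]
  simp only [mul_inv]
  rw [inv_Gamma_eq_mul (s := Q) rfl,
    inv_Gamma_eq_mul (s := Q + b) (t := Q + 1 + b) (by ring),
    inv_Gamma_eq_mul (s := P + Q + a + b) (t := P + (Q + 1) + a + b) (by ring)]
  ring

/-- `Γ(Q) Γ(Q + A) / (Γ(Q - x) Γ(Q + A + x))`, which normalizes the `Q`-dependent factor of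
`dougallTerm` so that it tends to `1` as `Q → ∞`. -/
noncomputable def gammaQuot (A : ℝ) (Q : ℂ) (x : ℕ) : ℂ :=
  Complex.Gamma Q * Complex.Gamma (Q + A) *
    (Complex.Gamma (Q - x) * Complex.Gamma (Q + A + x))⁻¹

section gammaQuot

variable {A : ℝ} {Q : ℂ}

lemma gammaQuot_zero (hA : -1 < A) (hQ : 1 ≤ Q.re) : gammaQuot A Q 0 = 1 := by
  simp only [gammaQuot, Nat.cast_zero, sub_zero, add_zero]
  refine mul_inv_cancel₀ (mul_ne_zero ?_ ?_) <;>
    refine Complex.Gamma_ne_zero_of_re_pos ?_ <;> first | linarith | simp; linarith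

lemma gammaQuot_succ (hA : -1 < A) (hQ : 1 ≤ Q.re) (x : ℕ) :
    gammaQuot A Q (x + 1) = gammaQuot A Q x * ((Q - x - 1) / (Q + A + x)) := by
  have hne : Q + A + x ≠ 0 := Complex.ne_zero_of_re_pos <| by
    simp only [Complex.add_re, Complex.ofReal_re, Complex.natCast_re]
    linarith [x.cast_nonneg (α := ℝ)]
  simp only [gammaQuot, mul_inv]
  rw [inv_Gamma_eq_mul (s := Q - (x + 1 : ℕ)) (t := Q - x) (by push_cast; ring),
    inv_Gamma_eq_mul (s := Q + A + x) (t := Q + A + (x + 1 : ℕ)) (by push_cast; ring)]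
  push_cast
  field_simp
  ring

lemma norm_gammaQuot_le (hA : -1 < A) (hQ : 1 ≤ Q.re) (x : ℕ) : ‖gammaQuot A Q x‖ ≤ 1 := by
  induction x with
  | zero => simp [gammaQuot_zero hA hQ]
  | succ x ih =>
    rw [gammaQuot_succ hA hQ, norm_mul, norm_div]
    refine mul_le_one₀ ih (by positivity) (div_le_one_of_le₀ ?_ (norm_nonneg _))
    rw [← sq_le_sq₀ (norm_nonneg _) (norm_nonneg _), Complex.sq_norm, Complex.sq_norm,
      Complex.normSq_apply, Complex.normSq_apply]
    simp only [Complex.sub_re, Complex.add_re, Complex.ofReal_re, Complex.natCast_re,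
      Complex.one_re, Complex.sub_im, Complex.add_im, Complex.ofReal_im, Complex.natCast_im,
      Complex.one_im]
    nlinarith [mul_nonneg (show 0 ≤ 2 * Q.re - 1 + A by linarith)
      (show 0 ≤ A + 2 * x + 1 by linarith [x.cast_nonneg (α := ℝ)])]

lemma gammaQuot_tendsto (hA : -1 < A) (hQ : 1 ≤ Q.re) (x : ℕ) :
    Tendsto (fun M : ℕ => gammaQuot A (Q + M) x) atTop (𝓝 1) := by
  have hQM (M : ℕ) : 1 ≤ (Q + M).re := by
    simp only [Complex.add_re, Complex.natCast_re]
    exact le_add_of_le_of_nonneg hQ M.cast_nonneg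
  induction x with
  | zero => simp [gammaQuot_zero hA (hQM _)]
  | succ x ih =>
    have h := ih.mul (tendsto_add_nat_div_add_nat (Q - x - 1) (Q + A + x))
    rw [one_mul] at h
    refine h.congr fun M => ?_
    rw [gammaQuot_succ hA (hQM M)]
    congr 2 <;> ring

end gammaQuot

lemma tendsto_Gamma_balanced_quot {c₁ c₂ d₁ d₂ : ℂ} (h : c₁ + c₂ = d₁ + d₂) (hc₁ : 0 < c₁.re)
    (hc₂ : 0 < c₂.re) (hd₁ : 0 < d₁.re) (hd₂ : 0 < d₂.re) :
    Tendsto (fun n : ℕ => Complex.Gamma (n + c₁) * Complex.Gamma (n + c₂) /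
      (Complex.Gamma (n + d₁) * Complex.Gamma (n + d₂))) atTop (𝓝 1) := by
  have hΓ {c : ℂ} (hc : 0 < c.re) := tendsto_Gamma_nat_add_div (ne_neg_natCast_of_re_pos hc)
  have hlim := ((hΓ hc₁).mul (hΓ hc₂)).div ((hΓ hd₁).mul (hΓ hd₂)) (by simp)
  rw [mul_one, div_one] at hlim
  refine hlim.congr' ?_
  filter_upwards [eventually_ne_atTop 0] with n hn
  have hn' : (n : ℂ) ≠ 0 := Nat.cast_ne_zero.2 hn
  have hfac : (n.factorial : ℂ) ≠ 0 := Nat.cast_ne_zero.2 n.factorial_ne_zero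
  have hpow (r : ℂ) : (n : ℂ) ^ r ≠ 0 := by simp [Complex.cpow_eq_zero_iff, hn']
  have hbal : (n : ℂ) ^ (c₁ - 1) * (n : ℂ) ^ (c₂ - 1) = n ^ (d₁ - 1) * n ^ (d₂ - 1) := by
    rw [← Complex.cpow_add _ _ hn', ← Complex.cpow_add _ _ hn']
    congr 1
    linear_combination h
  simp only [Pi.div_apply]
  rw [div_mul_div_comm, div_mul_div_comm, mul_mul_mul_comm (n.factorial : ℂ) (n ^ (c₁ - 1)),
    mul_mul_mul_comm (n.factorial : ℂ) (n ^ (d₁ - 1)), hbal, div_div_div_cancel_right₀]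
  exact mul_ne_zero (mul_ne_zero hfac hfac) (mul_ne_zero (hpow _) (hpow _))

lemma tsum_dougallTerm_one {a b : ℝ} (hab : -2 < a + b) {P : ℂ} (hP : Complex.Gamma (P + b) ≠ 0) :
    ∑' x, dougallTerm a b P 1 x = dougallSum a b P 1 := by
  rw [tsum_eq_single 0]
  · have hΓ : (Real.Gamma (a + b + 2) : ℂ) ≠ 0 :=
      Complex.ofReal_ne_zero.2 (Real.Gamma_pos_of_pos (by linarith)).ne'
    simp only [dougallTerm, jacobiCore, leadFactor, two_mul_eps, if_true, dougallSum,
      Nat.cast_zero, zero_add, sub_zero, add_zero, Complex.Gamma_one, Real.Gamma_one]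
    rw [show (P + 1 + b - 1 : ℂ) = P + b by ring,
      show (P + 1 + a + b : ℂ) = P + (a + b + 1) by ring,
      show (1 + (a + b + 1) : ℂ) = (a + b + 2 : ℝ) by push_cast; ring,
      show (a + 1 : ℂ) = (a + 1 : ℝ) by push_cast; ring,
      show (1 + b : ℂ) = (b + 1 : ℝ) by push_cast; ring,
      show (a + b + 1 + 1 : ℝ) = a + b + 2 by ring]
    simp only [Complex.Gamma_ofReal]
    push_cast
    simp only [mul_inv, div_eq_mul_inv]
    field_simp
  · intro x hx
    obtain ⟨y, rfl⟩ := Nat.exists_eq_succ_of_ne_zero hx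
    have hpole : Complex.Gamma (1 - (y + 1 : ℕ)) = 0 :=
      Complex.Gamma_eq_zero_iff _ |>.2 ⟨y, by push_cast; ring⟩
    rw [dougallTerm, hpole, zero_mul, inv_zero, mul_zero, mul_zero]

/-- The limit of `Γ(Q) Γ(Q + a + b + 1) dougallTerm a b P Q` as `Q → ∞`. -/
noncomputable def dougallLimitTerm (a b : ℝ) (P : ℂ) (x : ℕ) : ℂ :=
  (jacobiCore a b x : ℂ) * (Complex.Gamma (P - x) * Complex.Gamma (P + (a + b + 1) + x))⁻¹

/-- The limit of `Γ(Q) Γ(Q + a + b + 1) dougallSum a b P Q` as `Q → ∞`. -/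
noncomputable def dougallLimitSum (a b : ℝ) (P : ℂ) : ℂ :=
  1 / 2 * Complex.Gamma (a + 1) * (Complex.Gamma P * Complex.Gamma (P + b))⁻¹

lemma dougallLimitTerm_summable {a b : ℝ} (hab : -2 < a + b) {P : ℂ} (hP : a - b + 2 < 2 * P.re) :
    Summable (dougallLimitTerm a b P) := by
  have hO := (Complex.isBigO_ofReal_left.2 (jacobiCore_isBigO hab)).mul
    (inv_Gamma_sub_mul_Gamma_add_isBigO P (P + (a + b + 1)))
  refine summable_of_isBigO_nat (g := fun n : ℕ => (n : ℝ) ^ (a - b + 1 - 2 * P.re))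
    (Real.summable_nat_rpow.2 (by linarith)) (hO.trans (EventuallyEq.isBigO ?_))
  filter_upwards [eventually_gt_atTop 0] with n hn
  rw [← Real.rpow_add (Nat.cast_pos.2 hn)]
  simp only [Complex.add_re, Complex.ofReal_re, Complex.one_re]
  ring_nf

section largeParameters

variable {a b : ℝ} {P Q : ℂ}

lemma tendsto_tsum_dougallTerm (hab : -2 < a + b) (hP : a - b + 2 < 2 * P.re) (hQ : 1 ≤ Q.re) :
    Tendsto (fun M : ℕ => Complex.Gamma (Q + M) * Complex.Gamma (Q + M + (a + b + 1)) *
      ∑' x, dougallTerm a b P (Q + M) x) atTop (𝓝 (∑' x, dougallLimitTerm a b P x)) := by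
  have hA : -1 < a + b + 1 := by linarith
  have hQM (M : ℕ) : 1 ≤ (Q + M).re := by
    simp only [Complex.add_re, Complex.natCast_re]
    exact le_add_of_le_of_nonneg hQ M.cast_nonneg
  have h := tendsto_tsum_of_dominated_convergence (𝓕 := atTop)
    (f := fun (M : ℕ) x => dougallLimitTerm a b P x * gammaQuot (a + b + 1) (Q + M) x)
    (dougallLimitTerm_summable hab hP).norm
    (fun x => by simpa using (gammaQuot_tendsto hA hQ x).const_mul (dougallLimitTerm a b P x))
    (.of_forall fun M x => by
      rw [norm_mul]
      exact mul_le_of_le_one_right (norm_nonneg _) (norm_gammaQuot_le hA (hQM M) x))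
  refine h.congr fun M => ?_
  rw [← tsum_mul_left]
  refine tsum_congr fun x => ?_
  simp only [dougallLimitTerm, gammaQuot, dougallTerm]
  push_cast
  ring

lemma tendsto_dougallSum (ha : -1 < a) (hb : -1 < b) (hP : 1 ≤ P.re) (hQ : 1 ≤ Q.re) :
    Tendsto (fun M : ℕ => Complex.Gamma (Q + M) * Complex.Gamma (Q + M + (a + b + 1)) *
      dougallSum a b P (Q + M)) atTop (𝓝 (dougallLimitSum a b P)) := by
  have h := (tendsto_Gamma_balanced_quot (c₁ := P + Q + b - 1) (c₂ := Q + (a + b + 1))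
    (d₁ := Q + b) (d₂ := P + Q + a + b) (by ring) (by simp; linarith) (by simp; linarith)
    (by simp; linarith) (by simp; linarith)).const_mul (dougallLimitSum a b P)
  rw [mul_one] at h
  refine h.congr fun M => ?_
  have hΓ : Complex.Gamma (Q + M) ≠ 0 := Complex.Gamma_ne_zero_of_re_pos <| by
    simp only [Complex.add_re, Complex.natCast_re]
    positivity
  rw [dougallLimitSum, dougallSum, show M + (P + Q + b - 1) = P + (Q + M) + b - 1 by ring,
    show M + (Q + (a + b + 1)) = Q + M + (a + b + 1) by ring,
    show M + (Q + b) = Q + M + b by ring, show M + (P + Q + a + b) = P + (Q + M) + a + b by ring]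
  simp only [div_eq_mul_inv, mul_inv]
  field_simp

lemma dougallLimitSum_ne_zero (ha : -1 < a) (hb : -1 < b) (hP : 1 ≤ P.re) :
    dougallLimitSum a b P ≠ 0 := by
  refine mul_ne_zero (mul_ne_zero (by norm_num) ?_) (inv_ne_zero (mul_ne_zero ?_ ?_)) <;>
    refine Complex.Gamma_ne_zero_of_re_pos ?_ <;> first | linarith | simp; linarith

lemma dougallSum_ne_zero (ha : -1 < a) (hb : -1 < b) (hP : 1 ≤ P.re) (hQ : 1 ≤ Q.re) :
    dougallSum a b P Q ≠ 0 := by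
  refine mul_ne_zero (mul_ne_zero (mul_ne_zero (by norm_num) ?_) ?_) (inv_ne_zero
    (mul_ne_zero (mul_ne_zero (mul_ne_zero ?_ ?_) (mul_ne_zero ?_ ?_)) ?_)) <;>
    refine Complex.Gamma_ne_zero_of_re_pos ?_ <;> first | linarith | simp; linarith

lemma dougall_ratio_add_one (ha : -1 < a) (hb : -1 < b) (hP : 1 ≤ P.re) (hQ : 1 ≤ Q.re) :
    (∑' x, dougallTerm a b P (Q + 1) x) / dougallSum a b P (Q + 1) =
      (∑' x, dougallTerm a b P Q x) / dougallSum a b P Q := by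
  have hc : P + Q + b - 1 ≠ 0 := Complex.ne_zero_of_re_pos (by simp; linarith)
  have hd : Q * (Q + b) * (P + Q + a + b) ≠ 0 := by
    refine mul_ne_zero (mul_ne_zero ?_ ?_) ?_ <;>
      refine Complex.ne_zero_of_re_pos ?_ <;> first | linarith | simp; linarith
  rw [← mul_div_mul_left _ _ hd, ← mul_div_mul_left (∑' x, dougallTerm a b P Q x) _ hc,
    dougallSum_contiguous a hc,
    dougallTerm_tsum_contiguous ha (by linarith) (by simp; linarith)]

lemma dougall_ratio_add_nat (ha : -1 < a) (hb : -1 < b) (hP : 1 ≤ P.re) (hQ : 1 ≤ Q.re) (M : ℕ) :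
    (∑' x, dougallTerm a b P (Q + M) x) / dougallSum a b P (Q + M) =
      (∑' x, dougallTerm a b P Q x) / dougallSum a b P Q := by
  induction M with
  | zero => rw [Nat.cast_zero, add_zero]
  | succ M ih =>
    rw [Nat.cast_succ, ← add_assoc, dougall_ratio_add_one ha hb hP (by simp; linarith), ih]

lemma dougall_ratio_eq_limit (ha : -1 < a) (hb : -1 < b) (hP : 1 ≤ P.re)
    (hP' : a - b + 2 < 2 * P.re) (hQ : 1 ≤ Q.re) :
    (∑' x, dougallTerm a b P Q x) / dougallSum a b P Q =
      (∑' x, dougallLimitTerm a b P x) / dougallLimitSum a b P := by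
  refine tendsto_nhds_unique (l := (atTop : Filter ℕ)) tendsto_const_nhds
    (((tendsto_tsum_dougallTerm (by linarith) hP' hQ).div (tendsto_dougallSum ha hb hP hQ)
      (dougallLimitSum_ne_zero ha hb hP)).congr fun M => ?_)
  rw [Pi.div_apply, mul_div_mul_left, dougall_ratio_add_nat ha hb hP hQ]
  refine mul_ne_zero ?_ ?_ <;>
    refine Complex.Gamma_ne_zero_of_re_pos ?_ <;> simp <;> linarith [M.cast_nonneg (α := ℝ)]

lemma tsum_dougallTerm_of_large (ha : -1 < a) (hb : -1 < b) (hP : 1 ≤ P.re)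
    (hP' : a - b + 2 < 2 * P.re) (hQ : 1 ≤ Q.re) :
    ∑' x, dougallTerm a b P Q x = dougallSum a b P Q := by
  have hone : (1 : ℝ) ≤ (1 : ℂ).re := le_rfl
  have hΓ : Complex.Gamma (P + b) ≠ 0 := Complex.Gamma_ne_zero_of_re_pos (by simp; linarith)
  rw [← div_eq_one_iff_eq (dougallSum_ne_zero ha hb hP hQ),
    dougall_ratio_eq_limit ha hb hP hP' hQ, ← dougall_ratio_eq_limit ha hb hP hP' hone,
    tsum_dougallTerm_one (by linarith) hΓ, div_self (dougallSum_ne_zero ha hb hP hone)]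

end largeParameters

lemma tsum_dougallTerm_of_add_nat {a b : ℝ} (ha : -1 < a) (hab : -2 < a + b) {P Q : ℂ}
    (h : 1 < (P + Q + b).re) (M : ℕ)
    (hM : ∑' x, dougallTerm a b P (Q + M) x = dougallSum a b P (Q + M)) :
    ∑' x, dougallTerm a b P Q x = dougallSum a b P Q := by
  induction M generalizing Q with
  | zero => simpa using hM
  | succ M ih =>
    have hc : P + Q + b - 1 ≠ 0 := Complex.ne_zero_of_re_pos (by simpa using h)
    apply mul_left_cancel₀ hc
    rw [← dougallTerm_tsum_contiguous ha hab h, ← dougallSum_contiguous a hc,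
      ih (by simp only [Complex.add_re, Complex.one_re] at h ⊢; linarith)
        (by rwa [add_assoc, add_comm (1 : ℂ), ← Nat.cast_succ])]

theorem dougallTerm_hasSum {a b : ℝ} (ha : -1 < a) (hb : -1 < b) {P Q : ℂ}
    (h : 1 < (P + Q + b).re) : HasSum (dougallTerm a b P Q) (dougallSum a b P Q) := by
  have hab : -2 < a + b := by linarith
  obtain ⟨M, hM⟩ := exists_nat_gt (|P.re| + |Q.re| + |a| + |b| + 1)
  suffices ∑' x, dougallTerm a b P Q x = dougallSum a b P Q from
    this ▸ (dougallTerm_summable hab h).hasSum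
  refine tsum_dougallTerm_of_add_nat ha hab h M ?_
  rw [dougallTerm_comm, dougallSum_comm]
  refine tsum_dougallTerm_of_add_nat ha hab
    (by simp only [Complex.add_re, Complex.natCast_re] at h ⊢; linarith [M.cast_nonneg (α := ℝ)]) M
    (tsum_dougallTerm_of_large ha hb ?_ ?_ ?_) <;>
    simp only [Complex.add_re, Complex.natCast_re] <;>
    linarith [neg_abs_le P.re, neg_abs_le Q.re, abs_nonneg P.re, abs_nonneg Q.re, abs_nonneg a,
      le_abs_self a, neg_abs_le b, abs_nonneg b]

/-! ### Newton polynomials and finite differences -/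

section Newton

variable {R : Type*} [CommRing R]

/-- The Newton basis `1, X - f 0, (X - f 0) (X - f 1), …` of the polynomials. -/
noncomputable def newtonSequence [Nontrivial R] (f : ℕ → R) : Polynomial.Sequence R :=
  ⟨fun k => Lagrange.nodal (Finset.range k) f, fun k => by simp [Lagrange.degree_nodal]⟩

lemma newtonSequence_apply [Nontrivial R] (f : ℕ → R) (k : ℕ) :
    newtonSequence f k = ∏ j ∈ Finset.range k, (X - C (f j)) := rfl

lemma newtonSequence_monic [Nontrivial R] (f : ℕ → R) (k : ℕ) : (newtonSequence f k).Monic := by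
  rw [newtonSequence_apply]
  exact monic_prod_X_sub_C f _

lemma isUnit_leadingCoeff_newtonSequence [Nontrivial R] (f : ℕ → R) (k : ℕ) :
    IsUnit (newtonSequence f k).leadingCoeff := by
  simp [(newtonSequence_monic f k).leadingCoeff]

lemma monic_sum_newtonSequence [Nontrivial R] (f c : ℕ → R) (n : ℕ) (hc : c n = 1) :
    (∑ k ∈ Finset.range (n + 1), C (c k) * newtonSequence f k).Monic ∧
      (∑ k ∈ Finset.range (n + 1), C (c k) * newtonSequence f k).natDegree = n := by
  have hlow : (∑ k ∈ Finset.range n, C (c k) * newtonSequence f k).degree <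
      (newtonSequence f n).degree := by
    rw [Sequence.degree_eq]
    refine (degree_sum_le _ _).trans_lt
      ((Finset.sup_lt_iff (WithBot.bot_lt_coe n)).2 fun k hk => ?_)
    rw [C_mul']
    refine (degree_smul_le _ _).trans_lt ?_
    rw [Sequence.degree_eq]
    exact WithBot.coe_lt_coe.2 (Finset.mem_range.1 hk)
  rw [Finset.sum_range_succ, hc, C_1, one_mul]
  refine ⟨(newtonSequence_monic f n).add_of_right hlow, ?_⟩
  rw [natDegree_add_eq_right_of_degree_lt hlow, Sequence.natDegree_eq]

lemma hasSum_mul_eval_eq_zero {ι : Type*} [TopologicalSpace R] [IsTopologicalSemiring R]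
    (S : Polynomial.Sequence R) (hS : ∀ i, IsUnit (S i).leadingCoeff) {u w : ι → R} {n : ℕ}
    (h : ∀ j < n, HasSum (fun x => w x * (S j).eval (u x)) 0) {q : R[X]} (hq : q.degree < n) :
    HasSum (fun x => w x * q.eval (u x)) 0 := by
  have hspan : q ∈ Submodule.span R (S '' Set.Iio n) := by
    rw [Sequence.span_degreeLT _ fun j _ => hS j]
    exact mem_degreeLT.2 hq
  clear hq
  induction hspan using Submodule.span_induction with
  | mem p hp =>
    obtain ⟨j, hj, rfl⟩ := hp
    exact h j hj
  | zero => simp [hasSum_zero]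
  | add p q _ _ hp hq => simpa only [eval_add, mul_add, add_zero] using hp.add hq
  | smul c p _ hp =>
    simpa only [eval_smul, smul_eq_mul, mul_left_comm, mul_zero] using hp.mul_left c

end Newton

lemma newtonSequence_eval_sq (c e : ℂ) (j : ℕ) (x : ℂ) :
    (newtonSequence (fun i => (c + i - e) ^ 2) j).eval ((x + e) ^ 2) =
      (-1) ^ j * (poch (x + c) j * poch (c - 2 * e - x) j) := by
  induction j with
  | zero => simp [newtonSequence_apply, poch]
  | succ j ih =>
    rw [newtonSequence_apply, Finset.prod_range_succ, ← newtonSequence_apply, eval_mul, ih,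
      poch_succ, poch_succ]
    simp only [eval_sub, eval_C, eval_X]
    ring

lemma poch_neg_mul_inv_Gamma (k y : ℕ) :
    poch (-((y + k : ℕ) : ℂ)) k * (Complex.Gamma ((y + k : ℕ) + 1))⁻¹ =
      (-1) ^ k * (Complex.Gamma (y + 1))⁻¹ := by
  rw [inv_Gamma_eq_poch_mul (y + 1) k, ← mul_assoc, ← poch_reflect]
  push_cast
  ring_nf

lemma poch_neg_div_factorial {n k : ℕ} (h : k ≤ n) :
    poch (-(n : ℂ)) k / (k.factorial : ℂ) = (-1) ^ k * (n.choose k : ℂ) := by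
  obtain ⟨m, rfl⟩ := Nat.exists_eq_add_of_le' h
  have hshift := poch_neg_mul_inv_Gamma k m
  rw [Complex.Gamma_nat_eq_factorial, Complex.Gamma_nat_eq_factorial,
    mul_inv_eq_iff_eq_mul₀ (Nat.cast_ne_zero.2 (Nat.factorial_ne_zero _))] at hshift
  rw [hshift, Nat.cast_choose ℂ h, Nat.add_sub_cancel]
  field_simp

lemma sum_poch_neg_eq_fwdDiff (f : ℂ → ℂ) (n : ℕ) :
    ∑ k ∈ Finset.range (n + 1), poch (-(n : ℂ)) k / (k.factorial : ℂ) * f k =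
      (-1) ^ n * (fwdDiff 1)^[n] f 0 := by
  rw [fwdDiff_iter_eq_sum_shift, Finset.mul_sum]
  refine Finset.sum_congr rfl fun k hk => ?_
  have hk' : k ≤ n := Nat.lt_succ_iff.1 (Finset.mem_range.1 hk)
  have hsign : (-1 : ℂ) ^ n * (-1) ^ (n - k) = (-1) ^ k := by
    obtain ⟨m, rfl⟩ := Nat.exists_eq_add_of_le hk'
    rw [Nat.add_sub_cancel_left, pow_add, mul_assoc, ← mul_pow, neg_one_mul, neg_neg, one_pow,
      mul_one]
  rw [poch_neg_div_factorial hk', zsmul_eq_mul]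
  push_cast
  rw [zero_add, nsmul_one, ← mul_assoc, ← mul_assoc, hsign]

lemma sum_poch_neg_mul_eval_eq_zero {n : ℕ} {R : ℂ[X]} (hR : R.degree < n) :
    ∑ k ∈ Finset.range (n + 1), poch (-(n : ℂ)) k / (k.factorial : ℂ) * R.eval (k : ℂ) = 0 := by
  rcases eq_or_ne R 0 with rfl | hR0
  · simp
  rw [← natDegree_lt_iff_degree_lt hR0] at hR
  rw [sum_poch_neg_eq_fwdDiff (fun x => R.eval x), fwdDiff_iter_eq_zero_of_degree_lt hR,
    Pi.zero_apply, mul_zero]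

lemma fwdDiff_iter_inv_const_sub {c x : ℂ} {n : ℕ} (hx : ∀ i ≤ n, c - x - i ≠ 0) :
    (fwdDiff 1)^[n] (fun y => (c - y)⁻¹) x =
      n.factorial * (∏ i ∈ Finset.range (n + 1), (c - x - i))⁻¹ := by
  induction n generalizing x with
  | zero => simp
  | succ n ih =>
    have hcast (i : ℕ) : c - (x + 1) - i = c - x - (i + 1 : ℕ) := by push_cast; ring
    rw [Function.iterate_succ_apply', fwdDiff, ih fun i hi => hx i (by omega),
      ih fun i hi => hcast i ▸ hx (i + 1) (by omega)]
    simp_rw [hcast]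
    have hlast := Finset.prod_range_succ (fun i : ℕ => c - x - i) (n + 1)
    have hfirst := Finset.prod_range_succ' (fun i : ℕ => c - x - i) (n + 1)
    have hne : ∀ i ∈ Finset.range (n + 1 + 1), c - x - (i : ℕ) ≠ 0 := fun i hi =>
      hx i (by simpa [Nat.lt_succ_iff] using hi)
    have hprod := Finset.prod_ne_zero_iff.2 hne
    rw [hlast] at hfirst ⊢
    rw [hlast] at hprod
    have hprod' := hfirst ▸ hprod
    rw [Nat.factorial_succ]
    push_cast at *
    have h₁ := left_ne_zero_of_mul hprod
    have h₂ := right_ne_zero_of_mul hprod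
    have h₃ := left_ne_zero_of_mul hprod'
    field_simp
    linear_combination (n.factorial : ℂ) * hfirst

lemma degree_divByMonic_X_sub_C_lt {A : Type*} [CommRing A] [Nontrivial A] {n : ℕ} {p : A[X]}
    (hp : p.natDegree ≤ n) (c : A) : (p /ₘ (X - C c)).degree < n := by
  rcases eq_or_ne p 0 with rfl | hp0
  · simp
  · exact (degree_divByMonic_lt p (X - C c) hp0 (by simp)).trans_le
      (natDegree_le_iff_degree_le.1 hp)

lemma eval_eq_add_sub_mul_eval_divByMonic {A : Type*} [CommRing A] (p : A[X]) (c x : A) :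
    p.eval x = p.eval c + (x - c) * (p /ₘ (X - C c)).eval x := by
  conv_lhs => rw [← modByMonic_add_div p (X - C c), modByMonic_X_sub_C_eq_C_eval]
  simp

lemma sum_poch_neg_mul_eval_div {n : ℕ} {R : ℂ[X]} (hR : R.natDegree ≤ n) {c : ℂ}
    (hc : ∀ i ≤ n, c - i ≠ 0) :
    ∑ k ∈ Finset.range (n + 1), poch (-(n : ℂ)) k / (k.factorial : ℂ) *
      (R.eval (k : ℂ) * (c - k)⁻¹) =
    R.eval c * ((-1) ^ n * n.factorial * (∏ i ∈ Finset.range (n + 1), (c - i))⁻¹) := by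
  have hpole : ∑ k ∈ Finset.range (n + 1), poch (-(n : ℂ)) k / (k.factorial : ℂ) * (c - k)⁻¹ =
      (-1) ^ n * n.factorial * (∏ i ∈ Finset.range (n + 1), (c - i))⁻¹ := by
    rw [sum_poch_neg_eq_fwdDiff (fun x => (c - x)⁻¹),
      fwdDiff_iter_inv_const_sub (by simpa using hc)]
    simp [mul_assoc]
  have hpoly : ∑ k ∈ Finset.range (n + 1), poch (-(n : ℂ)) k / (k.factorial : ℂ) *
      (R /ₘ (X - C c)).eval (k : ℂ) = 0 :=
    sum_poch_neg_mul_eval_eq_zero (degree_divByMonic_X_sub_C_lt hR c)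
  rw [← hpole, Finset.mul_sum, ← sub_zero (∑ k ∈ _, R.eval c * _), ← hpoly,
    ← Finset.sum_sub_distrib]
  refine Finset.sum_congr rfl fun k hk => ?_
  have hk0 := hc k (Nat.lt_succ_iff.1 (Finset.mem_range.1 hk))
  rw [eval_eq_add_sub_mul_eval_divByMonic R c]
  field_simp
  ring

lemma natDegree_ascPochhammer_comp_le {A : Type*} [CommRing A] [IsDomain A] (m : ℕ) {p : A[X]}
    (hp : p.natDegree ≤ 1) : ((ascPochhammer A m).comp p).natDegree ≤ m := by
  refine natDegree_comp_le.trans ?_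
  rw [ascPochhammer_natDegree]
  exact mul_le_of_le_one_right' hp

/-! ### Pairings of the Newton bases at the two ends of the weight -/

lemma Gamma_add_nat {c : ℂ} (hc : ∀ m : ℕ, c ≠ -m) (n : ℕ) :
    Complex.Gamma (c + n) = poch c n * Complex.Gamma c := by
  rw [poch_eq_Gamma_div c n hc, div_mul_cancel₀ _ (Complex.Gamma_ne_zero hc)]

lemma hat_cast (a b : ℝ) (x : ℕ) : (hat a b x : ℂ) = ((x : ℂ) + (eps a b : ℂ)) ^ 2 := by
  simp [hat]

lemma weightC_eq_dougallTerm (z z' : ℂ) (a b : ℝ) (N x : ℕ) :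
    weightC z z' a b N x = dougallTerm a b (z + N) (z' + N) x := by
  have hε : 2 * (eps a b : ℂ) = a + b + 1 := by exact_mod_cast two_mul_eps a b
  rw [weightC, dougallTerm, jacobiCore, hε, ← mul_inv]
  ring_nf

lemma leadFactor_shift {a b : ℝ} (hab : -2 < a + b) (k y : ℕ) :
    (leadFactor a b (y + k) : ℂ) * poch ((y + k : ℕ) + (a + b + 1)) k =
      leadFactor (a + k) (b + k) y := by
  rcases k.eq_zero_or_pos with rfl | hk
  · simp [poch]
  have hk' : (1 : ℝ) ≤ k := Nat.one_le_cast.2 hk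
  have : (0 : ℝ) ≤ y := y.cast_nonneg
  have heps : eps (a + k) (b + k) = eps a b + k := by
    rw [eps, eps]
    ring
  have hΓ := Gamma_add_nat (c := (y + k : ℕ) + (a + b + 1))
    (ne_neg_natCast_of_re_pos (by simp; linarith)) k
  have hε : 0 < eps a b + k := by linarith [two_mul_eps a b]
  rw [leadFactor_eq _ (.inl (by omega)), leadFactor_eq _ (.inr (heps ▸ hε.ne')), heps, mul_add,
    two_mul_eps]
  push_cast [← Complex.Gamma_ofReal] at hΓ ⊢
  rw [mul_assoc, mul_comm (Complex.Gamma _), ← hΓ]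
  ring_nf

lemma jacobiCore_shift {a b : ℝ} (hab : -2 < a + b) (k y : ℕ) :
    poch ((y + k : ℕ) + (a + b + 1)) k * poch (-((y + k : ℕ) : ℂ)) k * jacobiCore a b (y + k) =
      (-1) ^ k * jacobiCore (a + k) (b + k) y := by
  have hfactorial := poch_neg_mul_inv_Gamma k y
  have hΓa : Real.Gamma ((y + k : ℕ) + a + 1) = Real.Gamma (y + (a + k) + 1) := by
    push_cast
    ring_nf
  have hΓb : Real.Gamma ((y + k : ℕ) + b + 1) = Real.Gamma (y + (b + k) + 1) := by
    push_cast
    ring_nf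
  rw [jacobiCore, jacobiCore, hΓa, hΓb, div_eq_mul_inv, div_eq_mul_inv, mul_inv, mul_inv]
  push_cast [← leadFactor_shift hab, ← Complex.Gamma_ofReal] at hfactorial ⊢
  linear_combination (leadFactor a b (y + k) * poch (y + k + (a + b + 1)) k *
    Complex.Gamma (y + (a + k) + 1) * (Complex.Gamma (y + (b + k) + 1))⁻¹) * hfactorial

lemma inv_Gamma_shift (Q A : ℂ) (k j y : ℕ) :
    (poch ((y + k : ℕ) + (1 - Q)) j * poch (1 - Q - A - (y + k : ℕ)) j) *
      (Complex.Gamma (Q - (y + k : ℕ)) * Complex.Gamma (Q + A + (y + k : ℕ)))⁻¹ =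
    (Complex.Gamma (Q - k - j - y) * Complex.Gamma (Q - k - j + (A + 2 * k) + y))⁻¹ := by
  have hleft : (Complex.Gamma (Q - k - j - y))⁻¹ = (-1) ^ j * poch ((y + k : ℕ) + (1 - Q)) j *
      (Complex.Gamma (Q - (y + k : ℕ)))⁻¹ := by
    convert inv_Gamma_sub_nat (Q - (y + k : ℕ)) j using 3 <;> push_cast <;> ring_nf
  have hright : (Complex.Gamma (Q - k - j + (A + 2 * k) + y))⁻¹ =
      (-1) ^ j * poch (1 - Q - A - (y + k : ℕ)) j *
        (Complex.Gamma (Q + A + (y + k : ℕ)))⁻¹ := by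
    convert inv_Gamma_sub_nat (Q + A + (y + k : ℕ)) j using 3 <;> push_cast <;> ring_nf
  have hsign : (-1 : ℂ) ^ j * (-1) ^ j = 1 := pow_mul_pow_eq_one _ (by norm_num)
  rw [mul_inv, mul_inv, hleft, hright]
  linear_combination -(poch ((y + k : ℕ) + (1 - Q)) j * poch (1 - Q - A - (y + k : ℕ)) j *
    (Complex.Gamma (Q - (y + k : ℕ)))⁻¹ * (Complex.Gamma (Q + A + (y + k : ℕ)))⁻¹) * hsign

lemma dougallTerm_shift {a b : ℝ} (hab : -2 < a + b) (P Q : ℂ) (k j y : ℕ) :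
    poch ((y + k : ℕ) + (a + b + 1)) k * poch (-((y + k : ℕ) : ℂ)) k *
      (poch ((y + k : ℕ) + (1 - Q)) j * poch (1 - Q - (a + b + 1) - (y + k : ℕ)) j) *
        dougallTerm a b P Q (y + k) =
      (-1) ^ k * dougallTerm (a + k) (b + k) (P - k) (Q - k - j) y := by
  have hcore := jacobiCore_shift hab k y
  have hP := inv_Gamma_shift P (a + b + 1) k 0 y
  have hQ := inv_Gamma_shift Q (a + b + 1) k j y
  have hA : (((a + k : ℝ) : ℂ) + ((b + k : ℝ) : ℂ) + 1) = a + b + 1 + 2 * k := by push_cast; ring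
  simp only [poch, ascPochhammer_zero, eval_one, Nat.cast_zero, sub_zero, one_mul] at hP
  rw [dougallTerm, dougallTerm, hA, ← hP, ← hQ]
  linear_combination (poch ((y + k : ℕ) + (1 - Q)) j *
    poch (1 - Q - (a + b + 1) - (y + k : ℕ)) j *
    (Complex.Gamma (P - (y + k : ℕ)) * Complex.Gamma (P + (a + b + 1) + (y + k : ℕ)))⁻¹ *
    (Complex.Gamma (Q - (y + k : ℕ)) * Complex.Gamma (Q + (a + b + 1) + (y + k : ℕ)))⁻¹) * hcore

lemma poch_mul_dougallTerm_hasSum {a b : ℝ} (ha : -1 < a) (hb : -1 < b) {P Q : ℂ} (k j : ℕ)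
    (h : k + j + 1 < (P + Q + b).re) :
    HasSum (fun x : ℕ => poch (x + (a + b + 1)) k * poch (-(x : ℂ)) k *
      (poch (x + (1 - Q)) j * poch (1 - Q - (a + b + 1) - x) j) * dougallTerm a b P Q x)
      ((-1) ^ k * dougallSum (a + k) (b + k) (P - k) (Q - k - j)) := by
  have : (0 : ℝ) ≤ k := k.cast_nonneg
  have hsum := (dougallTerm_hasSum (a := a + k) (b := b + k) (P := P - k) (Q := Q - k - j)
    (by linarith) (by linarith) (by simp at h ⊢; linarith)).mul_left ((-1) ^ k)
  rw [← hasSum_nat_add_iff' k, Finset.sum_eq_zero, sub_zero]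
  · exact hsum.congr_fun fun y => dougallTerm_shift (by linarith) P Q k j y
  · intro x hx
    rw [poch_neg_nat (Finset.mem_range.1 hx)]
    ring

/-- The part of the pairing of `latticePoly a b k` with the degree `j` dual polynomial that does
not depend on `k`. -/
noncomputable def pairConst (a b : ℝ) (P Q : ℂ) (j : ℕ) : ℂ :=
  1 / 2 * Complex.Gamma (a + 1) * (Complex.Gamma P * Complex.Gamma Q * Complex.Gamma (P + b) *
    Complex.Gamma (Q + b - j) * Complex.Gamma (P + Q + a + b - j))⁻¹

lemma dougallSum_shift {a : ℝ} (ha : -1 < a) (b : ℝ) (P Q : ℂ) (k j : ℕ) :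
    dougallSum (a + k) (b + k) (P - k) (Q - k - j) =
      (-1) ^ j * pairConst a b P Q j * (poch (1 + a) k * poch (1 - P) k * poch (1 - Q) k *
        poch (1 - Q + k) j * Complex.Gamma (P + Q + b - 1 - k - j)) := by
  have hP := inv_Gamma_sub_nat P k
  have hQ := inv_Gamma_sub_nat Q (k + j)
  have hΓ := Gamma_add_nat (c := 1 + a) (ne_neg_natCast_of_re_pos (by simp; linarith)) k
  have hsign : (-1 : ℂ) ^ k * (-1) ^ k = 1 := pow_mul_pow_eq_one _ (by norm_num)
  rw [poch_add, Nat.cast_add, ← sub_sub] at hQ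
  rw [dougallSum, pairConst]
  simp only [mul_inv, hP, hQ]
  push_cast
  rw [show (a + k + 1 : ℂ) = 1 + a + k by ring, hΓ, add_comm (a : ℂ) 1,
    show P - k + (Q - k - j) + (b + k) - 1 = P + Q + b - 1 - k - j by ring,
    show P - k + (b + k) = P + b by ring, show Q - k - j + (b + k) = Q + b - j by ring,
    show P - k + (Q - k - j) + (a + k) + (b + k) = P + Q + a + b - j by ring, pow_add]
  linear_combination (1 / 2 * (-1) ^ j * (poch (1 + a) k * Complex.Gamma (1 + a)) *
    Complex.Gamma (P + Q + b - 1 - k - j) * poch (1 - P) k * (Complex.Gamma P)⁻¹ *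
    (poch (1 - Q) k * poch (1 - Q + k) j) * (Complex.Gamma Q)⁻¹ * (Complex.Gamma (P + b))⁻¹ *
    (Complex.Gamma (Q + b - j))⁻¹ * (Complex.Gamma (P + Q + a + b - j))⁻¹) * hsign

/-- The Newton basis at the nodes attached to `Q`: its members multiply the weight with parameters
`P, Q` into weights with `Q` shifted. -/
noncomputable def dualPoly (a b : ℝ) (Q : ℂ) : Polynomial.Sequence ℂ :=
  newtonSequence fun i => (1 - Q + i - eps a b) ^ 2

lemma latticePoly_pairing {a b : ℝ} (ha : -1 < a) (hb : -1 < b) {P Q : ℂ} (k j : ℕ)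
    (h : k + j + 1 < (P + Q + b).re) :
    HasSum (fun x => (latticePoly a b k).eval (hat a b x : ℂ) *
      (dualPoly a b Q j).eval (hat a b x : ℂ) * dougallTerm a b P Q x)
      (pairConst a b P Q j * ((-1) ^ k * (poch (1 + a) k * poch (1 - P) k * poch (1 - Q) k) *
        poch (1 - Q + k) j * Complex.Gamma (P + Q + b - 1 - k - j))) := by
  have hε : 2 * (eps a b : ℂ) = a + b + 1 := by exact_mod_cast two_mul_eps a b
  have hsign : (-1 : ℂ) ^ j * (-1) ^ j = 1 := pow_mul_pow_eq_one j (by norm_num)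
  have hsum := (poch_mul_dougallTerm_hasSum ha hb k j h).mul_left ((-1) ^ j)
  rw [dougallSum_shift ha, ← mul_assoc ((-1 : ℂ) ^ k), mul_left_comm ((-1 : ℂ) ^ k), mul_assoc,
    ← mul_assoc, ← mul_assoc, hsign, one_mul] at hsum
  rw [mul_assoc ((-1 : ℂ) ^ k), mul_assoc ((-1 : ℂ) ^ k), mul_left_comm, ← mul_assoc ((-1 : ℂ) ^ k)]
  refine hsum.congr_fun fun x => ?_
  rw [hat_cast, latticePoly_eval, dualPoly, newtonSequence_eval_sq, hε]
  ring

/-! ### Orthogonality of the Wilson–Neretin polynomials -/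

/-- The exponent `Σ + 2N - 1`: the weight pairs absolutely with polynomials in `x̂` of degree less
than its real part. -/
noncomputable def decay (z z' : ℂ) (b : ℝ) (N : ℕ) : ℂ := sig z z' b + 2 * N - 1

/-- The prefactor of the sum defining `𝔭_n`. -/
noncomputable def neretinFactor (z z' : ℂ) (a b : ℝ) (N n : ℕ) : ℂ :=
  poch (1 + a) n * poch (1 - z - N) n * poch (1 - z' - N) n / poch (n - decay z z' b N) n

lemma decay_re (z z' : ℂ) (b : ℝ) (N : ℕ) :
    (decay z z' b N).re = (sig z z' b).re + 2 * N - 1 := by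
  simp [decay]

lemma neretin_eq (z z' : ℂ) (a b : ℝ) (N n : ℕ) :
    neretin z z' a b N n = C (neretinFactor z z' a b N n) * ∑ k ∈ Finset.range (n + 1),
      C (poch (-(n : ℂ)) k * poch (n - decay z z' b N) k /
        (poch (1 + a) k * poch (1 - z - N) k * poch (1 - z' - N) k * (k.factorial : ℂ))) *
      latticePoly a b k := by
  have hd : (n : ℂ) + 1 - 2 * N - sig z z' b = n - decay z z' b N := by rw [decay]; ring
  rw [neretin, hd, neretinFactor]

lemma latticePoly_eq (a b : ℝ) (k : ℕ) :
    latticePoly a b k = C ((-1) ^ k) * newtonSequence (fun j => ((j : ℂ) + eps a b) ^ 2) k := by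
  rw [latticePoly, newtonSequence_apply, C_pow, ← Finset.card_range k, ← Finset.prod_const,
    Finset.card_range, ← Finset.prod_mul_distrib]
  simp

lemma neg_one_pow_mul_poch_neg_mul_Gamma {t : ℂ} {k : ℕ} (ht : ∀ m : ℕ, t - k + 1 ≠ -m) :
    (-1) ^ k * poch (-t) k * Complex.Gamma (t - k + 1) = Complex.Gamma (t + 1) := by
  have hreflect := poch_reflect k (t - k + 1)
  have hΓ := Gamma_add_nat ht k
  rw [show 1 - (t - k + 1) - k = -t by ring] at hreflect
  rw [show t - k + 1 + k = t + 1 by ring] at hΓ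
  rw [hreflect, hΓ, ← mul_assoc, pow_mul_pow_eq_one k (by norm_num), one_mul]

lemma poch_one_add_ne_zero {a : ℝ} (ha : -1 < a) (n : ℕ) : poch (1 + a) n ≠ 0 :=
  poch_ne_zero _ n (ne_neg_natCast_of_re_pos (by simp; linarith))

lemma latticePoly_pairing_weightC {z z' : ℂ} {a b : ℝ} (ha : -1 < a) (hb : -1 < b) (N k j : ℕ)
    (h : k + j < (decay z z' b N).re) :
    HasSum (fun x => (latticePoly a b k).eval (hat a b x : ℂ) *
      (dualPoly a b (z' + N) j).eval (hat a b x : ℂ) * weightC z z' a b N x)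
      (pairConst a b (z + N) (z' + N) j * ((-1) ^ k * (poch (1 + a) k * poch (1 - z - N) k *
        poch (1 - z' - N) k) * poch (1 - z' - N + k) j *
          Complex.Gamma (decay z z' b N - k - j))) := by
  have hdecay : z + N + (z' + N) + b - 1 = decay z z' b N := by rw [decay, sig]; ring
  have hpair := latticePoly_pairing ha hb (P := z + N) (Q := z' + N) k j (by
    rw [← hdecay] at h; simp at h ⊢; linarith)
  rw [hdecay, ← sub_sub, ← sub_sub] at hpair
  exact hpair.congr_fun fun x => by rw [weightC_eq_dougallTerm]

lemma neretin_pairing {z z' : ℂ} {a b : ℝ} (ha : -1 < a) (hb : -1 < b) {N n : ℕ} (j : ℕ)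
    (hP : ∀ k ≤ n, poch (1 - z - N) k ≠ 0) (hQ : ∀ k ≤ n, poch (1 - z' - N) k ≠ 0)
    (h : n + j < (decay z z' b N).re) :
    HasSum (fun x => (neretin z z' a b N n).eval (hat a b x : ℂ) *
      (dualPoly a b (z' + N) j).eval (hat a b x : ℂ) * weightC z z' a b N x)
      (neretinFactor z z' a b N n * pairConst a b (z + N) (z' + N) j *
        ∑ k ∈ Finset.range (n + 1), poch (-(n : ℂ)) k / (k.factorial : ℂ) *
          (poch (1 - z' - N + k) j *
            ((-1) ^ k * poch (n - decay z z' b N) k *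
              Complex.Gamma (decay z z' b N - k - j)))) := by
  have hle : ∀ k ∈ Finset.range (n + 1), k ≤ n := fun k hk =>
    Nat.lt_succ_iff.1 (Finset.mem_range.1 hk)
  have hterm := (hasSum_sum fun k hk =>
    (latticePoly_pairing_weightC (z := z) (z' := z') ha hb N k j (by
      have : (k : ℝ) ≤ n := Nat.cast_le.2 (hle k hk)
      linarith)).mul_left (poch (-(n : ℂ)) k * poch (n - decay z z' b N) k /
        (poch (1 + a) k * poch (1 - z - N) k * poch (1 - z' - N) k * (k.factorial : ℂ)))).mul_left
    (neretinFactor z z' a b N n)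
  have hvalue : ∀ k ∈ Finset.range (n + 1), poch (-(n : ℂ)) k * poch (n - decay z z' b N) k /
      (poch (1 + a) k * poch (1 - z - N) k * poch (1 - z' - N) k * (k.factorial : ℂ)) *
      (pairConst a b (z + N) (z' + N) j * ((-1) ^ k * (poch (1 + a) k * poch (1 - z - N) k *
        poch (1 - z' - N) k) * poch (1 - z' - N + k) j *
          Complex.Gamma (decay z z' b N - k - j))) =
      pairConst a b (z + N) (z' + N) j * (poch (-(n : ℂ)) k / (k.factorial : ℂ) *
        (poch (1 - z' - N + k) j *
          ((-1) ^ k * poch (n - decay z z' b N) k * Complex.Gamma (decay z z' b N - k - j)))) := by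
    intro k hk
    have hpoch := poch_one_add_ne_zero ha k
    have hPk := hP k (hle k hk)
    have hQk := hQ k (hle k hk)
    field_simp
  rw [Finset.sum_congr rfl hvalue, ← Finset.mul_sum, ← mul_assoc] at hterm
  refine hterm.congr_fun fun x => ?_
  rw [neretin_eq, eval_mul, eval_C, eval_finsetSum, mul_assoc, mul_assoc, Finset.sum_mul]
  congr 1
  refine Finset.sum_congr rfl fun k _ => ?_
  rw [eval_mul, eval_C]
  ring

lemma degree_ascPochhammer_comp_mul_lt {A : Type*} [CommRing A] [IsDomain A] {m l n : ℕ}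
    (h : m + l < n) {p q : A[X]} (hp : p.natDegree ≤ 1) (hq : q.natDegree ≤ 1) :
    ((ascPochhammer A m).comp p * (ascPochhammer A l).comp q).degree < n := by
  have hle := (natDegree_mul_le (p := (ascPochhammer A m).comp p)
    (q := (ascPochhammer A l).comp q)).trans (add_le_add (natDegree_ascPochhammer_comp_le m hp)
      (natDegree_ascPochhammer_comp_le l hq))
  exact degree_le_natDegree.trans_lt (Nat.cast_lt.2 (hle.trans_lt h))

lemma neretin_pairing_eq_zero {z z' : ℂ} {a b : ℝ} (ha : -1 < a) (hb : -1 < b) {N n j : ℕ}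
    (hj : j < n) (hP : ∀ k ≤ n, poch (1 - z - N) k ≠ 0) (hQ : ∀ k ≤ n, poch (1 - z' - N) k ≠ 0)
    (hpole : ∀ m : ℕ, decay z z' b N - 2 * n + 1 ≠ -m)
    (h : n + j < (decay z z' b N).re) :
    HasSum (fun x => (neretin z z' a b N n).eval (hat a b x : ℂ) *
      (dualPoly a b (z' + N) j).eval (hat a b x : ℂ) * weightC z z' a b N x) 0 := by
  set t := decay z z' b N - n with ht
  let R : ℂ[X] := (ascPochhammer ℂ j).comp (C (1 - z' - N) + X) *
    (ascPochhammer ℂ (n - 1 - j)).comp (C (t + 1) - X)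
  have hR : R.degree < n := degree_ascPochhammer_comp_mul_lt (by omega) (by compute_degree)
    (by compute_degree)
  have hterm : ∀ k ∈ Finset.range (n + 1), poch (-(n : ℂ)) k / (k.factorial : ℂ) *
      (poch (1 - z' - N + k) j *
        ((-1) ^ k * poch (n - decay z z' b N) k * Complex.Gamma (decay z z' b N - k - j))) =
      Complex.Gamma (t + 1) * (poch (-(n : ℂ)) k / (k.factorial : ℂ) * R.eval (k : ℂ)) := by
    intro k hk
    have hk' : k ≤ n := Nat.lt_succ_iff.1 (Finset.mem_range.1 hk)
    have htk : ∀ m : ℕ, t - k + 1 ≠ -m := fun m hm => hpole (n - k + m) (by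
      push_cast [hk']
      linear_combination hm)
    have hΓ := Gamma_add_nat htk (n - 1 - j)
    have hcast : t - k + 1 + (n - 1 - j : ℕ) = decay z z' b N - k - j := by
      rw [Nat.sub_sub, Nat.cast_sub (by omega)]
      push_cast
      ring
    rw [← hcast, hΓ, ← neg_sub (decay z z' b N), ← ht, ← neg_one_pow_mul_poch_neg_mul_Gamma htk]
    simp only [R, eval_mul, eval_comp, eval_add, eval_sub, eval_C, eval_X, poch, sub_add_eq_add_sub]
    ring
  have hsum := neretin_pairing ha hb j hP hQ h
  rwa [Finset.sum_congr rfl hterm, ← Finset.mul_sum, sum_poch_neg_mul_eval_eq_zero hR, mul_zero,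
    mul_zero] at hsum

lemma prod_sub_natCast (t : ℂ) (n : ℕ) :
    ∏ i ∈ Finset.range (n + 1), (t - i) = poch (t - n) (n + 1) := by
  rw [poch_eq_prod, ← Finset.prod_range_reflect]
  refine Finset.prod_congr rfl fun i hi => ?_
  rw [Nat.add_sub_cancel, Nat.cast_sub (Nat.lt_succ_iff.1 (Finset.mem_range.1 hi))]
  ring

lemma Gamma_add_one_mul_inv_prod {t : ℂ} {n : ℕ} (ht : ∀ m : ℕ, t - n ≠ -m) :
    Complex.Gamma (t + 1) * (∏ i ∈ Finset.range (n + 1), (t - i))⁻¹ = Complex.Gamma (t - n) := by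
  have hΓ := Gamma_add_nat ht (n + 1)
  rw [show t - n + (n + 1 : ℕ) = t + 1 by push_cast; ring] at hΓ
  rw [hΓ, prod_sub_natCast, mul_inv_eq_iff_eq_mul₀ (poch_ne_zero _ _ ht), mul_comm]

lemma neretin_pairing_self {z z' : ℂ} {a b : ℝ} (ha : -1 < a) (hb : -1 < b) {N n : ℕ}
    (hP : ∀ k ≤ n, poch (1 - z - N) k ≠ 0) (hQ : ∀ k ≤ n, poch (1 - z' - N) k ≠ 0)
    (h : n + n < (decay z z' b N).re) :
    HasSum (fun x => (neretin z z' a b N n).eval (hat a b x : ℂ) *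
      (dualPoly a b (z' + N) n).eval (hat a b x : ℂ) * weightC z z' a b N x)
      (neretinFactor z z' a b N n * pairConst a b (z + N) (z' + N) n *
        (Complex.Gamma (decay z z' b N - 2 * n) * poch (z + b + N - n) n *
          ((-1) ^ n * n.factorial))) := by
  set t := decay z z' b N - n with ht
  let R : ℂ[X] := (ascPochhammer ℂ n).comp (C (1 - z' - N) + X)
  have hR : R.natDegree ≤ n := natDegree_ascPochhammer_comp_le n (by compute_degree)
  have htre : ∀ k ≤ n, 0 < (t - k).re := fun k hk => by
    have : (k : ℝ) ≤ n := Nat.cast_le.2 hk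
    simp [ht]
    linarith
  have hterm : ∀ k ∈ Finset.range (n + 1), poch (-(n : ℂ)) k / (k.factorial : ℂ) *
      (poch (1 - z' - N + k) n *
        ((-1) ^ k * poch (n - decay z z' b N) k * Complex.Gamma (decay z z' b N - k - n))) =
      Complex.Gamma (t + 1) *
        (poch (-(n : ℂ)) k / (k.factorial : ℂ) * (R.eval (k : ℂ) * (t - k)⁻¹)) := by
    intro k hk
    have hpos := htre k (Nat.lt_succ_iff.1 (Finset.mem_range.1 hk))
    have h0 : t - k ≠ 0 := Complex.ne_zero_of_re_pos hpos
    have htk : ∀ m : ℕ, t - k + 1 ≠ -m :=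
      ne_neg_natCast_of_re_pos (by rw [Complex.add_re, Complex.one_re]; linarith)
    rw [sub_right_comm (decay z z' b N), ← neg_sub (decay z z' b N), ← ht,
      ← neg_one_pow_mul_poch_neg_mul_Gamma htk, Complex.Gamma_add_one _ h0]
    simp only [R, eval_comp, eval_add, eval_C, eval_X, poch]
    field_simp
  have hsum := neretin_pairing ha hb n hP hQ h
  rw [Finset.sum_congr rfl hterm, ← Finset.mul_sum, sum_poch_neg_mul_eval_div hR fun i hi =>
    Complex.ne_zero_of_re_pos (htre i hi)] at hsum
  have hRt : R.eval t = poch (z + b + N - n) n := by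
    simp only [R, eval_comp, eval_add, eval_C, eval_X, poch, ht, decay, sig]
    ring_nf
  have hvalue : Complex.Gamma (t + 1) * (R.eval t * ((-1) ^ n * n.factorial *
      (∏ i ∈ Finset.range (n + 1), (t - i))⁻¹)) =
      Complex.Gamma (decay z z' b N - 2 * n) * poch (z + b + N - n) n *
        ((-1) ^ n * n.factorial) := by
    rw [hRt, show decay z z' b N - 2 * n = t - n by rw [ht]; ring,
      ← Gamma_add_one_mul_inv_prod (ne_neg_natCast_of_re_pos (htre n le_rfl))]
    ring
  rwa [hvalue] at hsum

lemma poch_reflect_mul (c : ℂ) (k m : ℕ) :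
    poch (1 - c - (k + m : ℕ)) k * poch c m = (-1) ^ k * poch c (k + m) := by
  rw [add_comm k m, poch_add, mul_comm (poch c m), ← mul_assoc, ← poch_reflect]
  push_cast
  ring_nf

lemma neretinTilde_term {z z' : ℂ} {b : ℝ} (a : ℝ) {N k j : ℕ} (hk : k ≤ N) (hj : j + 2 ≤ N)
    (hsig : -1 < (sig z z' b).re) :
    poch (-(N : ℂ) - a) k * poch z k * poch z' k / poch (sig z z' b + 1) k *
      ((-1) ^ (N - k) * (poch (1 + a) (N - k) * poch (1 - z - N) (N - k) *
        poch (1 - z' - N) (N - k)) * poch (1 - z' - N + (N - k : ℕ)) j *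
          Complex.Gamma (decay z z' b N - (N - k : ℕ) - j)) =
    (-1) ^ (N + j) * poch (1 + a) N * poch z N * poch z' N * Complex.Gamma (sig z z' b + 1) *
      (poch (z' + k - j) j * poch (sig z z' b + 1 + k) (N - 2 - j)) := by
  obtain ⟨m, rfl⟩ := Nat.exists_eq_add_of_le hk
  rw [Nat.add_sub_cancel_left]
  have hpole : ∀ l : ℕ, sig z z' b + 1 ≠ -l :=
    ne_neg_natCast_of_re_pos (by rw [Complex.add_re, Complex.one_re]; linarith)
  have hpole' : ∀ l : ℕ, sig z z' b + 1 + k ≠ -l :=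
    ne_neg_natCast_of_re_pos (by
      rw [Complex.add_re, Complex.add_re, Complex.one_re, Complex.natCast_re]
      linarith [k.cast_nonneg (α := ℝ)])
  have hΓ : Complex.Gamma (decay z z' b (k + m) - m - j) =
      poch (sig z z' b + 1 + k) (k + m - 2 - j) *
        (poch (sig z z' b + 1) k * Complex.Gamma (sig z z' b + 1)) := by
    rw [← Gamma_add_nat hpole, ← Gamma_add_nat hpole', Nat.sub_sub, Nat.cast_sub (by omega), decay]
    push_cast
    ring_nf
  have ha := poch_reflect_mul (1 + a) k m
  have hz := poch_reflect_mul z m k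
  have hz' := poch_reflect_mul z' m k
  have hj' := poch_reflect j (z' + k - j)
  rw [show 1 - (1 + a) - (k + m : ℕ) = -((k + m : ℕ) : ℂ) - a by ring] at ha
  rw [add_comm m k] at hz hz'
  rw [show 1 - (z' + k - j) - j = 1 - z' - (k + m : ℕ) + m by push_cast; ring] at hj'
  have hne := poch_ne_zero _ k hpole
  have hsign : (-1 : ℂ) ^ m * (-1) ^ m = 1 := pow_mul_pow_eq_one m (by norm_num)
  rw [hΓ, hj', pow_add, pow_add]
  calc _ = (-1) ^ m * (-1) ^ j * Complex.Gamma (sig z z' b + 1) *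
        (poch (z' + k - j) j * poch (sig z z' b + 1 + k) (k + m - 2 - j)) *
        (poch (-((k + m : ℕ) : ℂ) - a) k * poch (1 + a) m) *
        (poch (1 - z - (k + m : ℕ)) m * poch z k) *
        (poch (1 - z' - (k + m : ℕ)) m * poch z' k) := by field_simp
    _ = _ := by
      rw [ha, hz, hz']
      linear_combination ((-1) ^ k * (-1) ^ m * (-1) ^ j * Complex.Gamma (sig z z' b + 1) *
        (poch (z' + k - j) j * poch (sig z z' b + 1 + k) (k + m - 2 - j)) * poch (1 + a) (k + m) *
        poch z (k + m) * poch z' (k + m)) * hsign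

lemma neretinTilde_pairing_eq_zero {z z' : ℂ} {a b : ℝ} (ha : -1 < a) (hb : -1 < b) {N j : ℕ}
    (hj : j + 2 ≤ N) (hsig : -1 < (sig z z' b).re) :
    HasSum (fun x => (neretinTilde z z' a b N).eval (hat a b x : ℂ) *
      (dualPoly a b (z' + N) j).eval (hat a b x : ℂ) * weightC z z' a b N x) 0 := by
  have hdecay := decay_re z z' b N
  have hjN : (j + 2 : ℝ) ≤ N := by exact_mod_cast hj
  let R : ℂ[X] := (ascPochhammer ℂ j).comp (C (z' - j) + X) *
    (ascPochhammer ℂ (N - 2 - j)).comp (C (sig z z' b + 1) + X)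
  have hR : R.degree < N := degree_ascPochhammer_comp_mul_lt (by omega) (by compute_degree)
    (by compute_degree)
  have hReval (k : ℕ) : R.eval (k : ℂ) =
      poch (z' + k - j) j * poch (sig z z' b + 1 + k) (N - 2 - j) := by
    simp only [R, eval_mul, eval_comp, eval_add, eval_C, eval_X, poch, sub_add_eq_add_sub]
  have hterm := hasSum_sum (s := Finset.range (N + 1)) fun k _ =>
    (latticePoly_pairing_weightC (z := z) (z' := z') ha hb N (N - k) j (by
      have : ((N - k : ℕ) : ℝ) ≤ N := Nat.cast_le.2 (Nat.sub_le N k)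
      linarith)).mul_left
      (poch (-(N : ℂ)) k * poch (-(N : ℂ) - a) k * poch z k * poch z' k /
        (poch (sig z z' b + 1) k * (k.factorial : ℂ)) * (-1) ^ N)
  rw [Finset.sum_congr rfl fun k hk => show _ = (-1) ^ N * pairConst a b (z + N) (z' + N) j *
    ((-1) ^ (N + j) * poch (1 + a) N * poch z N * poch z' N * Complex.Gamma (sig z z' b + 1)) *
    (poch (-(N : ℂ)) k / (k.factorial : ℂ) * R.eval (k : ℂ)) from ?_, ← Finset.mul_sum,
    sum_poch_neg_mul_eval_eq_zero hR, mul_zero] at hterm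
  · refine hterm.congr_fun fun x => ?_
    rw [neretinTilde, eval_finsetSum, mul_assoc, Finset.sum_mul]
    refine Finset.sum_congr rfl fun k _ => ?_
    rw [eval_mul, eval_C]
    ring
  · have h := neretinTilde_term a (Nat.lt_succ_iff.1 (Finset.mem_range.1 hk)) hj hsig
    rw [hReval]
    simp only [div_eq_mul_inv, mul_inv] at h ⊢
    linear_combination ((-1) ^ N * pairConst a b (z + N) (z' + N) j * poch (-(N : ℂ)) k *
      (k.factorial : ℂ)⁻¹) * h

lemma neretin_monic {z z' : ℂ} {a b : ℝ} (ha : -1 < a) {N n : ℕ}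
    (hP : poch (1 - z - N) n ≠ 0) (hQ : poch (1 - z' - N) n ≠ 0)
    (hpole : ∀ m : ℕ, decay z z' b N - 2 * n + 1 ≠ -m) :
    (neretin z z' a b N n).Monic ∧ (neretin z z' a b N n).natDegree = n := by
  have hD : poch (n - decay z z' b N) n ≠ 0 := by
    have hreflect := poch_reflect n (decay z z' b N - 2 * n + 1)
    rw [show 1 - (decay z z' b N - 2 * n + 1) - n = n - decay z z' b N by ring] at hreflect
    exact hreflect ▸ mul_ne_zero (by simp) (poch_ne_zero _ _ hpole)
  rw [neretin_eq, Finset.mul_sum]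
  simp_rw [latticePoly_eq, ← mul_assoc, ← C_mul]
  refine monic_sum_newtonSequence _ _ n ?_
  have hlast := poch_neg_div_factorial (le_refl n)
  have ha' := poch_one_add_ne_zero ha n
  have hsign : (-1 : ℂ) ^ n * (-1) ^ n = 1 := pow_mul_pow_eq_one n (by norm_num)
  have hfac : (n.factorial : ℂ) ≠ 0 := Nat.cast_ne_zero.2 n.factorial_ne_zero
  rw [Nat.choose_self, Nat.cast_one, mul_one, div_eq_iff hfac] at hlast
  rw [neretinFactor, hlast]
  field_simp
  rw [pow_two, hsign]

lemma neretinTilde_monic (z z' : ℂ) (a b : ℝ) (N : ℕ) :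
    (neretinTilde z z' a b N).Monic ∧ (neretinTilde z z' a b N).natDegree = N := by
  rw [neretinTilde, ← Finset.sum_flip, Finset.sum_congr rfl fun k hk => by
    rw [Nat.sub_sub_self (Nat.lt_succ_iff.1 (Finset.mem_range.1 hk)), latticePoly_eq, ← mul_assoc,
      ← C_mul]]
  refine monic_sum_newtonSequence _ _ N ?_
  have hsign : (-1 : ℂ) ^ N * (-1) ^ N = 1 := pow_mul_pow_eq_one N (by norm_num)
  simp [poch, hsign]

lemma normTop_eq {z z' : ℂ} {a b : ℝ} (ha : -1 < a) (n : ℕ) (hsig : -1 < (sig z z' b).re) :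
    neretinFactor z z' a b (n + 1) n * pairConst a b (z + (n + 1 : ℕ)) (z' + (n + 1 : ℕ)) n *
      (Complex.Gamma (sig z z' b + 1) * poch (1 + z + b) n * ((-1) ^ n * n.factorial)) =
    normTop z z' a b (n + 1) := by
  have hpole : ∀ l : ℕ, sig z z' b + 2 ≠ -l :=
    ne_neg_natCast_of_re_pos (by rw [Complex.add_re, Complex.re_ofNat]; linarith)
  have hΓa := Gamma_add_nat (c := 1 + a) (ne_neg_natCast_of_re_pos (by simp; linarith)) n
  have hΓz := inv_Gamma_sub_nat (z + (n + 1 : ℕ)) n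
  have hΓz' := inv_Gamma_sub_nat (z' + (n + 1 : ℕ)) n
  have hΓzb := inv_Gamma_eq_poch_mul (1 + z + b) n
  have hD : (poch (n - decay z z' b (n + 1)) n)⁻¹ = (-1) ^ n *
      (Complex.Gamma (sig z z' b + 2) * (Complex.Gamma (sig z z' b + 2 + n))⁻¹) := by
    rw [show n - decay z z' b (n + 1) = 1 - (sig z z' b + 2) - n by rw [decay]; push_cast; ring,
      poch_reflect, poch_eq_Gamma_div _ n hpole, mul_inv, inv_div, ← inv_pow, inv_neg_one,
      div_eq_mul_inv]
  rw [show z + (n + 1 : ℕ) - n = 1 + z by push_cast; ring, ← sub_sub] at hΓz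
  rw [show z' + (n + 1 : ℕ) - n = 1 + z' by push_cast; ring, ← sub_sub] at hΓz'
  rw [neretinFactor, pairConst, normTop, div_eq_mul_inv _ (poch _ n), hD,
    ← Complex.Gamma_nat_eq_factorial, add_comm (a : ℂ) 1,
    show ((n + 1 : ℕ) : ℂ) + a = 1 + a + n by push_cast; ring,
    show z + (n + 1 : ℕ) + b = 1 + z + b + n by push_cast; ring,
    show z' + (n + 1 : ℕ) + b - n = 1 + z' + b by push_cast; ring,
    show z + (n + 1 : ℕ) + (z' + (n + 1 : ℕ)) + a + b - n = (n + 1 : ℕ) + sig z z' b + a + 1 by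
      rw [sig]; push_cast; ring,
    show ((n + 1 : ℕ) : ℂ) + sig z z' b + 1 = sig z z' b + 2 + n by push_cast; ring]
  simp only [div_eq_mul_inv, mul_inv, hΓz, hΓz', hΓa, hΓzb]
  push_cast
  ring

/-- The squared norm is a pairing with the monic `dualPoly`, as the difference has lower degree. -/
lemma neretin_norm {z z' : ℂ} {a b : ℝ} (ha : -1 < a) (hb : -1 < b) {N : ℕ} (hN : 1 ≤ N)
    (hP : ∀ k < N, poch (1 - z - N) k ≠ 0) (hQ : ∀ k < N, poch (1 - z' - N) k ≠ 0)
    (hsig : -1 < (sig z z' b).re) :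
    HasSum (fun x => (neretin z z' a b N (N - 1)).eval (hat a b x : ℂ) ^ 2 *
      weightC z z' a b N x) (normTop z z' a b N) := by
  obtain ⟨n, rfl⟩ := Nat.exists_eq_add_of_le' hN
  rw [Nat.add_sub_cancel]
  have hdecay : decay z z' b (n + 1) = sig z z' b + 2 * n + 1 := by rw [decay]; push_cast; ring
  have hre : (decay z z' b (n + 1)).re = (sig z z' b).re + 2 * n + 1 := by simp [hdecay]
  have hpole : ∀ m : ℕ, decay z z' b (n + 1) - 2 * n + 1 ≠ -m :=
    ne_neg_natCast_of_re_pos (by simp [hdecay]; linarith)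
  have hP' : ∀ k ≤ n, poch (1 - z - (n + 1 : ℕ)) k ≠ 0 := fun k hk => hP k (by omega)
  have hQ' : ∀ k ≤ n, poch (1 - z' - (n + 1 : ℕ)) k ≠ 0 := fun k hk => hQ k (by omega)
  obtain ⟨hmonic, hdeg⟩ := neretin_monic ha (hP' n le_rfl) (hQ' n le_rfl) hpole
  set p := neretin z z' a b (n + 1) n
  set q := dualPoly a b (z' + (n + 1 : ℕ)) n
  have hlow : (p - q).degree < n := by
    have hdeg' : p.degree = n := (degree_eq_iff_natDegree_eq hmonic.ne_zero).2 hdeg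
    exact hdeg' ▸ degree_sub_lt_left (hdeg'.trans (Sequence.degree_eq _ n).symm) hmonic.ne_zero
      (hmonic.leadingCoeff.trans (newtonSequence_monic _ n).leadingCoeff.symm)
  have hzero : HasSum (fun x => p.eval (hat a b x : ℂ) * weightC z z' a b (n + 1) x *
      (p - q).eval (hat a b x : ℂ)) 0 := by
    refine hasSum_mul_eval_eq_zero (dualPoly a b (z' + (n + 1 : ℕ)))
      (isUnit_leadingCoeff_newtonSequence _) (fun j hj => ?_) hlow
    have hjn : (j + 1 : ℝ) ≤ n := by exact_mod_cast hj
    exact (neretin_pairing_eq_zero ha hb hj hP' hQ' hpole (by linarith)).congr_fun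
      fun x => mul_right_comm _ _ _
  have hself := neretin_pairing_self (N := n + 1) ha hb hP' hQ' (by linarith)
  rw [show decay z z' b (n + 1) - 2 * n = sig z z' b + 1 by rw [hdecay]; ring,
    show z + b + (n + 1 : ℕ) - n = 1 + z + b by push_cast; ring, normTop_eq ha n hsig] at hself
  have hsum := hzero.add hself
  rw [zero_add] at hsum
  refine hsum.congr_fun fun x => ?_
  rw [eval_sub]
  ring

/-! ### Projection kernels -/

section GramKernel

open Matrix

variable {R : Type*} [CommRing R]

lemma det_succ_eq_sub_sum_cramer {m : ℕ} (M : Matrix (Fin (m + 1)) (Fin (m + 1)) R) :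
    M.det = M 0 0 * (M.submatrix Fin.succ Fin.succ).det -
      ∑ l, M 0 l.succ * (M.submatrix Fin.succ Fin.succ).cramer (fun i => M i.succ 0) l := by
  rw [det_succ_row_zero, Fin.sum_univ_succ, sub_eq_add_neg, ← Finset.sum_neg_distrib]
  congr 1
  · simp
  refine Finset.sum_congr rfl fun l _ => ?_
  have hcol : (M.submatrix Fin.succ l.succ.succAbove).submatrix id l.cycleRange =
      (M.submatrix Fin.succ Fin.succ).updateCol l fun i => M i.succ 0 := by
    ext i j
    change M i.succ (l.succ.succAbove (l.cycleRange j)) = _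
    rw [Fin.succAbove_cycleRange, updateCol_apply]
    split_ifs with h
    · simp [h]
    · rw [Equiv.swap_apply_of_ne_of_ne (Fin.succ_ne_zero j) ((Fin.succ_injective _).ne h)]
      rfl
  rw [cramer_apply, ← hcol, det_permute', Fin.sign_cycleRange, Fin.val_succ, pow_succ]
  push_cast
  ring

variable {E n : Type*} [Fintype n] [DecidableEq n]

/-- The kernel `ψ(x)ᵀ M⁻¹ ψ(y)`. When `M = ∑ₓ ψ(x) ψ(x)ᵀ` is invertible this is the kernel of the
projection onto the span of the coordinates of `ψ`. -/
noncomputable def gramKernel (ψ : E → n → R) (M : Matrix n n R) (x y : E) : R :=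
  ψ x ⬝ᵥ M⁻¹ *ᵥ ψ y

lemma of_gramKernel {m : Type*} (ψ : E → n → R) (M : Matrix n n R) (x : m → E) :
    of (fun i j => gramKernel ψ M (x i) (x j)) =
      of (fun i => ψ (x i)) * (M⁻¹ * (of fun i => ψ (x i))ᵀ) := by
  ext i j
  rfl

lemma det_of_gramKernel (ψ : E → n → R) (M : Matrix n n R) (x : n → E) :
    (of fun i j => gramKernel ψ M (x i) (x j)).det =
      M⁻¹.det * (of fun i => ψ (x i)).det ^ 2 := by
  rw [of_gramKernel, det_mul, det_mul, det_transpose]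
  ring

lemma det_of_gramKernel_eq_zero {F m : Type*} [Field F] [Fintype m] [DecidableEq m]
    (h : Fintype.card n < Fintype.card m) (ψ : E → n → F) (M : Matrix n n F) (x : m → E) :
    (of fun i j => gramKernel ψ M (x i) (x j)).det = 0 := by
  by_contra hdet
  refine h.not_ge ?_
  rw [← rank_of_isUnit _ ((isUnit_iff_isUnit_det _).2 (isUnit_iff_ne_zero.2 hdet)), of_gramKernel]
  exact (rank_mul_le_left _ _).trans (rank_le_card_width _)

variable [TopologicalSpace R] [IsTopologicalRing R]

/-- Expanding along the new row and column, the trace contributes `r` and reproduction removes one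
copy of the smaller determinant for each of the `m` old points. -/
lemma hasSum_det_cons {K : E → E → R} {r : R}
    (hK : ∀ x y, HasSum (fun t => K x t * K t y) (K x y)) (hr : HasSum (fun t => K t t) r) {m : ℕ}
    (x : Fin m → E) :
    HasSum (fun t => (of fun i j => K ((Fin.cons t x : Fin (m + 1) → E) i)
      ((Fin.cons t x : Fin (m + 1) → E) j)).det)
      ((r - m) * (of fun i j => K (x i) (x j)).det) := by
  set A := of fun i j => K (x i) (x j)
  have hcramer (l : Fin m) : HasSum (fun t => K t (x l) * A.cramer (fun i => K (x i) t) l)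
      (∑ i, A.adjugate l i * A i l) := by
    refine (hasSum_sum fun i _ => (hK (x i) (x l)).mul_left (A.adjugate l i)).congr_fun fun t => ?_
    rw [cramer_eq_adjugate_mulVec, mulVec, dotProduct, Finset.mul_sum]
    exact Finset.sum_congr rfl fun i _ => by ring
  have htrace : ∑ l, ∑ i, A.adjugate l i * A i l = m * A.det := by
    simp_rw [← mul_apply, adjugate_mul]
    simp
  have hsum := (hr.mul_right A.det).sub (hasSum_sum fun l (_ : l ∈ Finset.univ) => hcramer l)
  rw [htrace, ← sub_mul] at hsum
  refine hsum.congr_fun fun t => ?_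
  rw [det_succ_eq_sub_sum_cramer]
  rfl

variable {ψ : E → n → R} {M : Matrix n n R}

lemma hasSum_dotProduct_mulVec {ι m : Type*} [Fintype m] {φ : ι → m → R} {A : Matrix m m R}
    (hφ : HasSum (fun t => vecMulVec (φ t) (φ t)) A) (v w : m → R) :
    HasSum (fun t => (v ⬝ᵥ φ t) * (φ t ⬝ᵥ w)) (v ⬝ᵥ A *ᵥ w) := by
  let pairing : Matrix m m R →+ R :=
    { toFun B := v ⬝ᵥ B *ᵥ w
      map_zero' := by simp
      map_add' B C := by rw [add_mulVec, dotProduct_add] }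
  have hcont : Continuous pairing := by
    change Continuous fun B => v ⬝ᵥ B *ᵥ w
    fun_prop
  refine (hφ.map pairing hcont).congr_fun fun t => ?_
  change _ = v ⬝ᵥ vecMulVec (φ t) (φ t) *ᵥ w
  rw [vecMulVec_mulVec, op_smul_eq_smul, dotProduct_smul, smul_eq_mul, mul_comm]

lemma gramKernel_hasSum_mul (hψ : HasSum (fun t => vecMulVec (ψ t) (ψ t)) M) (hM : IsUnit M.det)
    (x y : E) :
    HasSum (fun t => gramKernel ψ M x t * gramKernel ψ M t y) (gramKernel ψ M x y) := by
  have hsum := hasSum_dotProduct_mulVec hψ (ψ x ᵥ* M⁻¹) (M⁻¹ *ᵥ ψ y)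
  rw [mulVec_mulVec, mul_nonsing_inv M hM, one_mulVec, ← dotProduct_mulVec] at hsum
  exact hsum.congr_fun fun t => by rw [gramKernel, gramKernel, dotProduct_mulVec]

lemma gramKernel_hasSum_trace (hψ : HasSum (fun t => vecMulVec (ψ t) (ψ t)) M)
    (hM : IsUnit M.det) : HasSum (fun t => gramKernel ψ M t t) (Fintype.card n : R) := by
  have hsum := (hψ.mul_left M⁻¹).map (traceAddMonoidHom n R) continuous_id.matrix_trace
  rw [nonsing_inv_mul _ hM, traceAddMonoidHom_apply, trace_one] at hsum
  refine hsum.congr_fun fun t => ?_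
  rw [Function.comp_apply, traceAddMonoidHom_apply, mul_vecMulVec, trace_vecMulVec, gramKernel,
    dotProduct_comm]

lemma isUnit_det_of_hasSum_vecMulVec {ψ : E → n → ℝ} {M : Matrix n n ℝ}
    (hψ : HasSum (fun t => vecMulVec (ψ t) (ψ t)) M) {x : n → E}
    (hx : (of fun i => ψ (x i)).det ≠ 0) : IsUnit M.det := by
  rw [isUnit_iff_ne_zero]
  intro hdet
  obtain ⟨v, hv, hMv⟩ := exists_mulVec_eq_zero_iff.2 hdet
  have hsq := hasSum_dotProduct_mulVec hψ v v
  rw [hMv, dotProduct_zero] at hsq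
  simp_rw [dotProduct_comm v, ← sq] at hsq
  have horth := (hasSum_zero_iff_of_nonneg fun t => sq_nonneg (ψ t ⬝ᵥ v)).1 hsq
  refine hx (exists_mulVec_eq_zero_iff.1 ⟨v, hv, ?_⟩)
  ext i
  exact pow_eq_zero_iff two_ne_zero |>.1 (congrFun horth (x i))

end GramKernel

section Correlation

variable {E : Type*} [Countable E] {μ : Measure (Finset E)} [IsFiniteMeasure μ] {N : ℕ}

lemma hasSum_measureReal_mem_inter (hcard : ∀ᵐ X ∂μ, X.card = N) (A : Set (Finset E)) :
    HasSum (fun y => μ.real ({X | y ∈ X} ∩ A)) (N * μ.real A) := by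
  classical
  have hcount (X : Finset E) : ∑' y, {X : Finset E | y ∈ X}.indicator 1 X = (X.card : ENNReal) := by
    simp_rw [Set.indicator_apply, Set.mem_ofPred_eq]
    rw [tsum_eq_sum (s := X) (by simp +contextual)]
    simp
  have hsum : ∑' y, μ ({X | y ∈ X} ∩ A) = N * μ A := by
    calc ∑' y, μ ({X | y ∈ X} ∩ A)
        = ∑' y, ∫⁻ X in A, {X : Finset E | y ∈ X}.indicator 1 X ∂μ := by
          refine tsum_congr fun y => ?_
          rw [lintegral_indicator_one (measurableSet_mem_finset y),
            Measure.restrict_apply (measurableSet_mem_finset y)]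
      _ = ∫⁻ X in A, X.card ∂μ := by
          rw [← lintegral_tsum fun y =>
            (measurable_one.indicator (measurableSet_mem_finset y)).aemeasurable]
          simp_rw [hcount]
      _ = N * μ A := by
          rw [lintegral_congr_ae ((ae_restrict_of_ae hcard).mono fun X hX => by rw [hX]),
            setLIntegral_const]
  have hreal := ENNReal.hasSum_toReal (hsum.trans_ne (by finiteness))
  rwa [← ENNReal.tsum_toReal_eq fun y => measure_ne_top _ _, hsum, ENNReal.toReal_mul,
    ENNReal.toReal_natCast] at hreal

lemma measureReal_forall_mem_eq_det_of_succ (hcard : ∀ᵐ X ∂μ, X.card = N) {K : E → E → ℝ}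
    (hK : ∀ x y, HasSum (fun t => K x t * K t y) (K x y)) (htrace : HasSum (fun t => K t t) N)
    {κ : ℝ} {m : ℕ} (hm : m < N)
    (hsucc : ∀ x : Fin (m + 1) → E, x.Injective →
      μ.real {X | ∀ i, x i ∈ X} = κ * (Matrix.of fun i j => K (x i) (x j)).det)
    {x : Fin m → E} (hx : x.Injective) :
    μ.real {X | ∀ i, x i ∈ X} = κ * (Matrix.of fun i j => K (x i) (x j)).det := by
  classical
  set ρ := μ.real {X | ∀ i, x i ∈ X}
  set D := fun y => (Matrix.of fun i j => K ((Fin.cons y x : Fin (m + 1) → E) i)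
    ((Fin.cons y x : Fin (m + 1) → E) j)).det
  have hdiff := (hasSum_measureReal_mem_inter hcard {X | ∀ i, x i ∈ X}).sub
    ((hasSum_det_cons hK htrace x).mul_left κ)
  have hold (i : Fin m) :
      μ.real ({X | x i ∈ X} ∩ {X | ∀ i, x i ∈ X}) - κ * D (x i) = ρ := by
    have hrow : D (x i) = 0 := Matrix.det_zero_of_row_eq (Fin.succ_ne_zero i).symm (by ext j; simp)
    rw [hrow, mul_zero, sub_zero, Set.inter_eq_right.2 (by intro X hX; exact hX i)]
  have hnew (y : E) (hy : y ∉ Finset.univ.image x) :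
      μ.real ({X | y ∈ X} ∩ {X | ∀ i, x i ∈ X}) - κ * D y = 0 := by
    have hcons : ({X | y ∈ X} ∩ {X | ∀ i, x i ∈ X} : Set (Finset E)) =
        {X | ∀ i, (Fin.cons y x : Fin (m + 1) → E) i ∈ X} := by
      ext X
      simp [Fin.forall_fin_succ]
    rw [hcons, hsucc _ (Fin.cons_injective_iff.2 ⟨by simpa using hy, hx⟩), sub_self]
  have hcount := hdiff.unique (hasSum_sum_of_ne_finset_zero hnew)
  rw [Finset.sum_image hx.injOn, Finset.sum_congr rfl fun i _ => hold i, Finset.sum_const,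
    Finset.card_univ, Fintype.card_fin, nsmul_eq_mul] at hcount
  have hNm : (N - m : ℝ) ≠ 0 := sub_ne_zero.2 (by exact_mod_cast hm.ne')
  refine mul_left_cancel₀ hNm ?_
  linear_combination hcount

end Correlation

theorem measureReal_forall_mem_eq_det {E : Type*} [Countable E] {μ : Measure (Finset E)}
    [IsProbabilityMeasure μ] {N : ℕ} (hcard : ∀ᵐ X ∂μ, X.card = N) {K : E → E → ℝ}
    (hK : ∀ x y, HasSum (fun t => K x t * K t y) (K x y)) (htrace : HasSum (fun t => K t t) N)
    (hrank : ∀ m > N, ∀ x : Fin m → E, (Matrix.of fun i j => K (x i) (x j)).det = 0) {κ : ℝ}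
    (hμ : ∀ x : Fin N → E, x.Injective →
      μ.real {X | ∀ i, x i ∈ X} = κ * (Matrix.of fun i j => K (x i) (x j)).det)
    {m : ℕ} {x : Fin m → E} (hx : x.Injective) :
    μ.real {X | ∀ i, x i ∈ X} = (Matrix.of fun i j => K (x i) (x j)).det := by
  have hle {m : ℕ} (hm : m ≤ N) : ∀ x : Fin m → E, x.Injective →
      μ.real {X | ∀ i, x i ∈ X} = κ * (Matrix.of fun i j => K (x i) (x j)).det := by
    induction hm using Nat.decreasingInduction with
    | self => exact hμ
    | of_succ m hm ih =>
      exact fun x hx => measureReal_forall_mem_eq_det_of_succ hcard hK htrace hm ih hx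
  have hκ : κ = 1 := by
    simpa using (hle N.zero_le _ (Function.injective_of_subsingleton (Fin.elim0 : Fin 0 → E))).symm
  rcases le_or_gt m N with hm | hm
  · rw [hle hm x hx, hκ, one_mul]
  · rw [hrank m hm x, measureReal_eq_zero_iff, measure_eq_zero_iff_ae_notMem]
    filter_upwards [hcard] with X hXN hX
    have hsub := Finset.card_le_card (s := Finset.univ.map ⟨x, hx⟩) (t := X) (by
      simpa [Finset.subset_iff] using hX)
    rw [Finset.card_map, Finset.card_univ, Fintype.card_fin, hXN] at hsub
    omega

theorem measureReal_forall_mem_eq_det_gramKernel {E : Type*} [Countable E] {N : ℕ}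
    {μ : Measure (Finset E)} [IsProbabilityMeasure μ] (hcard : ∀ᵐ X ∂μ, X.card = N)
    {ψ : E → Fin N → ℝ} {M : Matrix (Fin N) (Fin N) ℝ}
    (hψ : HasSum (fun t => Matrix.vecMulVec (ψ t) (ψ t)) M) (hM : IsUnit M.det) {c : ℝ}
    (hμ : ∀ x : Fin N → E, x.Injective →
      μ.real {X | ∀ i, x i ∈ X} = c * (Matrix.of fun i => ψ (x i)).det ^ 2)
    {m : ℕ} {x : Fin m → E} (hx : x.Injective) :
    μ.real {X | ∀ i, x i ∈ X} = (Matrix.of fun i j => gramKernel ψ M (x i) (x j)).det := by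
  have hMinv : M⁻¹.det ≠ 0 := (Matrix.isUnit_nonsing_inv_det_iff.2 hM).ne_zero
  have htrace := gramKernel_hasSum_trace hψ hM
  rw [Fintype.card_fin] at htrace
  refine measureReal_forall_mem_eq_det hcard (gramKernel_hasSum_mul hψ hM) htrace
    (fun m hm x => det_of_gramKernel_eq_zero (by simpa using hm) ψ M x) (κ := c / M⁻¹.det)
    (fun x hx => ?_) hx
  rw [hμ x hx, det_of_gramKernel, ← mul_assoc, div_mul_cancel₀ c hMinv]

/-! ### The Christoffel–Darboux formula -/

section ChristoffelDarboux

variable {F : Type*} [Field F]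

/-- The Christoffel–Darboux quotient `(p(v) q(t) - q(v) p(t)) / (v - t)` as a polynomial in `v`. -/
noncomputable def cdPoly (p q : F[X]) (t : F) : F[X] :=
  C (q.eval t) * (p /ₘ (X - C t)) - C (p.eval t) * (q /ₘ (X - C t))

lemma X_sub_C_mul_cdPoly (p q : F[X]) (t : F) :
    (X - C t) * cdPoly p q t = C (q.eval t) * p - C (p.eval t) * q := by
  have hp := X_sub_C_mul_divByMonic_eq_sub_modByMonic p t
  have hq := X_sub_C_mul_divByMonic_eq_sub_modByMonic q t
  rw [modByMonic_X_sub_C_eq_C_eval] at hp hq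
  rw [cdPoly]
  linear_combination C (q.eval t) * hp - C (p.eval t) * hq

lemma cdPoly_eq (p q : F[X]) (t : F) :
    cdPoly p q t = p /ₘ (X - C t) * q - q /ₘ (X - C t) * p := by
  have hp := X_sub_C_mul_divByMonic_eq_sub_modByMonic p t
  have hq := X_sub_C_mul_divByMonic_eq_sub_modByMonic q t
  rw [modByMonic_X_sub_C_eq_C_eval] at hp hq
  rw [cdPoly]
  linear_combination (p /ₘ (X - C t)) * hq - q /ₘ (X - C t) * hp

lemma cdPoly_eval (p q : ℂ[X]) (t v : ℂ) : (cdPoly p q t).eval v = cdQuotient p q t v := by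
  have heval := congrArg (eval v) (X_sub_C_mul_cdPoly p q t)
  simp only [eval_mul, eval_sub, eval_X, eval_C] at heval
  rw [cdQuotient]
  split_ifs with htv
  · subst htv
    have hder (r : ℂ[X]) : (r /ₘ (X - C t)).eval t = r.derivative.eval t := by
      have := congrArg (eval t) (divByMonic_add_X_sub_C_mul_derivative_divByMonic_eq_derivative r t)
      simpa using this
    simp only [cdPoly, eval_sub, eval_mul, eval_C, hder]
    ring
  · rw [eq_div_iff (sub_ne_zero.2 htv)]
    linear_combination -heval

section Orthogonality

variable [TopologicalSpace F] {ι : Type*}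

/-- Orthogonality of `p` to all polynomials of degree less than `n`, for the weights `w` placed at
the nodes `u`; convergence of the pairings is part of the notion. -/
def OrthogonalBelow (u w : ι → F) (n : ℕ) (p : F[X]) : Prop :=
  ∀ r : F[X], r.degree < n → HasSum (fun x => p.eval (u x) * r.eval (u x) * w x) 0

variable [IsTopologicalRing F] {u w : ι → F} {p q : F[X]} {n : ℕ} {h : F}

lemma hasSum_eval_mul_eval_of_monic (hq : q.Monic) (hqn : q.natDegree = n)
    (hq_orth : OrthogonalBelow u w n q)
    (hnorm : HasSum (fun x => q.eval (u x) ^ 2 * w x) h) {r : F[X]} (hr : r.Monic)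
    (hrn : r.natDegree = n) : HasSum (fun x => q.eval (u x) * r.eval (u x) * w x) h := by
  have hlt : (r - q).degree < n := by
    rw [← hrn, ← degree_eq_natDegree hr.ne_zero]
    exact degree_sub_lt_left (by rw [degree_eq_natDegree hr.ne_zero,
      degree_eq_natDegree hq.ne_zero, hrn, hqn]) hr.ne_zero (hr.trans hq.symm)
  have hsum := hnorm.add (hq_orth _ hlt)
  rw [add_zero] at hsum
  refine hsum.congr_fun fun x => ?_
  rw [eval_sub]
  ring

lemma hasSum_cdPoly_eval_mul (hp : p.Monic) (hpn : p.natDegree = n + 1) (hq : q.Monic)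
    (hqn : q.natDegree = n)
    (hp_orth : OrthogonalBelow u w n p) (hq_orth : OrthogonalBelow u w n q)
    (hnorm : HasSum (fun x => q.eval (u x) ^ 2 * w x) h) (t : F) :
    HasSum (fun x => (cdPoly p q t).eval (u x) * w x) h := by
  have hmonic : (p /ₘ (X - C t)).Monic :=
    (leadingCoeff_divByMonic_X_sub_C p (by
      rw [degree_eq_natDegree hp.ne_zero, hpn]; exact_mod_cast n.succ_ne_zero) t).trans hp
  have hnatDegree : (p /ₘ (X - C t)).natDegree = n := by
    rw [natDegree_divByMonic p (monic_X_sub_C t), natDegree_X_sub_C, hpn, Nat.add_sub_cancel]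
  have hsum := (hasSum_eval_mul_eval_of_monic hq hqn hq_orth hnorm hmonic hnatDegree).sub
    (hp_orth _ (degree_divByMonic_X_sub_C_lt hqn.le t))
  rw [sub_zero] at hsum
  refine hsum.congr_fun fun x => ?_
  rw [cdPoly_eq, eval_sub, eval_mul, eval_mul]
  ring

theorem hasSum_cdPoly_eval_mul_eval (hp : p.Monic) (hpn : p.natDegree = n + 1) (hq : q.Monic)
    (hqn : q.natDegree = n)
    (hp_orth : OrthogonalBelow u w n p) (hq_orth : OrthogonalBelow u w n q)
    (hnorm : HasSum (fun x => q.eval (u x) ^ 2 * w x) h) (t : F) {r : F[X]}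
    (hr : r.natDegree ≤ n) :
    HasSum (fun x => (cdPoly p q t).eval (u x) * r.eval (u x) * w x) (h * r.eval t) := by
  have hlt := degree_divByMonic_X_sub_C_lt hr t
  have hsum := ((hasSum_cdPoly_eval_mul hp hpn hq hqn hp_orth hq_orth hnorm t).mul_right
    (r.eval t)).add (((hp_orth _ hlt).mul_left (q.eval t)).sub
      ((hq_orth _ hlt).mul_left (p.eval t)))
  rw [mul_zero, mul_zero, sub_zero, add_zero] at hsum
  refine hsum.congr_fun fun x => ?_
  have heval := congrArg (eval (u x)) (X_sub_C_mul_cdPoly p q t)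
  simp only [eval_mul, eval_sub, eval_X, eval_C] at heval
  rw [eval_eq_add_sub_mul_eval_divByMonic r t (u x)]
  linear_combination (r /ₘ (X - C t)).eval (u x) * w x * heval

variable [T2Space F]

/-- The Gram kernel of the monomials has the same reproducing property as the Christoffel–Darboux
polynomial, and the moment matrix being invertible this property determines the coefficients. -/
theorem cdPoly_eval_eq_gramKernel (hp : p.Monic) (hpn : p.natDegree = n + 1) (hq : q.Monic)
    (hqn : q.natDegree = n)
    (hp_orth : OrthogonalBelow u w n p) (hq_orth : OrthogonalBelow u w n q)
    (hnorm : HasSum (fun x => q.eval (u x) ^ 2 * w x) h)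
    {M : Matrix (Fin (n + 1)) (Fin (n + 1)) F}
    (hM : ∀ i j : Fin (n + 1), HasSum (fun x => u x ^ ((i : ℕ) + j) * w x) (M i j))
    (hdet : IsUnit M.det) (t v : F) :
    (cdPoly p q t).eval v = h * gramKernel (fun s (i : Fin (n + 1)) => s ^ (i : ℕ)) M t v := by
  have hdeg : (cdPoly p q t).natDegree < n + 1 := by
    refine Nat.lt_succ_of_le ((natDegree_sub_le _ _).trans (max_le ?_ ?_)) <;>
      refine (natDegree_C_mul_le _ _).trans ?_ <;>
      rw [natDegree_divByMonic _ (monic_X_sub_C t), natDegree_X_sub_C] <;> omega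
  set β : Fin (n + 1) → F := fun i => (cdPoly p q t).coeff i
  have heval (s : F) : (cdPoly p q t).eval s = β ⬝ᵥ fun i => s ^ (i : ℕ) := by
    rw [eval_eq_sum_range' hdeg, ← Fin.sum_univ_eq_sum_range
      (fun i => (cdPoly p q t).coeff i * s ^ i), dotProduct]
  have hβ : Matrix.vecMul β M = h • fun i : Fin (n + 1) => t ^ (i : ℕ) := by
    ext j
    have hrepr := hasSum_cdPoly_eval_mul_eval hp hpn hq hqn hp_orth hq_orth hnorm t
      (r := X ^ (j : ℕ)) (by rw [natDegree_X_pow]; omega)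
    rw [eval_X_pow] at hrepr
    refine (HasSum.congr_fun (hasSum_sum fun i (_ : i ∈ Finset.univ) =>
      (hM i j).mul_left (β i)) fun x => ?_).unique
      hrepr
    rw [heval, dotProduct, eval_X_pow, Finset.sum_mul, Finset.sum_mul]
    exact Finset.sum_congr rfl fun i _ => by ring
  rw [heval, gramKernel, Matrix.dotProduct_mulVec, ← smul_eq_mul, ← smul_dotProduct,
    ← Matrix.smul_vecMul, ← hβ, Matrix.vecMul_vecMul, Matrix.mul_nonsing_inv _ hdet,
    Matrix.vecMul_one]

end Orthogonality

end ChristoffelDarboux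

lemma gramKernel_map {R S E n : Type*} [CommRing R] [CommRing S] [Fintype n] [DecidableEq n]
    (f : R →+* S) (ψ : E → n → R) {M : Matrix n n R} (hM : IsUnit M.det) (x y : E) :
    gramKernel (fun t i => f (ψ t i)) (M.map f) x y = f (gramKernel ψ M x y) := by
  have hinv : (M.map f)⁻¹ = M⁻¹.map f := Matrix.inv_eq_right_inv (by
    rw [← Matrix.map_mul, Matrix.mul_nonsing_inv M hM, Matrix.map_one f f.map_zero f.map_one])
  rw [gramKernel, hinv, gramKernel, RingHom.map_dotProduct]
  congr 1
  ext i
  exact (RingHom.map_mulVec f M⁻¹ (ψ y) i).symm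

section Moments

variable {ι : Type*} {u W : ι → ℝ} {N : ℕ}

/-- The monomials of degree less than `N` at the nodes `u`, multiplied by the square root of the
weight `W`, so that `gramKernel` is symmetric in the two points. -/
noncomputable def weightedPowers (u W : ι → ℝ) (N : ℕ) (x : ι) (i : Fin N) : ℝ :=
  √(W x) * u x ^ (i : ℕ)

/-- The Hankel matrix of the moments of the weight `W` placed at the nodes `u`. -/
noncomputable def momentMatrix (u W : ι → ℝ) (N : ℕ) : Matrix (Fin N) (Fin N) ℝ :=
  Matrix.of fun i j => ∑' x, u x ^ ((i : ℕ) + j) * W x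

/-- The kernel on the nodes of the orthogonal projection onto the span of `weightedPowers`. -/
noncomputable def projectionKernel (u W : ι → ℝ) (N : ℕ) (x y : ι) : ℝ :=
  gramKernel (weightedPowers u W N) (momentMatrix u W N) x y

lemma hasSum_momentMatrix (hs : ∀ k < 2 * N - 1, Summable fun x => u x ^ k * W x) (i j : Fin N) :
    HasSum (fun x => u x ^ ((i : ℕ) + j) * W x) (momentMatrix u W N i j) :=
  (hs (i + j) (by omega)).hasSum

lemma hasSum_vecMulVec_weightedPowers (hW : ∀ x, 0 ≤ W x)
    (hs : ∀ k < 2 * N - 1, Summable fun x => u x ^ k * W x) :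
    HasSum (fun x => Matrix.vecMulVec (weightedPowers u W N x) (weightedPowers u W N x))
      (momentMatrix u W N) := by
  refine Pi.hasSum.2 fun i => Pi.hasSum.2 fun j =>
    (hasSum_momentMatrix hs i j).congr_fun fun x => ?_
  rw [Matrix.vecMulVec_apply, weightedPowers, weightedPowers, mul_mul_mul_comm,
    Real.mul_self_sqrt (hW x), pow_add, mul_comm]

lemma det_weightedPowers_sq (hW : ∀ x, 0 ≤ W x) (x : Fin N → ι) :
    (Matrix.of fun i => weightedPowers u W N (x i)).det ^ 2 =
      (Matrix.vandermonde fun i => u (x i)).det ^ 2 * ∏ i, W (x i) := by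
  have hdet : (Matrix.of fun i => weightedPowers u W N (x i)).det =
      (∏ i, √(W (x i))) * (Matrix.vandermonde fun i => u (x i)).det :=
    Matrix.det_mul_column (fun i => √(W (x i))) (Matrix.vandermonde fun i => u (x i))
  rw [hdet, mul_pow, ← Finset.prod_pow, mul_comm]
  simp_rw [Real.sq_sqrt (hW _)]

lemma isUnit_det_momentMatrix (hW : ∀ x, 0 ≤ W x)
    (hs : ∀ k < 2 * N - 1, Summable fun x => u x ^ k * W x) {x : Fin N → ι}
    (hx : Function.Injective fun i => u (x i)) (hpos : ∀ i, 0 < W (x i)) :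
    IsUnit (momentMatrix u W N).det := by
  refine isUnit_det_of_hasSum_vecMulVec (hasSum_vecMulVec_weightedPowers hW hs) (x := x) ?_
  rw [← sq_pos_iff, det_weightedPowers_sq hW]
  exact mul_pos (sq_pos_of_ne_zero (Matrix.det_vandermonde_ne_zero_iff.2 hx))
    (Finset.prod_pos fun i _ => hpos i)

lemma projectionKernel_eq (hW : ∀ x, 0 ≤ W x) (N : ℕ) (x y : ι) :
    projectionKernel u W N x y = √(W x * W y) *
      gramKernel (fun s (i : Fin N) => s ^ (i : ℕ)) (momentMatrix u W N) (u x) (u y) := by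
  have hpowers (x : ι) : weightedPowers u W N x = √(W x) • fun i : Fin N => u x ^ (i : ℕ) := rfl
  rw [projectionKernel, gramKernel, hpowers, hpowers, Matrix.mulVec_smul, smul_dotProduct,
    dotProduct_smul, gramKernel, Real.sqrt_mul (hW x), smul_eq_mul, smul_eq_mul, mul_assoc]

theorem sqrt_mul_cdQuotient_eq (hN : 1 ≤ N) (hW : ∀ x, 0 ≤ W x)
    (hs : ∀ k < 2 * N - 1, Summable fun x => u x ^ k * W x)
    (hdet : IsUnit (momentMatrix u W N).det) {p q : ℂ[X]} {h : ℂ} (hp : p.Monic)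
    (hpN : p.natDegree = N) (hq : q.Monic) (hqN : q.natDegree = N - 1)
    (hp_orth : OrthogonalBelow (fun x => (u x : ℂ)) (fun x => (W x : ℂ)) (N - 1) p)
    (hq_orth : OrthogonalBelow (fun x => (u x : ℂ)) (fun x => (W x : ℂ)) (N - 1) q)
    (hnorm : HasSum (fun x => q.eval (u x : ℂ) ^ 2 * (W x : ℂ)) h) (x y : ι) :
    (√(W x * W y) : ℂ) * cdQuotient p q (u x) (u y) =
      h * projectionKernel u W N x y := by
  obtain ⟨n, rfl⟩ := Nat.exists_eq_add_of_le' hN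
  set M := (momentMatrix u W (n + 1)).map Complex.ofRealHom
  have hM : ∀ i j : Fin (n + 1),
      HasSum (fun x => (u x : ℂ) ^ ((i : ℕ) + j) * (W x : ℂ)) (M i j) := fun i j =>
    (Complex.hasSum_ofReal.2 (hasSum_momentMatrix hs i j)).congr_fun fun x => by push_cast; rfl
  have hMdet : IsUnit M.det := by
    change IsUnit (Complex.ofRealHom.mapMatrix (momentMatrix u W (n + 1))).det
    rw [← RingHom.map_det]
    exact hdet.map Complex.ofRealHom
  have hmap := gramKernel_map Complex.ofRealHom (fun x (i : Fin (n + 1)) => u x ^ (i : ℕ)) hdet x y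
  simp only [map_pow] at hmap
  have hcd := cdPoly_eval_eq_gramKernel hp hpN hq hqN hp_orth hq_orth hnorm hM hMdet (u x) (u y)
  rw [projectionKernel_eq hW, Complex.ofReal_mul, mul_left_comm, ← cdPoly_eval, hcd]
  exact congrArg (fun s => _ * (h * s)) hmap

end Moments

/-! ### Signatures and `N`-point subsets -/

lemma hat_injective {a b : ℝ} (h : -1 < 2 * eps a b) : Function.Injective (hat a b) := by
  intro x y hxy
  rcases sq_eq_sq_iff_eq_or_eq_neg.1 hxy with heq | hneg
  · exact_mod_cast add_right_cancel heq
  · have hsum : ((x + y : ℕ) : ℝ) < (1 : ℕ) := by push_cast; linarith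
    have := Nat.cast_lt.1 hsum
    omega

lemma pt_injective {a b : ℝ} (h : Function.Injective (hat a b)) : Function.Injective (pt a b) :=
  fun _ _ hxy => h (congrArg Subtype.val hxy)

lemma pt_surjective (a b : ℝ) : Function.Surjective (pt a b) := by
  rintro ⟨_, x, rfl⟩
  exact ⟨x, rfl⟩

lemma val_le_of_strictMono {N : ℕ} {e : Fin N → ℕ} (he : StrictMono e) (i : Fin N) :
    (i : ℕ) ≤ e i := by
  cases N with
  | zero => exact i.elim0
  | succ n =>
    induction i using Fin.induction with
    | zero => exact Nat.zero_le _
    | succ i ih => exact ih.trans_lt (he i.castSucc_lt_succ)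

lemma monotone_sub_val_of_strictMono {N : ℕ} {e : Fin N → ℕ} (he : StrictMono e) :
    Monotone fun i => e i - (i : ℕ) := by
  cases N with
  | zero => exact fun i => i.elim0
  | succ n =>
    refine Fin.monotone_iff_le_succ.2 fun i => ?_
    have := he i.castSucc_lt_succ
    rw [Fin.val_castSucc, Fin.val_succ]
    omega

lemma shifted_strictAnti {N : ℕ} (lam : Signature N) : StrictAnti (shifted lam) := by
  intro i j hij
  have hle : lam.1 j ≤ lam.1 i := lam.2 hij.le
  have := Fin.lt_def.1 hij
  have := j.2
  unfold shifted
  omega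

lemma exists_range_shifted_eq {N : ℕ} {x : Fin N → ℕ} (hx : Function.Injective x) :
    ∃ lam : Signature N, Set.range (shifted lam) = Set.range x := by
  have hcard : (Finset.univ.image x).card = N := by
    rw [Finset.card_image_of_injective _ hx, Finset.card_univ, Fintype.card_fin]
  let e := (Finset.univ.image x).orderEmbOfFin hcard
  let lam : Signature N := ⟨fun i => e i.rev - (i.rev : ℕ),
    (monotone_sub_val_of_strictMono e.strictMono).comp_antitone Fin.rev_anti⟩
  have hshifted : shifted lam = e ∘ Fin.rev := by
    ext i
    have hrev : N - 1 - (i : ℕ) = i.rev := by rw [Fin.val_rev]; omega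
    rw [shifted, hrev]
    exact Nat.sub_add_cancel (val_le_of_strictMono e.strictMono i.rev)
  refine ⟨lam, ?_⟩
  rw [hshifted, Fin.rev_surjective.range_comp, Finset.range_orderEmbOfFin, Finset.coe_image,
    Finset.coe_univ, Set.image_univ]

lemma eq_of_range_shifted_eq {N : ℕ} {lam mu : Signature N}
    (h : Set.range (shifted lam) = Set.range (shifted mu)) : lam = mu := by
  have hmono (lam : Signature N) : StrictMono (shifted lam ∘ Fin.rev) := fun i j hij =>
    shifted_strictAnti lam (Fin.rev_lt_rev.2 hij)
  have hcomp : shifted lam ∘ Fin.rev = shifted mu ∘ Fin.rev := by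
    rw [← StrictMono.range_inj (hmono lam) (hmono mu), Fin.rev_surjective.range_comp,
      Fin.rev_surjective.range_comp, h]
  refine Subtype.ext (funext fun i => ?_)
  exact Nat.add_right_cancel (congrFun (Fin.rev_surjective.injective_comp_right hcomp) i)

lemma coe_configO (a b : ℝ) {N : ℕ} (lam : Signature N) :
    (configO a b lam : Set (HalfLattice a b)) = Set.range fun i => pt a b (shifted lam i) :=
  Set.Finite.coe_toFinset _

lemma card_configO {a b : ℝ} (h : Function.Injective (hat a b)) {N : ℕ} (lam : Signature N) :
    (configO a b lam).card = N := by
  rw [← Set.ncard_coe_finset, coe_configO, Set.ncard_range_of_injective, Nat.card_fin]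
  exact (pt_injective h).comp (shifted_strictAnti lam).injective

lemma coe_configO_eq_iff {a b : ℝ} (h : Function.Injective (hat a b)) {N : ℕ} (lam : Signature N)
    (x : Fin N → ℕ) :
    (configO a b lam : Set (HalfLattice a b)) = Set.range (fun i => pt a b (x i)) ↔
      Set.range (shifted lam) = Set.range x := by
  have himage (y : Fin N → ℕ) : Set.range (fun i => pt a b (y i)) = pt a b '' Set.range y :=
    Set.range_comp (pt a b) y
  rw [coe_configO, himage, himage, (pt_injective h).image_injective.eq_iff]

lemma forall_mem_configO_iff {a b : ℝ} (h : Function.Injective (hat a b)) {N : ℕ}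
    (lam : Signature N) {x : Fin N → ℕ} (hx : Function.Injective x) :
    (∀ i, pt a b (x i) ∈ configO a b lam) ↔ Set.range (shifted lam) = Set.range x := by
  rw [← coe_configO_eq_iff h]
  refine ⟨fun hmem => ?_, fun heq i => Finset.mem_coe.1 (heq ▸ Set.mem_range_self i)⟩
  refine (Set.eq_of_subset_of_ncard_le (Set.range_subset_iff.2 hmem) ?_
    (Finset.finite_toSet _)).symm
  rw [Set.ncard_coe_finset, card_configO h, Set.ncard_range_of_injective, Nat.card_fin]
  exact (pt_injective h).comp hx

lemma exists_perm_of_range_eq {ι α : Type*} {f g : ι → α} (hf : f.Injective) (hg : g.Injective)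
    (h : Set.range f = Set.range g) : ∃ σ : Equiv.Perm ι, f = g ∘ σ := by
  refine ⟨(Equiv.ofInjective f hf).trans
    ((Equiv.setCongr h).trans (Equiv.ofInjective g hg).symm), funext fun i => ?_⟩
  exact (Equiv.apply_ofInjective_symm hg (Equiv.setCongr h (Equiv.ofInjective f hf i))).symm

lemma vandermonde_sq {N : ℕ} (v : Fin N → ℝ) :
    vandermonde v ^ 2 = (Matrix.vandermonde v).det ^ 2 := by
  rw [vandermonde, Matrix.det_vandermonde]
  simp_rw [← Finset.prod_pow]
  exact Finset.prod_congr rfl fun i _ => Finset.prod_congr rfl fun j _ => sub_sq_comm _ _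

lemma det_vandermonde_comp_perm_sq {N : ℕ} (v : Fin N → ℝ) (σ : Equiv.Perm (Fin N)) :
    (Matrix.vandermonde (v ∘ σ)).det ^ 2 = (Matrix.vandermonde v).det ^ 2 := by
  have hdet : (Matrix.vandermonde (v ∘ σ)).det =
      Equiv.Perm.sign σ * (Matrix.vandermonde v).det := Matrix.det_permute σ (Matrix.vandermonde v)
  rw [hdet, mul_pow, ← Int.cast_pow, ← Units.val_pow_eq_pow_val, Int.units_sq, Units.val_one,
    Int.cast_one, one_mul]

lemma zWeight_eq (z z' : ℂ) (a b : ℝ) {N : ℕ} {lam : Signature N} {x : Fin N → ℕ}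
    (hx : Function.Injective x) (h : Set.range (shifted lam) = Set.range x) :
    zWeight z z' a b N lam =
      (Matrix.vandermonde fun i => hat a b (x i)).det ^ 2 * ∏ i, weight z z' a b N (x i) := by
  obtain ⟨σ, hσ⟩ := exists_perm_of_range_eq (shifted_strictAnti lam).injective hx h
  rw [zWeight, vandermonde_sq, hσ]
  congr 1
  · exact det_vandermonde_comp_perm_sq (fun i => hat a b (x i)) σ
  · exact Equiv.prod_comp σ fun i => weight z z' a b N (x i)

/-! ### The partition function -/

lemma summable_pi_prod {α : Type*} {g : α → ℝ} (hg : Summable g) (hg0 : ∀ x, 0 ≤ g x) (n : ℕ) :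
    Summable fun x : Fin n → α => ∏ i, g (x i) := by
  induction n with
  | zero => exact Summable.of_finite
  | succ n ih =>
    have hmul := hg.mul_of_nonneg ih hg0 fun x => Finset.prod_nonneg fun i _ => hg0 (x i)
    rw [← (Fin.consEquiv fun _ : Fin (n + 1) => α).summable_iff]
    refine hmul.congr fun x => ?_
    simp [Fin.prod_univ_succ, Fin.consEquiv]

lemma prod_Ioi_mul_eq_prod_pow {R : Type*} [CommMonoid R] {N : ℕ} (f : Fin N → R) :
    ∏ i, ∏ j ∈ Finset.Ioi i, (f i * f j) = ∏ i, f i ^ (N - 1) := by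
  have hswap : ∏ i, ∏ j ∈ Finset.Ioi i, f j = ∏ j, ∏ _i ∈ Finset.Iio j, f j :=
    Finset.prod_comm' (by simp)
  simp_rw [Finset.prod_mul_distrib]
  rw [hswap, ← Finset.prod_mul_distrib]
  refine Finset.prod_congr rfl fun i _ => ?_
  rw [Finset.prod_const, Finset.prod_const, Fin.card_Ioi, Fin.card_Iio, ← pow_add,
    Nat.sub_add_cancel (Nat.le_sub_one_of_lt i.2)]

lemma abs_vandermonde_le {N : ℕ} {v : Fin N → ℝ} (hv : ∀ i, 0 ≤ v i) :
    |vandermonde v| ≤ ∏ i, (1 + v i) ^ (N - 1) := by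
  rw [vandermonde, Finset.abs_prod, ← prod_Ioi_mul_eq_prod_pow]
  refine Finset.prod_le_prod (fun _ _ => abs_nonneg _) fun i _ => ?_
  rw [Finset.abs_prod]
  refine Finset.prod_le_prod (fun _ _ => abs_nonneg _) fun j _ => abs_le.2 ?_
  constructor <;> nlinarith [hv i, hv j, mul_nonneg (hv i) (hv j)]

lemma vandermonde_sq_le {N : ℕ} {v : Fin N → ℝ} (hv : ∀ i, 0 ≤ v i) :
    vandermonde v ^ 2 ≤ ∏ i, (1 + v i) ^ (2 * N - 2) :=
  calc vandermonde v ^ 2 = |vandermonde v| ^ 2 := (sq_abs _).symm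
    _ ≤ (∏ i, (1 + v i) ^ (N - 1)) ^ 2 := by gcongr; exact abs_vandermonde_le hv
    _ = ∏ i, (1 + v i) ^ (2 * N - 2) := by
      rw [← Finset.prod_pow]
      refine Finset.prod_congr rfl fun i _ => ?_
      rw [← pow_mul, mul_comm, Nat.mul_sub, mul_one]

/-! ### The law of the point process -/

section Ensemble

variable {z z' : ℂ} {a b : ℝ} {N : ℕ}

lemma zWeight_nonneg (hW0 : ∀ x, 0 ≤ weight z z' a b N x) (lam : Signature N) :
    0 ≤ zWeight z z' a b N lam :=
  mul_nonneg (sq_nonneg _) (Finset.prod_nonneg fun _ _ => hW0 _)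

lemma summable_zWeight (hW0 : ∀ x, 0 ≤ weight z z' a b N x)
    (hW : Summable fun x => (1 + hat a b x) ^ (2 * N - 2) * weight z z' a b N x) :
    Summable (zWeight z z' a b N) := by
  have hhat (x : ℕ) : 0 ≤ hat a b x := sq_nonneg _
  have hinj : Function.Injective (shifted (N := N)) := fun lam mu h =>
    eq_of_range_shifted_eq (by rw [h])
  have hprod := summable_pi_prod hW
    (fun x => mul_nonneg (pow_nonneg (add_nonneg zero_le_one (hhat x)) _) (hW0 x)) N
  refine Summable.of_nonneg_of_le (zWeight_nonneg hW0) (fun lam => ?_) (hprod.comp_injective hinj)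
  rw [Function.comp_apply, Finset.prod_mul_distrib]
  exact mul_le_mul_of_nonneg_right (vandermonde_sq_le fun i => hhat _)
    (Finset.prod_nonneg fun _ _ => hW0 _)

lemma tsum_zWeight_pos (h : Function.Injective (hat a b)) (hW0 : ∀ x, 0 ≤ weight z z' a b N x)
    (hWpos : ∀ x < N, 0 < weight z z' a b N x) (hs : Summable (zWeight z z' a b N)) :
    0 < ∑' mu, zWeight z z' a b N mu := by
  obtain ⟨lam, hlam⟩ := exists_range_shifted_eq (Fin.val_injective (n := N))
  refine hs.tsum_pos (zWeight_nonneg hW0) lam ?_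
  rw [zWeight_eq z z' a b Fin.val_injective hlam]
  exact mul_pos (sq_pos_of_ne_zero (Matrix.det_vandermonde_ne_zero_iff.2
    (h.comp Fin.val_injective))) (Finset.prod_pos fun i _ => hWpos i i.2)

lemma isProbabilityMeasure_zMeasure (hW0 : ∀ x, 0 ≤ weight z z' a b N x)
    (hs : Summable (zWeight z z' a b N)) (hpos : 0 < ∑' mu, zWeight z z' a b N mu) :
    IsProbabilityMeasure (zMeasure z z' a b N) := by
  constructor
  rw [zMeasure, Measure.sum_apply _ MeasurableSet.univ]
  simp only [Measure.smul_apply, measure_univ, smul_eq_mul, mul_one]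
  rw [← ENNReal.ofReal_tsum_of_nonneg (fun lam => div_nonneg (zWeight_nonneg hW0 lam) hpos.le)
    (hs.div_const _), tsum_div_const, div_self hpos.ne', ENNReal.ofReal_one]

lemma zMeasure_singleton (lam : Signature N) : zMeasure z z' a b N {lam} =
    ENNReal.ofReal (zWeight z z' a b N lam / ∑' mu, zWeight z z' a b N mu) := by
  rw [zMeasure, Measure.sum_apply _ (MeasurableSet.singleton lam), tsum_eq_single lam]
  · simp
  · intro mu hmu
    simp [hmu]

lemma measurable_configO : Measurable (configO a b (N := N)) := measurable_of_countable _

lemma countable_halfLattice (a b : ℝ) : Countable (HalfLattice a b) :=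
  (pt_surjective a b).countable

lemma measurableSet_conf (S : Set (Conf a b)) : MeasurableSet S :=
  have := countable_halfLattice a b
  S.to_countable.measurableSet

lemma processO_real_of_range (hW0 : ∀ x, 0 ≤ weight z z' a b N x) {S : Set (Conf a b)}
    {x : Fin N → ℕ} (hx : Function.Injective x)
    (hS : ∀ lam : Signature N, configO a b lam ∈ S ↔ Set.range (shifted lam) = Set.range x) :
    (processO z z' a b N).real S = (∑' mu, zWeight z z' a b N mu)⁻¹ *
      ((Matrix.vandermonde fun i => hat a b (x i)).det ^ 2 * ∏ i, weight z z' a b N (x i)) := by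
  obtain ⟨lam, hlam⟩ := exists_range_shifted_eq hx
  have hpre : configO a b ⁻¹' S = {lam} := by
    ext mu
    rw [Set.mem_preimage, hS, Set.mem_singleton_iff]
    exact ⟨fun hmu => eq_of_range_shifted_eq (hmu.trans hlam.symm), fun hmu => hmu ▸ hlam⟩
  rw [measureReal_def, processO, Measure.map_apply measurable_configO (measurableSet_conf S),
    hpre, zMeasure_singleton, ENNReal.toReal_ofReal, zWeight_eq z z' a b hx hlam, div_eq_inv_mul]
  exact div_nonneg (zWeight_nonneg hW0 lam) (tsum_nonneg (zWeight_nonneg hW0))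

lemma card_ae_processO (h : Function.Injective (hat a b)) :
    ∀ᵐ X ∂(processO z z' a b N), X.card = N := by
  rw [processO, ae_map_iff measurable_configO.aemeasurable (measurableSet_conf _)]
  exact .of_forall (card_configO h)

lemma isProbabilityMeasure_processO (hW0 : ∀ x, 0 ≤ weight z z' a b N x)
    (hs : Summable (zWeight z z' a b N)) (hpos : 0 < ∑' mu, zWeight z z' a b N mu) :
    IsProbabilityMeasure (processO z z' a b N) :=
  have := isProbabilityMeasure_zMeasure hW0 hs hpos
  Measure.isProbabilityMeasure_map measurable_configO.aemeasurable

lemma isOrthPolyEnsemble_processO (h : Function.Injective (hat a b))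
    (hW0 : ∀ x, 0 ≤ weight z z' a b N x) (hpos : 0 < ∑' mu, zWeight z z' a b N mu) :
    IsOrthPolyEnsemble a b N (weight z z' a b N) (processO z z' a b N) := by
  refine ⟨card_ae_processO h, _, inv_pos.2 hpos, fun x hx => ?_⟩
  rw [processO_real_of_range hW0 hx fun lam => coe_configO_eq_iff h lam x, sq_abs,
    vandermonde_sq, mul_assoc]

theorem isCorrelationKernel_projectionKernel (h : Function.Injective (hat a b))
    (hW0 : ∀ x, 0 ≤ weight z z' a b N x) (hs : Summable (zWeight z z' a b N))
    (hpos : 0 < ∑' mu, zWeight z z' a b N mu)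
    (hmom : ∀ k < 2 * N - 1, Summable fun x => hat a b x ^ k * weight z z' a b N x)
    (hM : IsUnit (momentMatrix (hat a b) (weight z z' a b N) N).det) :
    IsCorrelationKernel a b
      (fun x y => projectionKernel (hat a b) (weight z z' a b N) N x y) (processO z z' a b N) := by
  have := isProbabilityMeasure_processO hW0 hs hpos
  have := countable_halfLattice a b
  let e := Equiv.ofBijective (pt a b) ⟨pt_injective h, pt_surjective a b⟩
  have hψ := (Equiv.hasSum_iff e.symm).2 (hasSum_vecMulVec_weightedPowers hW0 hmom)
  have hμ (y : Fin N → HalfLattice a b) (hy : y.Injective) :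
      (processO z z' a b N).real {X | ∀ i, y i ∈ X} = (∑' mu, zWeight z z' a b N mu)⁻¹ *
        (Matrix.of fun i => weightedPowers (hat a b) (weight z z' a b N) N
          (e.symm (y i))).det ^ 2 := by
    have hpt (i : Fin N) : pt a b (e.symm (y i)) = y i := e.apply_symm_apply (y i)
    have hy' : Function.Injective fun i => e.symm (y i) := e.symm.injective.comp hy
    rw [det_weightedPowers_sq hW0]
    refine processO_real_of_range hW0 hy' fun lam => ?_
    rw [← forall_mem_configO_iff h lam hy']
    simp only [hpt, Set.mem_ofPred_eq]
  intro m x hx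
  have hsymm (i : Fin m) : e.symm (pt a b (x i)) = x i := e.symm_apply_apply (x i)
  have hdet := measureReal_forall_mem_eq_det_gramKernel (card_ae_processO h) hψ hM hμ
    ((pt_injective h).comp hx)
  simp only [Function.comp_apply, gramKernel, hsymm] at hdet
  rw [hdet]
  exact Complex.ofRealHom.map_det _

end Ensemble

/-! ### Consequences of admissibility -/

lemma sig_comm (z z' : ℂ) (b : ℝ) : sig z' z b = sig z z' b := by
  rw [sig, sig, add_comm z' z]

lemma conj_eq_of_mem_Zprinc {w w' : ℂ} (h : (w, w') ∈ Zprinc) : w' = (starRingEnd ℂ) w :=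
  h.2

lemma im_ne_zero_of_mem_Zprinc {w w' : ℂ} (h : (w, w') ∈ Zprinc) : w.im ≠ 0 := fun hw =>
  h.1 ⟨hw, by rw [conj_eq_of_mem_Zprinc h, Complex.conj_im, hw, neg_zero]⟩

lemma swap_mem_series {w w' : ℂ} (h : (w, w') ∈ Zprinc ∪ Zcompl ∪ Zdegen) :
    (w', w) ∈ Zprinc ∪ Zcompl ∪ Zdegen := by
  rcases h with (⟨him, hconj⟩ | ⟨hw, hw', n, h₁, h₂, h₁', h₂'⟩) | ⟨hw, hw', n, hn, h⟩
  · exact .inl (.inl ⟨fun h => him h.symm, (star_eq_iff_star_eq.1 hconj.symm).symm⟩)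
  · exact .inl (.inr ⟨hw', hw, n, h₁', h₂', h₁, h₂⟩)
  · exact .inr ⟨hw', hw, n, hn, h.symm⟩

lemma ne_neg_natCast_of_mem_series {w w' : ℂ} (h : (w, w') ∈ Zprinc ∪ Zcompl ∪ Zdegen) (l : ℕ) :
    w ≠ -l := by
  rintro rfl
  rcases h with (h | ⟨-, -, n, h₁, h₂, -⟩) | ⟨-, -, n, hn, h⟩
  · exact im_ne_zero_of_mem_Zprinc h (by simp)
  · have hlt : (n : ℝ) < (-l : ℤ) := by simpa using h₁
    have hgt : ((-l : ℤ) : ℝ) < (n + 1 : ℤ) := by simpa using h₂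
    have := Int.cast_lt.1 hlt
    have := Int.cast_lt.1 hgt
    omega
  · have hn' : (1 : ℝ) ≤ n := by exact_mod_cast hn
    have : (0 : ℝ) ≤ l := l.cast_nonneg
    simp only [Complex.neg_re, Complex.natCast_re] at h
    rcases h with ⟨heq, -⟩ | ⟨-, hlt⟩ <;> linarith

lemma Gamma_add_natCast_ne_zero {w : ℂ} (hw : ∀ l : ℕ, w ≠ -l) (m : ℕ) :
    Complex.Gamma (w + m) ≠ 0 :=
  Complex.Gamma_ne_zero fun l hl => hw (l + m) (by push_cast; linear_combination hl)

lemma realGamma_mul_pos_of_neg {k : ℕ} {u v : ℝ} (hu : -k < u) (hu' : u < -k + 1) (hv : -k < v)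
    (hv' : v < -k + 1) : 0 < Real.Gamma u * Real.Gamma v := by
  induction k generalizing u v with
  | zero =>
    rw [Nat.cast_zero, neg_zero] at hu hv
    exact mul_pos (Real.Gamma_pos_of_pos hu) (Real.Gamma_pos_of_pos hv)
  | succ k ih =>
    push_cast at hu hu' hv hv'
    have : (0 : ℝ) ≤ k := k.cast_nonneg
    have hu0 : u < 0 := by linarith
    have hv0 : v < 0 := by linarith
    have hshift := ih (u := u + 1) (v := v + 1) (by linarith) (by linarith) (by linarith)
      (by linarith)
    rw [Real.Gamma_add_one hu0.ne, Real.Gamma_add_one hv0.ne, mul_mul_mul_comm] at hshift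
    exact (mul_pos_iff_of_pos_left (mul_pos_of_neg_of_neg hu0 hv0)).1 hshift

lemma realGamma_mul_pos {n : ℤ} {u v : ℝ} (hu : n < u) (hu' : u < n + 1) (hv : n < v)
    (hv' : v < n + 1) : 0 < Real.Gamma u * Real.Gamma v := by
  obtain ⟨k, rfl | rfl⟩ := n.eq_nat_or_neg
  · rw [Int.cast_natCast] at hu hv
    exact mul_pos (Real.Gamma_pos_of_pos (k.cast_nonneg.trans_lt hu))
      (Real.Gamma_pos_of_pos (k.cast_nonneg.trans_lt hv))
  · rw [Int.cast_neg, Int.cast_natCast] at hu hu' hv hv'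
    exact realGamma_mul_pos_of_neg hu hu' hv hv'

lemma realGamma_intCast_mul_nonneg {n : ℤ} {v : ℝ} (hv : n - 1 < v) :
    0 ≤ Real.Gamma n * Real.Gamma v := by
  rcases le_or_gt n 0 with hn | hn
  · obtain ⟨k, rfl⟩ : ∃ k : ℕ, n = -k := ⟨n.natAbs, by omega⟩
    rw [Int.cast_neg, Int.cast_natCast, Real.Gamma_neg_nat_eq_zero, zero_mul]
  · have hn' : (1 : ℝ) ≤ n := by exact_mod_cast hn
    exact mul_nonneg (Real.Gamma_nonneg_of_nonneg (by linarith))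
      (Real.Gamma_nonneg_of_nonneg (by linarith))

open scoped ComplexOrder

lemma Gamma_mul_Gamma_nonneg_of_mem_series {w w' : ℂ}
    (h : (w, w') ∈ Zprinc ∪ Zcompl ∪ Zdegen) (m : ℤ) :
    0 ≤ Complex.Gamma (w + m) * Complex.Gamma (w' + m) := by
  rcases h with (h | ⟨hw, hw', n, h₁, h₂, h₁', h₂'⟩) | ⟨hw, hw', n, -, h⟩
  · have hconj : w' + m = (starRingEnd ℂ) (w + m) := by
      rw [conj_eq_of_mem_Zprinc h, map_add, map_intCast]
    rw [hconj, Complex.Gamma_conj]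
    exact mul_star_self_nonneg _
  all_goals
    lift w to ℝ using hw
    lift w' to ℝ using hw'
    simp only [Complex.ofReal_re] at *
    rw [← Complex.ofReal_intCast, ← Complex.ofReal_add, ← Complex.ofReal_add,
      Complex.Gamma_ofReal, Complex.Gamma_ofReal, ← Complex.ofReal_mul, Complex.zero_le_real]
  · refine (realGamma_mul_pos (n := n + m) ?_ ?_ ?_ ?_).le <;> push_cast <;> linarith
  · have hnm : ((n : ℝ) + m) = ((n + m : ℤ) : ℝ) := by push_cast; rfl
    rcases h with ⟨rfl, hlt⟩ | ⟨rfl, hlt⟩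
    · rw [hnm]
      exact realGamma_intCast_mul_nonneg (by push_cast; linarith)
    · rw [hnm, mul_comm]
      exact realGamma_intCast_mul_nonneg (by push_cast; linarith)

lemma leadFactor_pos {a b : ℝ} (h : -1 < 2 * eps a b) (x : ℕ) : 0 < leadFactor a b x := by
  unfold leadFactor
  split_ifs with hx
  · exact half_pos (Real.Gamma_pos_of_pos (by linarith))
  · have hx' : (1 : ℝ) ≤ x := by exact_mod_cast Nat.pos_of_ne_zero hx
    exact mul_pos (by linarith) (Real.Gamma_pos_of_pos (by linarith))

section Admissible

variable {z z' : ℂ} {a b : ℝ}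

lemma weightC_prefactor_pos (ha : -1 < a) (hb : -1 < b) (x : ℕ) :
    0 < leadFactor a b x * Real.Gamma (x + a + 1) /
      (Real.Gamma (x + 1) * Real.Gamma (x + b + 1)) := by
  have : (0 : ℝ) ≤ x := x.cast_nonneg
  have hΓ {s : ℝ} (hs : 0 < s) : 0 < Real.Gamma s := Real.Gamma_pos_of_pos hs
  exact div_pos (mul_pos (leadFactor_pos (by linarith [two_mul_eps a b]) x) (hΓ (by linarith)))
    (mul_pos (hΓ (by linarith)) (hΓ (by linarith)))

lemma weightC_nonneg (ha : -1 < a) (hb : -1 < b) (hz : Admissible z z' a b) (N x : ℕ) :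
    0 ≤ weightC z z' a b N x := by
  have hsub := Gamma_mul_Gamma_nonneg_of_mem_series hz.2.1 ((N : ℤ) - x)
  have hadd := Gamma_mul_Gamma_nonneg_of_mem_series hz.2.2 ((N : ℤ) + x)
  refine mul_nonneg (Complex.zero_le_real.2 (weightC_prefactor_pos ha hb x).le) (inv_nonneg.2 ?_)
  convert mul_nonneg hsub hadd using 1
  push_cast
  ring_nf

lemma weightC_ne_zero (ha : -1 < a) (hb : -1 < b) (hz : Admissible z z' a b) {N x : ℕ}
    (hx : x < N) : weightC z z' a b N x ≠ 0 := by
  obtain ⟨d, rfl⟩ := Nat.exists_eq_add_of_le hx.le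
  have hsub {w w' : ℂ} (h : (w, w') ∈ Zprinc ∪ Zcompl ∪ Zdegen) :
      Complex.Gamma (w - x + (x + d : ℕ)) ≠ 0 := by
    convert Gamma_add_natCast_ne_zero (ne_neg_natCast_of_mem_series h) d using 2
    push_cast
    ring
  have hadd {w w' : ℂ} (h : (w + 2 * (eps a b : ℂ), w') ∈ Zprinc ∪ Zcompl ∪ Zdegen) :
      Complex.Gamma (w + x + (x + d : ℕ) + 2 * (eps a b : ℂ)) ≠ 0 := by
    convert Gamma_add_natCast_ne_zero (ne_neg_natCast_of_mem_series h) (x + (x + d)) using 2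
    push_cast
    ring
  exact mul_ne_zero (Complex.ofReal_ne_zero.2 (weightC_prefactor_pos ha hb x).ne')
    (inv_ne_zero (mul_ne_zero (mul_ne_zero (mul_ne_zero (hsub hz.2.1)
      (hsub (swap_mem_series hz.2.1))) (hadd hz.2.2)) (hadd (swap_mem_series hz.2.2))))

lemma weightC_eq_weight (ha : -1 < a) (hb : -1 < b) (hz : Admissible z z' a b) (N x : ℕ) :
    weightC z z' a b N x = weight z z' a b N x :=
  Complex.eq_re_of_ofReal_le (weightC_nonneg ha hb hz N x)

lemma weight_nonneg (ha : -1 < a) (hb : -1 < b) (hz : Admissible z z' a b) (N x : ℕ) :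
    0 ≤ weight z z' a b N x :=
  (Complex.nonneg_iff.1 (weightC_nonneg ha hb hz N x)).1

lemma weight_pos (ha : -1 < a) (hb : -1 < b) (hz : Admissible z z' a b) {N x : ℕ}
    (hx : x < N) : 0 < weight z z' a b N x := by
  refine (weight_nonneg ha hb hz N x).lt_of_ne' fun h => weightC_ne_zero ha hb hz hx ?_
  rw [weightC_eq_weight ha hb hz, h, Complex.ofReal_zero]

lemma poch_one_sub_ne_zero {w : ℂ} (hw : ∀ l : ℕ, w ≠ -l) {N k : ℕ} (hk : k ≤ N) :
    poch (1 - w - N) k ≠ 0 := by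
  rw [poch_eq_prod, Finset.prod_ne_zero_iff]
  intro j hj h
  obtain ⟨d, rfl⟩ := Nat.exists_eq_add_of_le ((Finset.mem_range.1 hj).trans_le hk)
  refine hw d ?_
  push_cast at h
  linear_combination -h

lemma Gamma_one_add_add_ne_zero (hb : -1 < b) {w w' : ℂ} (hs : -1 < (sig w w' b).re)
    (h : (w, w') ∈ Zprinc ∪ Zcompl ∪ Zdegen) : Complex.Gamma (1 + w + b) ≠ 0 := by
  refine Complex.Gamma_ne_zero fun m hm => ?_
  have him : w.im = 0 := by simpa using congrArg Complex.im hm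
  have hre : 1 + w.re + b = -(m : ℝ) := by simpa using congrArg Complex.re hm
  have : (0 : ℝ) ≤ m := m.cast_nonneg
  have hs' : -1 < w.re + w'.re + b := by simpa [sig] using hs
  rcases h with (h | ⟨-, -, n, h₁, -, -, h₂'⟩) | ⟨-, -, n, hn, h⟩
  · exact im_ne_zero_of_mem_Zprinc h him
  · have hn : (0 : ℝ) < (n + 1 : ℤ) := by push_cast; linarith
    have hn0 : (0 : ℝ) ≤ n := by exact_mod_cast Int.lt_add_one_iff.1 (Int.cast_pos.1 hn)
    linarith
  · have hn' : (1 : ℝ) ≤ n := by exact_mod_cast hn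
    simp only at h
    rcases h with ⟨heq, -⟩ | ⟨-, hlt⟩ <;> linarith

lemma normTop_ne_zero (ha : -1 < a) (hb : -1 < b) (hz : Admissible z z' a b) {N : ℕ}
    (hN : 1 ≤ N) : normTop z z' a b N ≠ 0 := by
  have hN' : (1 : ℝ) ≤ N := by exact_mod_cast hN
  obtain ⟨hsig, hmem, -⟩ := hz
  have hΓ {c : ℂ} (hc : 0 < c.re) : Complex.Gamma c ≠ 0 := Complex.Gamma_ne_zero_of_re_pos hc
  have hone {w w' : ℂ} (h : (w, w') ∈ Zprinc ∪ Zcompl ∪ Zdegen) : Complex.Gamma (1 + w) ≠ 0 := by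
    simpa [add_comm] using Gamma_add_natCast_ne_zero (ne_neg_natCast_of_mem_series h) 1
  have hnum : Complex.Gamma (N + a) * Complex.Gamma N * Complex.Gamma (sig z z' b + 1) *
      Complex.Gamma (sig z z' b + 2) ≠ 0 := by
    refine mul_ne_zero (mul_ne_zero (mul_ne_zero (hΓ ?_) (hΓ ?_)) (hΓ ?_)) (hΓ ?_) <;> simp <;>
      linarith
  have hden : Complex.Gamma (N + sig z z' b + a + 1) * Complex.Gamma (N + sig z z' b + 1) ≠ 0 :=
    mul_ne_zero (hΓ (by simp; linarith)) (hΓ (by simp; linarith))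
  have hz₁ := Gamma_one_add_add_ne_zero hb hsig hmem
  have hz₂ := Gamma_one_add_add_ne_zero hb (sig_comm z z' b ▸ hsig) (swap_mem_series hmem)
  exact div_ne_zero (mul_ne_zero (by norm_num) hnum) (mul_ne_zero (mul_ne_zero (mul_ne_zero
    (mul_ne_zero hden (hone hmem)) (hone (swap_mem_series hmem))) hz₁) hz₂)

lemma weightC_isBigO (hab : -2 < a + b) (z z' : ℂ) (N : ℕ) :
    weightC z z' a b N =O[atTop]
      fun n : ℕ => (n : ℝ) ^ (-1 - 2 * ((sig z z' b).re + 2 * N - 1)) := by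
  have hexp : 1 - 2 * (z + N + (z' + N) + b : ℂ).re =
      -1 - 2 * ((sig z z' b).re + 2 * N - 1) := by
    simp only [sig, Complex.add_re, Complex.natCast_re]
    ring
  rw [funext (weightC_eq_dougallTerm z z' a b N), ← hexp]
  exact dougallTerm_isBigO hab (z + N) (z' + N)

lemma one_add_hat_isBigO (a b : ℝ) :
    (fun x => 1 + hat a b x) =O[atTop] fun n : ℕ => (n : ℝ) ^ 2 := by
  have hconst (c : ℝ) : (fun _ : ℕ => c) =O[atTop] fun n : ℕ => (n : ℝ) :=
    (isLittleO_const_id_atTop c).isBigO.comp_tendsto tendsto_natCast_atTop_atTop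
  have hone : (fun _ : ℕ => (1 : ℝ)) =O[atTop] fun n : ℕ => (n : ℝ) ^ 2 := by
    simpa using (hconst 1).pow 2
  exact hone.add (((isBigO_refl _ _).add (hconst (eps a b))).pow 2)

lemma summable_one_add_hat_pow (ha : -1 < a) (hb : -1 < b) (hz : Admissible z z' a b) {N k : ℕ}
    (hk : k + 2 ≤ 2 * N) :
    Summable fun x => (1 + hat a b x) ^ k * weight z z' a b N x := by
  have hW : weight z z' a b N =O[atTop]
      fun n : ℕ => (n : ℝ) ^ (-1 - 2 * ((sig z z' b).re + 2 * N - 1)) :=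
    Complex.isBigO_ofReal_left.1 ((weightC_isBigO (by linarith) z z' N).congr_left
      (weightC_eq_weight ha hb hz N))
  have hk' : (k : ℝ) + 2 ≤ 2 * N := by exact_mod_cast hk
  have hsum : Summable fun n : ℕ =>
      (n : ℝ) ^ (2 * (k : ℝ) + (-1 - 2 * ((sig z z' b).re + 2 * N - 1))) :=
    Real.summable_nat_rpow.2 (by linarith [hz.1])
  refine summable_of_isBigO_nat hsum ((((one_add_hat_isBigO a b).pow k).mul hW).congr' .rfl ?_)
  filter_upwards [eventually_gt_atTop 0] with n hn
  have hn' : (0 : ℝ) < n := by exact_mod_cast hn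
  rw [Real.rpow_add hn', ← pow_mul, ← Real.rpow_natCast, Nat.cast_mul, Nat.cast_ofNat]

lemma summable_hat_pow (ha : -1 < a) (hb : -1 < b) (hz : Admissible z z' a b) {N k : ℕ}
    (hk : k < 2 * N - 1) :
    Summable fun x => hat a b x ^ k * weight z z' a b N x := by
  have hhat (x : ℕ) : 0 ≤ hat a b x := sq_nonneg _
  have hW := weight_nonneg ha hb hz N
  refine .of_nonneg_of_le (fun x => mul_nonneg (pow_nonneg (hhat x) k) (hW x)) (fun x => ?_)
    (summable_one_add_hat_pow ha hb hz (N := N) (k := k) (by omega))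
  exact mul_le_mul_of_nonneg_right
    (pow_le_pow_left₀ (hhat x) (le_add_of_nonneg_left zero_le_one) k) (hW x)

end Admissible

/-! ### The kernels -/

section Kernel

variable {z z' : ℂ} {a b : ℝ} {N n : ℕ}

lemma orthogonalBelow_of_dualPoly (ha : -1 < a) (hb : -1 < b) (hz : Admissible z z' a b)
    {p : ℂ[X]} (hp : ∀ j < n, HasSum (fun x => p.eval (hat a b x : ℂ) *
      (dualPoly a b (z' + N) j).eval (hat a b x : ℂ) * weightC z z' a b N x) 0) :
    OrthogonalBelow (fun x => (hat a b x : ℂ)) (fun x => (weight z z' a b N x : ℂ)) n p := by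
  intro q hq
  refine (hasSum_mul_eval_eq_zero (dualPoly a b (z' + N))
    (isUnit_leadingCoeff_newtonSequence _) (u := fun x => (hat a b x : ℂ))
    (w := fun x => p.eval (hat a b x : ℂ) * weightC z z' a b N x)
    (fun j hj => (hp j hj).congr_fun fun x => mul_right_comm _ _ _) hq).congr_fun fun x => ?_
  rw [weightC_eq_weight ha hb hz, mul_right_comm]

lemma neretin_orthogonalBelow (ha : -1 < a) (hb : -1 < b) (hz : Admissible z z' a b) {m : ℕ}
    (hn : n ≤ N) (hm : m ≤ n) (hpole : ∀ k : ℕ, decay z z' b N - 2 * n + 1 ≠ -k)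
    (hs : n + m < (sig z z' b).re + 2 * N) :
    OrthogonalBelow (fun x => (hat a b x : ℂ)) (fun x => (weight z z' a b N x : ℂ)) m
      (neretin z z' a b N n) := by
  refine orthogonalBelow_of_dualPoly ha hb hz fun j hj => neretin_pairing_eq_zero ha hb
    (hj.trans_le hm)
    (fun k hk => poch_one_sub_ne_zero (ne_neg_natCast_of_mem_series hz.2.1) (hk.trans hn))
    (fun k hk => poch_one_sub_ne_zero (ne_neg_natCast_of_mem_series (swap_mem_series hz.2.1))
      (hk.trans hn)) hpole ?_
  have : (j : ℝ) + 1 ≤ m := by exact_mod_cast hj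
  rw [decay_re]
  linarith

lemma neretin_monic_of_admissible (ha : -1 < a) (hz : Admissible z z' a b) (hn : n ≤ N)
    (hpole : ∀ k : ℕ, decay z z' b N - 2 * n + 1 ≠ -k) :
    (neretin z z' a b N n).Monic ∧ (neretin z z' a b N n).natDegree = n :=
  neretin_monic ha (poch_one_sub_ne_zero (ne_neg_natCast_of_mem_series hz.2.1) hn)
    (poch_one_sub_ne_zero (ne_neg_natCast_of_mem_series (swap_mem_series hz.2.1)) hn) hpole

lemma decay_ne_pole_pred (hN : 1 ≤ N) (hsig : -1 < (sig z z' b).re) (m : ℕ) :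
    decay z z' b N - 2 * ((N - 1 : ℕ) : ℂ) + 1 ≠ -m := by
  have hdecay : decay z z' b N - 2 * ((N - 1 : ℕ) : ℂ) + 1 = sig z z' b + 2 := by
    rw [decay, Nat.cast_sub hN]
    push_cast
    ring
  rw [hdecay]
  exact ne_neg_natCast_of_re_pos (by rw [Complex.add_re, Complex.re_ofNat]; linarith) m

lemma decay_ne_pole (N : ℕ) (hsig : -1 < (sig z z' b).re) (h0 : sig z z' b ≠ 0) (m : ℕ) :
    decay z z' b N - 2 * N + 1 ≠ -m := by
  have hdecay : decay z z' b N - 2 * N + 1 = sig z z' b := by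
    rw [decay]
    ring
  rw [hdecay]
  rcases m with - | m
  · simpa using h0
  · intro h
    refine ne_neg_natCast_of_re_pos (c := sig z z' b + 1) ?_ m (by rw [h]; push_cast; ring)
    rw [Complex.add_re, Complex.one_re]
    linarith

lemma neretin_pred_isMonicOrthPoly (ha : -1 < a) (hb : -1 < b) (hN : 1 ≤ N)
    (hz : Admissible z z' a b) :
    IsMonicOrthPoly a b (weight z z' a b N) (N - 1) (neretin z z' a b N (N - 1)) := by
  have hpole := decay_ne_pole_pred hN hz.1
  obtain ⟨hmonic, hdeg⟩ := neretin_monic_of_admissible ha hz (Nat.sub_le N 1) hpole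
  refine ⟨hmonic, hdeg, neretin_orthogonalBelow ha hb hz (Nat.sub_le N 1) le_rfl hpole ?_⟩
  rw [Nat.cast_sub hN, Nat.cast_one]
  linarith [hz.1]

lemma neretin_isMonicOrthPoly (ha : -1 < a) (hb : -1 < b) (hz : Admissible z z' a b)
    (hsig : 0 < (sig z z' b).re) :
    IsMonicOrthPoly a b (weight z z' a b N) N (neretin z z' a b N N) := by
  have hpole := decay_ne_pole N hz.1 fun h => hsig.ne' (by rw [h, Complex.zero_re])
  obtain ⟨hmonic, hdeg⟩ := neretin_monic_of_admissible ha hz le_rfl hpole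
  exact ⟨hmonic, hdeg, neretin_orthogonalBelow ha hb hz le_rfl le_rfl hpole (by linarith)⟩

lemma neretin_pred_norm (ha : -1 < a) (hb : -1 < b) (hN : 1 ≤ N) (hz : Admissible z z' a b) :
    HasSum (fun x => (neretin z z' a b N (N - 1)).eval (hat a b x : ℂ) ^ 2 *
      (weight z z' a b N x : ℂ)) (normTop z z' a b N) := by
  have hne := ne_neg_natCast_of_mem_series hz.2.1
  have hne' := ne_neg_natCast_of_mem_series (swap_mem_series hz.2.1)
  refine (neretin_norm ha hb hN (fun k hk => poch_one_sub_ne_zero hne hk.le)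
    (fun k hk => poch_one_sub_ne_zero hne' hk.le) hz.1).congr_fun fun x => ?_
  rw [weightC_eq_weight ha hb hz]

lemma isUnit_det_momentMatrix_weight (ha : -1 < a) (hb : -1 < b) (hz : Admissible z z' a b) :
    IsUnit (momentMatrix (hat a b) (weight z z' a b N) N).det :=
  isUnit_det_momentMatrix (weight_nonneg ha hb hz N) (fun _ => summable_hat_pow ha hb hz)
    ((hat_injective (by linarith [two_mul_eps a b])).comp Fin.val_injective)
    fun i => weight_pos ha hb hz i.2

lemma cdKernel_eq_projectionKernel (ha : -1 < a) (hb : -1 < b) (hN : 1 ≤ N)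
    (hz : Admissible z z' a b) {p : ℂ[X]} (hmonic : p.Monic) (hdeg : p.natDegree = N)
    (horth : OrthogonalBelow (fun x => (hat a b x : ℂ)) (fun x => (weight z z' a b N x : ℂ))
      (N - 1) p) :
    cdKernel z z' a b N p = fun x y =>
      (projectionKernel (hat a b) (weight z z' a b N) N x y : ℂ) := by
  obtain ⟨hq, hqN, hq_orth⟩ := neretin_pred_isMonicOrthPoly ha hb hN hz
  ext x y
  rw [cdKernel, div_mul_eq_mul_div, div_eq_iff (normTop_ne_zero ha hb hz hN),
    mul_comm _ (normTop ..)]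
  exact sqrt_mul_cdQuotient_eq hN (weight_nonneg ha hb hz N)
    (fun _ => summable_hat_pow ha hb hz) (isUnit_det_momentMatrix_weight ha hb hz) hmonic hdeg hq
    hqN horth hq_orth (neretin_pred_norm ha hb hN hz) x y

lemma cdKernel_neretin (ha : -1 < a) (hb : -1 < b) (hN : 1 ≤ N) (hz : Admissible z z' a b)
    (h0 : sig z z' b ≠ 0) :
    cdKernel z z' a b N (neretin z z' a b N N) = fun x y =>
      (projectionKernel (hat a b) (weight z z' a b N) N x y : ℂ) := by
  have hpole := decay_ne_pole N hz.1 h0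
  obtain ⟨hmonic, hdeg⟩ := neretin_monic_of_admissible ha hz le_rfl hpole
  refine cdKernel_eq_projectionKernel ha hb hN hz hmonic hdeg
    (neretin_orthogonalBelow ha hb hz le_rfl (Nat.sub_le N 1) hpole ?_)
  rw [Nat.cast_sub hN, Nat.cast_one]
  linarith [hz.1]

lemma cdKernel_neretinTilde (ha : -1 < a) (hb : -1 < b) (hN : 1 ≤ N)
    (hz : Admissible z z' a b) :
    cdKernel z z' a b N (neretinTilde z z' a b N) = fun x y =>
      (projectionKernel (hat a b) (weight z z' a b N) N x y : ℂ) := by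
  obtain ⟨hmonic, hdeg⟩ := neretinTilde_monic z z' a b N
  exact cdKernel_eq_projectionKernel ha hb hN hz hmonic hdeg (orthogonalBelow_of_dualPoly ha hb hz
    fun j hj => neretinTilde_pairing_eq_zero ha hb (by omega) hz.1)

end Kernel

end ZMeas

open ZMeas in
theorem theorem4p3_general (z z' : ℂ) (a b : ℝ) (N : ℕ) (hN : 1 ≤ N) (ha : -1 < a) (hb : -1 < b)
    (hz : Admissible z z' a b) :
    (∀ x : ℕ, weightC z z' a b N x = (weight z z' a b N x : ℂ) ∧ 0 ≤ weight z z' a b N x) ∧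
    IsProbabilityMeasure (processO z z' a b N) ∧
    IsOrthPolyEnsemble a b N (weight z z' a b N) (processO z z' a b N) ∧
    normTop z z' a b N ≠ 0 ∧
    IsMonicOrthPoly a b (weight z z' a b N) (N - 1) (neretin z z' a b N (N - 1)) ∧
    HasSum (fun x : ℕ => (neretin z z' a b N (N - 1)).eval (hat a b x : ℂ) ^ 2 *
      (weight z z' a b N x : ℂ)) (normTop z z' a b N) ∧
    (0 < (sig z z' b).re →
      IsMonicOrthPoly a b (weight z z' a b N) N (neretin z z' a b N N)) ∧
    (sig z z' b ≠ 0 →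
      IsCorrelationKernel a b (cdKernel z z' a b N (neretin z z' a b N N))
        (processO z z' a b N)) ∧
    IsCorrelationKernel a b (cdKernel z z' a b N (neretinTilde z z' a b N))
      (processO z z' a b N) ∧
    (sig z z' b ≠ 0 → ∀ x y : ℕ,
      cdKernel z z' a b N (neretin z z' a b N N) x y =
        cdKernel z z' a b N (neretinTilde z z' a b N) x y) ∧
    (∀ x y : ℕ, (cdKernel z z' a b N (neretinTilde z z' a b N) x y).im = 0) := by
  have hhat : Function.Injective (hat a b) := hat_injective (by linarith [two_mul_eps a b])
  have hW := weight_nonneg ha hb hz N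
  have hs := summable_zWeight hW (summable_one_add_hat_pow ha hb hz (by omega))
  have hpos := tsum_zWeight_pos hhat hW (fun _ => weight_pos ha hb hz) hs
  have hK := isCorrelationKernel_projectionKernel hhat hW hs hpos
    (fun _ => summable_hat_pow ha hb hz) (isUnit_det_momentMatrix_weight ha hb hz)
  have hp := cdKernel_neretin ha hb hN hz
  have hpTilde := cdKernel_neretinTilde ha hb hN hz
  exact ⟨fun x => ⟨weightC_eq_weight ha hb hz N x, hW x⟩,
    isProbabilityMeasure_processO hW hs hpos, isOrthPolyEnsemble_processO hhat hW hpos,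
    normTop_ne_zero ha hb hz hN, neretin_pred_isMonicOrthPoly ha hb hN hz,
    neretin_pred_norm ha hb hN hz, neretin_isMonicOrthPoly ha hb hz, fun h => (hp h).symm ▸ hK,
    hpTilde.symm ▸ hK, fun h x y => by rw [hp h, hpTilde],
    fun x y => by rw [hpTilde, Complex.ofReal_im]⟩

theorem theorem4p3 (z z' : ℂ) (a b : ℝ) (N : ℕ) (hN : 1 ≤ N)
    (hab : b ≤ a) (hb : -1 / 2 ≤ b) (hz : ZMeas.Admissible z z' a b) :
    -- the weight is real and nonnegative on the half-lattice
    (∀ x : ℕ, ZMeas.weightC z z' a b N x = (ZMeas.weight z z' a b N x : ℂ) ∧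
      0 ≤ ZMeas.weight z z' a b N x) ∧
    -- the process is an orthogonal polynomial ensemble
    MeasureTheory.IsProbabilityMeasure (ZMeas.processO z z' a b N) ∧
    ZMeas.IsOrthPolyEnsemble a b N (ZMeas.weight z z' a b N) (ZMeas.processO z z' a b N) ∧
    -- the top polynomials and the squared norm
    ZMeas.normTop z z' a b N ≠ 0 ∧
    ZMeas.IsMonicOrthPoly a b (ZMeas.weight z z' a b N) (N - 1)
      (ZMeas.neretin z z' a b N (N - 1)) ∧
    HasSum (fun x : ℕ => (ZMeas.neretin z z' a b N (N - 1)).eval (ZMeas.hat a b x : ℂ) ^ 2 *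
      (ZMeas.weight z z' a b N x : ℂ)) (ZMeas.normTop z z' a b N) ∧
    (0 < (ZMeas.sig z z' b).re →
      ZMeas.IsMonicOrthPoly a b (ZMeas.weight z z' a b N) N (ZMeas.neretin z z' a b N N)) ∧
    -- the correlation kernel for `Σ ≠ 0`
    (ZMeas.sig z z' b ≠ 0 →
      ZMeas.IsCorrelationKernel a b (ZMeas.cdKernel z z' a b N (ZMeas.neretin z z' a b N N))
        (ZMeas.processO z z' a b N)) ∧
    -- the alternative formula, valid also for `Σ = 0`
    ZMeas.IsCorrelationKernel a b (ZMeas.cdKernel z z' a b N (ZMeas.neretinTilde z z' a b N))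
      (ZMeas.processO z z' a b N) ∧
    (ZMeas.sig z z' b ≠ 0 → ∀ x y : ℕ,
      ZMeas.cdKernel z z' a b N (ZMeas.neretin z z' a b N N) x y =
        ZMeas.cdKernel z z' a b N (ZMeas.neretinTilde z z' a b N) x y) ∧
    (∀ x y : ℕ, (ZMeas.cdKernel z z' a b N (ZMeas.neretinTilde z z' a b N) x y).im = 0) :=
  theorem4p3_general z z' a b N hN (by linarith) (by linarith) hz
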